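/- Let $1\le k\le n$ and $\rho\in\mathbb R$. Let $\Omega\subset\mathbb R^n$ be a bounded open set with a cubical mesh $\mathcal T_h$: a finite set of nondegenerate closed boxes $T=I_1\times\dots\times I_n$ whose union is $\overline\Omega$, whose interiors lie in $\Omega$, and any two of which are disjoint or intersect in a common face. Assume shape regularity: for every $T$ the length of each edge is at most $\rho$ times the length of any other edge. $\Delta_j(\cdot)$ denotes the set of $j$-dimensional faces; $\langle\cdot,\cdot\rangle$ and $\|\cdot\|$ are the inner product and norm of $L^2\Lambda^j(\Omega)$, where $\langle a,b\rangle_{\rm Alt}=\sum_\sigma a(e_{\sigma_1},\dots,e_{\sigma_j})\,b(e_{\sigma_1},\dots,e_{\sigma_j})$ over increasing $\sigma$. Shape functions: $\mathcal Q_1^-\Lambda^j$ is the space of polynomial $j$-forms $\sum_\sigma u_\sigma dx_\sigma$ such that $u_\sigma$ has degree at most one in each variable and does not depend on $x_{\sigma_1},\dots,x_{\sigma_j}$; $\mathcal B\Lambda^j$ is the span of the forms $p_{\sigma^*}p_\sigma\,dx_\sigma$, where $p_\sigma$ and $p_{\sigma^*}$ are polynomials of degree at most one in each variable, in the variables $x_i$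 with $i\in\{\sigma_1,\dots,\sigma_j\}$ and $i\notin\{\sigma_1,\dots,\sigma_j\}$ respectively, and $p_\sigma(0)=0$; and $\mathcal S_1^+\Lambda^j=\mathcal Q_1^-\Lambda^j+d\kappa\,\mathcal B\Lambda^j$, where $(\kappa u)_x=u_x\lrcorner x$. Then $\mathcal Q_1^-\Lambda^j(\mathcal T_h)$ (resp. $\mathcal S_1^+\Lambda^j(\mathcal T_h)$) is the space of piecewise $\mathcal Q_1^-\Lambda^j$ (resp. $\mathcal S_1^+\Lambda^j$) forms for which the degrees of freedom $\int_f\operatorname{tr}_f u$ (resp. $\int_f \operatorname{tr}_f u\wedge q$ for all polynomials $q$ of degree at most one in each variable), $f\in\Delta_j(\mathcal T_h)$, take the same value from all elements containing $f$. Put $V_h^{k-1}=\mathcal S_1^+\Lambda^{k-1}(\mathcal T_h)$, $V_h^k=\mathcal Q_1^-\Lambda^k(\mathcal T_h)$, $\tilde V_h^{k-1}=\mathcal Q_1^-\Lambda^{k-1}(\mathcal T_h)$, let $W_h^{k-1}$ be the space of piecewise constant $(k-1)$-forms, and, for piecewise continuous $(k-1)$-forms, $$\langle u,v\rangle_h=\sum_{T\in\mathcal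 T_h}\langle u,v\rangle_{h,T},\qquad \langle u,v\rangle_{h,T}=2^{-n}|T|\sum_{x\in\Delta_0(T)}\langle u_x,v_x\rangle_{\rm Alt},$$ where the values at $x$ are taken from $T$; $\|u\|_h=\langle u,u\rangle_h^{1/2}$. Then $V_h^{k-1}\subset H\Lambda^{k-1}(\Omega)$ and $V_h^k\subset H\Lambda^k(\Omega)$, with the elementwise exterior derivative as weak exterior derivative, $dV_h^{k-1}\subset V_h^k$, and there is a constant $C>0$ depending only on $n,k,\rho$ such that the following hold. (A) $\langle\cdot,\cdot\rangle_h$ is a symmetric bilinear form on $V_h^{k-1}$ with $|\langle\sigma,\tau\rangle_h|\le C\|\sigma\|\|\tau\|$, $\|\tau\|^2\le C\langle\tau,\tau\rangle_h$, $\|\tau\|_h\le C\|\tau\|$ and $\|\tau\|\le C\|\tau\|_h$ for all $\sigma,\tau\in V_h^{k-1}$. (B) $W_h^{k-1}\subset L^2\Lambda^{k-1}(\Omega)$, $\tilde V_h^{k-1}\subset V_h^{k-1}$, and $\langle\tau,\tau_0\rangle=\langle\tau,\tau_0\rangle_h$ for $\tau\in\tilde V_h^{k-1}$, $\tau_0\in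 W_h^{k-1}$. There is exactly one linear map $\Pi_h:V_h^{k-1}\to\tilde V_h^{k-1}$ with $\int_f\operatorname{tr}_f\Pi_h\tau=\int_f\operatorname{tr}_f\tau$ for all $\tau\in V_h^{k-1}$ and $f\in\Delta_{k-1}(\mathcal T_h)$, and it satisfies $d\Pi_h\tau=d\tau$, $\|\Pi_h\tau\|\le C\|\tau\|$ and $\langle\Pi_h\tau,\tau_0\rangle_h=\langle\tau,\tau_0\rangle_h$ for all $\tau_0\in W_h^{k-1}$. Moreover, there is exactly one linear map $d_h^*:V_h^k\to V_h^{k-1}$ with $\langle d_h^*u,\tau\rangle_h=\langle u,d\tau\rangle$ for all $u\in V_h^k$, $\tau\in V_h^{k-1}$, and it is local: for every vertex $x$ of the mesh, the values $(d_h^*u)_x$ (from all elements with vertex $x$) depend only on the restriction of $u$ to the union of the elements with vertex $x$. -/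

import Mathlib

open MeasureTheory Set

noncomputable section

namespace CubicalFEEC

/-! ### Differential forms on `ℝⁿ` -/

/-- `ℝⁿ`. Only its topology, its vector space structure and Lebesgue measure are used; the inner
product on alternating forms is written out in `altInner`. -/
abbrev Vec (n : ℕ) : Type := Fin n → ℝ

/-- `Alt^k(ℝⁿ)`. -/
abbrev Alt (n k : ℕ) : Type := (Vec n) [⋀^Fin k]→L[ℝ] ℝ

/-- Differential `k`-forms on `ℝⁿ` (no regularity imposed). -/
abbrev Form (n k : ℕ) : Type := Vec n → Alt n k

/-- The vectors `e_{σ 1}, …, e_{σ k}` of the standard basis; `σ : Fin k ↪o Fin n` is an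
increasing sequence of indices. -/
def basisVec {n k : ℕ} (σ : Fin k ↪o Fin n) : Fin k → Vec n := fun j => Pi.single (σ j) 1

/-- `⟨a, b⟩ = ∑_σ a(e_{σ 1}, …, e_{σ k}) b(e_{σ 1}, …, e_{σ k})`, over increasing `σ`. -/
def altInner {n k : ℕ} (a b : Alt n k) : ℝ :=
  ∑ σ : Fin k ↪o Fin n, a (basisVec σ) * b (basisVec σ)

/-- `dx_σ = dx_{σ 1} ∧ ⋯ ∧ dx_{σ k}`, that is `(v_1, …, v_k) ↦ det ((v_i)_{σ j})`. -/
def dx {n k : ℕ} (σ : Fin k ↪o Fin n) : Alt n k :=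
  { (Matrix.detRowAlternating (R := ℝ) (n := Fin k)).compLinearMap (LinearMap.funLeft ℝ ℝ σ) with
    cont := by
      change Continuous fun v : Fin k → Vec n =>
        Matrix.det (Matrix.of fun i j => v i (σ j))
      exact Continuous.matrix_det (by fun_prop) }

theorem dx_apply {n k : ℕ} (σ : Fin k ↪o Fin n) (v : Fin k → Vec n) :
    dx σ v = Matrix.det (Matrix.of fun i j => v i (σ j)) := rfl

/-- The Koszul operator `(κ u)_x = u_x ⌟ x`. -/
def koszul {n k : ℕ} (u : Form n (k + 1)) : Form n k := fun x => (u x).curryLeft x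

/-- `⟨u, v⟩ = ∫_Ω ⟨u_x, v_x⟩ dx`. -/
def l2Inner {n k : ℕ} (Ω : Set (Vec n)) (u v : Form n k) : ℝ := ∫ x in Ω, altInner (u x) (v x)

/-- `‖u‖ = ⟨u, u⟩^{1/2}`. -/
def l2Norm {n k : ℕ} (Ω : Set (Vec n)) (u : Form n k) : ℝ := √(l2Inner Ω u u)

/-- `u ∈ L²Λ^k(Ω)`. -/
def MemL2 {n k : ℕ} (Ω : Set (Vec n)) (u : Form n k) : Prop :=
  ∀ t : Fin k → Vec n, MemLp (fun x => u x t) 2 (volume.restrict Ω)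

/-- `w = du` in the sense of distributions on `Ω`: the formula
`w(t_0, …, t_k) = ∑_j (-1)^j ∂_{t_j} u(t_0, …, t̂_j, …, t_k)`, with weak directional derivatives. -/
def IsWeakExtDeriv {n k : ℕ} (Ω : Set (Vec n)) (u : Form n k) (w : Form n (k + 1)) : Prop :=
  ∀ φ : Vec n → ℝ, ContDiff ℝ (⊤ : ℕ∞) φ → HasCompactSupport φ → tsupport φ ⊆ Ω →
    ∀ t : Fin (k + 1) → Vec n,
      ∫ x in Ω, φ x * w x t =
        - ∑ j : Fin (k + 1), (-1 : ℝ) ^ (j : ℕ) *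
            ∫ x in Ω, fderiv ℝ φ x (t j) * u x (j.removeNth t)

/-- `u ∈ HΛ^k(Ω)` and `du = w`. -/
def MemHLambda {n k : ℕ} (Ω : Set (Vec n)) (u : Form n k) (w : Form n (k + 1)) : Prop :=
  MemL2 Ω u ∧ MemL2 Ω w ∧ IsWeakExtDeriv Ω u w

/-! ### Polynomial spaces of forms -/

/-- The square-free monomial `∏_{i ∈ s} x_i`. -/
def mono {n : ℕ} (s : Finset (Fin n)) (x : Vec n) : ℝ := ∏ i ∈ s, x i

/-- `𝒬₁(ℝⁿ)`: polynomials of degree at most one in each variable. -/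
def Q1 (n : ℕ) : Submodule ℝ (Vec n → ℝ) := Submodule.span ℝ (range mono)

/-- The form monomial `(∏_{i ∈ s} x_i) dx_σ`. -/
def formMono {n k : ℕ} (s : Finset (Fin n)) (σ : Fin k ↪o Fin n) : Form n k :=
  fun x => mono s x • dx σ

/-- `𝒬₁⁻Λ^k`: the coefficient of `dx_σ` lies in `𝒬₁` and does not involve the variables
`x_{σ 1}, …, x_{σ k}`. -/
def Q1minus (n k : ℕ) : Submodule ℝ (Form n k) :=
  Submodule.span ℝ {u | ∃ (s : Finset (Fin n)) (σ : Fin k ↪o Fin n),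
    (∀ i ∈ s, i ∉ range σ) ∧ u = formMono s σ}

/-- `ℬΛ^k`: the span of the forms `p_{σ*} p_σ dx_σ` where `p_σ ∈ 𝒬₁` in the variables
`x_{σ 1}, …, x_{σ k}`, `p_{σ*} ∈ 𝒬₁` in the other variables, and `p_σ(0) = 0`. In terms of
monomials: at least one of the variables `x_{σ 1}, …, x_{σ k}` occurs. -/
def BLambda (n k : ℕ) : Submodule ℝ (Form n k) :=
  Submodule.span ℝ {u | ∃ (s : Finset (Fin n)) (σ : Fin k ↪o Fin n),
    (∃ i ∈ s, i ∈ range σ) ∧ u = formMono s σ}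

/-- `𝒮₁⁺Λ^k = 𝒬₁⁻Λ^k + dκ ℬΛ^k` (on `0`-forms `κ = 0`, so the second summand vanishes). -/
def S1plus (n : ℕ) : (k : ℕ) → Submodule ℝ (Form n k)
  | 0 => Q1minus n 0
  | k + 1 => Q1minus n (k + 1) ⊔
      Submodule.span ℝ ((fun u => extDeriv (koszul u)) '' (BLambda n (k + 1) : Set (Form n (k + 1))))

/-! ### Cubical meshes -/

/-- A Cartesian product `∏ [lo i, hi i]` of closed intervals, some of which may be points. -/
@[ext]
structure Cell (n : ℕ) where
  lo : Vec n
  hi : Vec n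
  le : lo ≤ hi

namespace Cell

variable {n : ℕ}

/-- The underlying closed set. -/
def toSet (T : Cell n) : Set (Vec n) := Icc T.lo T.hi

/-- The coordinate directions in which the cell has positive length. -/
def dirs (T : Cell n) : Finset (Fin n) := {i | T.lo i < T.hi i}

/-- The dimension of the cell. -/
def dim (T : Cell n) : ℕ := T.dirs.card

/-- `Δ₀(T)`: the vertices of the cell. -/
def vertices (T : Cell n) : Finset (Vec n) := Fintype.piFinset fun i => {T.lo i, T.hi i}

/-- `f ∈ Δ(T)`: each factor of `f` is the corresponding factor of `T` or one of its endpoints. -/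
def IsFace (f T : Cell n) : Prop :=
  ∀ i, (f.lo i = T.lo i ∧ f.hi i = T.hi i) ∨ (f.lo i = T.lo i ∧ f.hi i = T.lo i) ∨
    (f.lo i = T.hi i ∧ f.hi i = T.hi i)

/-- The directions of a `k`-dimensional cell, as an increasing sequence. -/
def tangent {k : ℕ} (f : Cell n) (hf : f.dim = k) : Fin k ↪o Fin n := f.dirs.orderEmbOfFin hf

/-- The product of Lebesgue measures in the directions of `f` and of Dirac masses in the fixed
coordinates; restricted to `f` it is the surface measure of `f`. -/
def planeMeasure (f : Cell n) : Measure (Vec n) := by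
  classical
  exact Measure.pi fun i => if f.lo i < f.hi i then volume else Measure.dirac (f.lo i)

/-- `∫_f tr_f u ∧ q` for a `k`-form `u`, a `k`-dimensional cell `f` (oriented by the order of the
coordinates) and a function `q`. -/
def traceIntegral {k : ℕ} (f : Cell n) (hf : f.dim = k) (u : Form n k) (q : Vec n → ℝ) : ℝ :=
  ∫ x in f.toSet, u x (basisVec (f.tangent hf)) * q x ∂f.planeMeasure

end Cell

/-- `𝒯` is a cubical mesh of the open set `Ω`: finitely many closed boxes that fill `Ω`, any two of
which are disjoint or meet in a common face. -/
structure IsCubicalMesh {n : ℕ} (Ω : Set (Vec n)) (𝒯 : Finset (Cell n)) : Prop where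
  isOpen : IsOpen Ω
  lt : ∀ T ∈ 𝒯, ∀ i, T.lo i < T.hi i
  interior_subset : ∀ T ∈ 𝒯, interior T.toSet ⊆ Ω
  closure_eq : closure Ω = ⋃ T ∈ 𝒯, T.toSet
  conforming : ∀ T ∈ 𝒯, ∀ T' ∈ 𝒯, (T.toSet ∩ T'.toSet).Nonempty →
    ∃ f : Cell n, f.IsFace T ∧ f.IsFace T' ∧ f.toSet = T.toSet ∩ T'.toSet

/-- Shape regularity with constant `ρ`: the edge lengths of each element are comparable. -/
def ShapeRegular {n : ℕ} (ρ : ℝ) (𝒯 : Finset (Cell n)) : Prop :=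
  ∀ T ∈ 𝒯, ∀ i j, T.hi i - T.lo i ≤ ρ * (T.hi j - T.lo j)

/-! ### Piecewise forms and the finite element spaces -/

/-- Piecewise `k`-forms: one form for each element. A function of this kind is double-valued at
interelement boundaries; `u T x` is the value at `x` taken from the element `T`. The finite element
functions are polynomial on every element `T`, and `u T` is that polynomial. -/
abbrev Broken {n : ℕ} (𝒯 : Finset (Cell n)) (k : ℕ) : Type := (T : 𝒯) → Form n k

/-- The piecewise form as an almost everywhere defined form on `Ω`. -/
def glue {n k : ℕ} {𝒯 : Finset (Cell n)} (u : Broken 𝒯 k) : Form n k :=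
  fun x => ∑ T : 𝒯, (interior T.1.toSet).indicator (u T) x

/-- The elementwise exterior derivative. -/
def brokenD {n k : ℕ} {𝒯 : Finset (Cell n)} (u : Broken 𝒯 k) : Broken 𝒯 (k + 1) :=
  fun T => extDeriv (u T)

section Helpers

variable {n k : ℕ}

theorem contDiff_formMono (s : Finset (Fin n)) (σ : Fin k ↪o Fin n) :
    ContDiff ℝ (⊤ : ℕ∞) (formMono s σ) := by
  have h : ContDiff ℝ (⊤ : ℕ∞) (mono s) := by
    unfold mono
    exact contDiff_prod fun i _ => contDiff_apply ℝ ℝ i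
  exact h.smul contDiff_const

theorem contDiff_of_mem_span {S : Set (Form n k)} (hS : ∀ u ∈ S, ContDiff ℝ (⊤ : ℕ∞) u)
    {u : Form n k} (hu : u ∈ Submodule.span ℝ S) : ContDiff ℝ (⊤ : ℕ∞) u := by
  induction hu using Submodule.span_induction with
  | mem x h => exact hS x h
  | zero => exact contDiff_const
  | add x y _ _ hx hy => exact hx.add hy
  | smul a x _ hx => exact contDiff_const.smul hx

theorem contDiff_of_mem_Q1minus {u : Form n k} (hu : u ∈ Q1minus n k) :
    ContDiff ℝ (⊤ : ℕ∞) u := by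
  refine contDiff_of_mem_span ?_ hu
  rintro _ ⟨s, σ, -, rfl⟩
  exact contDiff_formMono s σ

theorem contDiff_of_mem_BLambda {u : Form n k} (hu : u ∈ BLambda n k) :
    ContDiff ℝ (⊤ : ℕ∞) u := by
  refine contDiff_of_mem_span ?_ hu
  rintro _ ⟨s, σ, -, rfl⟩
  exact contDiff_formMono s σ

theorem contDiff_koszul {u : Form n (k + 1)} (hu : ContDiff ℝ (⊤ : ℕ∞) u) :
    ContDiff ℝ (⊤ : ℕ∞) (koszul u) := by
  have h : ContDiff ℝ (⊤ : ℕ∞) fun x => (u x).curryLeft :=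
    (show ContDiff ℝ (⊤ : ℕ∞) (ContinuousAlternatingMap.curryLeftLI :
      Alt n (k + 1) →ₗᵢ[ℝ] (Vec n →L[ℝ] Alt n k)) from LinearIsometry.contDiff _).comp hu
  exact h.clm_apply contDiff_id

theorem contDiff_extDeriv {u : Form n k} (hu : ContDiff ℝ (⊤ : ℕ∞) u) :
    ContDiff ℝ (⊤ : ℕ∞) (extDeriv u) := by
  have h : ContDiff ℝ (⊤ : ℕ∞) (fderiv ℝ u) := hu.fderiv_right (by simp)
  exact (ContinuousAlternatingMap.alternatizeUncurryFinCLM ℝ (Vec n) ℝ).contDiff.comp h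

theorem contDiff_of_mem_S1plus {u : Form n k} (hu : u ∈ S1plus n k) :
    ContDiff ℝ (⊤ : ℕ∞) u := by
  cases k with
  | zero => exact contDiff_of_mem_Q1minus hu
  | succ k =>
    obtain ⟨a, ha, b, hb, rfl⟩ := Submodule.mem_sup.1 hu
    refine (contDiff_of_mem_Q1minus ha).add (contDiff_of_mem_span ?_ hb)
    rintro _ ⟨w, hw, rfl⟩
    exact contDiff_extDeriv (contDiff_koszul (contDiff_of_mem_BLambda hw))

theorem continuous_of_mem_Q1 {q : Vec n → ℝ} (hq : q ∈ Q1 n) : Continuous q := by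
  induction hq using Submodule.span_induction with
  | mem x h =>
    obtain ⟨s, rfl⟩ := h
    unfold mono
    fun_prop
  | zero => exact continuous_const
  | add x y _ _ hx hy => exact hx.add hy
  | smul a x _ hx => exact continuous_const.smul hx

instance (f : Cell n) : IsLocallyFiniteMeasure f.planeMeasure := by
  classical
  have h1 : ∀ i, SigmaFinite (if f.lo i < f.hi i then (volume : Measure ℝ)
      else Measure.dirac (f.lo i)) := fun i => by split_ifs <;> infer_instance
  have h2 : ∀ i, IsLocallyFiniteMeasure (if f.lo i < f.hi i then (volume : Measure ℝ)
      else Measure.dirac (f.lo i)) := fun i => by split_ifs <;> infer_instance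
  unfold Cell.planeMeasure
  infer_instance

theorem integrableOn_trace (f : Cell n) (hf : f.dim = k) {u : Form n k} {q : Vec n → ℝ}
    (hu : Continuous u) (hq : Continuous q) :
    IntegrableOn (fun x => u x (basisVec (f.tangent hf)) * q x) f.toSet f.planeMeasure := by
  have h : Continuous fun x => u x (basisVec (f.tangent hf)) :=
    (ContinuousAlternatingMap.apply ℝ (Vec n) ℝ (basisVec (f.tangent hf))).continuous.comp hu
  exact (h.mul hq).continuousOn.integrableOn_compact isCompact_Icc

theorem traceIntegral_add (f : Cell n) (hf : f.dim = k) {u v : Form n k} {q : Vec n → ℝ}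
    (hu : Continuous u) (hv : Continuous v) (hq : Continuous q) :
    f.traceIntegral hf (u + v) q = f.traceIntegral hf u q + f.traceIntegral hf v q := by
  unfold Cell.traceIntegral
  rw [← integral_add (integrableOn_trace f hf hu hq) (integrableOn_trace f hf hv hq)]
  refine integral_congr_ae (Filter.Eventually.of_forall fun x => ?_)
  simp [add_mul]

theorem traceIntegral_smul (f : Cell n) (hf : f.dim = k) (c : ℝ) (u : Form n k) (q : Vec n → ℝ) :
    f.traceIntegral hf (c • u) q = c * f.traceIntegral hf u q := by
  unfold Cell.traceIntegral
  rw [← integral_const_mul]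
  refine integral_congr_ae (Filter.Eventually.of_forall fun x => ?_)
  simp [mul_assoc]

theorem traceIntegral_zero (f : Cell n) (hf : f.dim = k) (q : Vec n → ℝ) :
    f.traceIntegral hf (0 : Form n k) q = 0 := by
  simp [Cell.traceIntegral]

theorem altInner_add_left (a b c : Alt n k) :
    altInner (a + b) c = altInner a c + altInner b c := by
  simp [altInner, add_mul, Finset.sum_add_distrib]

theorem altInner_smul_left (r : ℝ) (a c : Alt n k) : altInner (r • a) c = r * altInner a c := by
  simp [altInner, mul_assoc, Finset.mul_sum]

theorem altInner_comm (a b : Alt n k) : altInner a b = altInner b a := by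
  simp [altInner, mul_comm]

end Helpers

/-- `𝒬₁⁻Λ^k(𝒯)`: piecewise `𝒬₁⁻Λ^k`, such that the degrees of freedom `∫_f tr_f u`, `f ∈ Δ_k(𝒯)`,
are single-valued. -/
def Q1minusMesh {n : ℕ} (𝒯 : Finset (Cell n)) (k : ℕ) : Submodule ℝ (Broken 𝒯 k) where
  carrier := {u | (∀ T, u T ∈ Q1minus n k) ∧
    ∀ (f : Cell n) (hf : f.dim = k) (T T' : 𝒯), f.IsFace T → f.IsFace T' →
      f.traceIntegral hf (u T) 1 = f.traceIntegral hf (u T') 1}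
  zero_mem' := ⟨fun _ => Submodule.zero_mem _, fun _ _ _ _ _ _ => rfl⟩
  add_mem' := by
    rintro u v ⟨hu, hu'⟩ ⟨hv, hv'⟩
    refine ⟨fun T => Submodule.add_mem _ (hu T) (hv T), fun f hf T T' h h' => ?_⟩
    have cu := fun T => (contDiff_of_mem_Q1minus (hu T)).continuous
    have cv := fun T => (contDiff_of_mem_Q1minus (hv T)).continuous
    have c1 : Continuous (1 : Vec n → ℝ) := continuous_const
    simp only [Pi.add_apply]
    rw [traceIntegral_add f hf (cu T) (cv T) c1, traceIntegral_add f hf (cu T') (cv T') c1,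
      hu' f hf T T' h h', hv' f hf T T' h h']
  smul_mem' := by
    rintro c u ⟨hu, hu'⟩
    refine ⟨fun T => Submodule.smul_mem _ c (hu T), fun f hf T T' h h' => ?_⟩
    simp only [Pi.smul_apply]
    rw [traceIntegral_smul, traceIntegral_smul, hu' f hf T T' h h']

/-- `𝒮₁⁺Λ^k(𝒯)`: piecewise `𝒮₁⁺Λ^k`, such that the degrees of freedom `∫_f tr_f u ∧ q`,
`q ∈ 𝒬₁(f)`, `f ∈ Δ_k(𝒯)`, are single-valued. -/
def S1plusMesh {n : ℕ} (𝒯 : Finset (Cell n)) (k : ℕ) : Submodule ℝ (Broken 𝒯 k) where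
  carrier := {u | (∀ T, u T ∈ S1plus n k) ∧
    ∀ (f : Cell n) (hf : f.dim = k) (T T' : 𝒯), f.IsFace T → f.IsFace T' → ∀ q ∈ Q1 n,
      f.traceIntegral hf (u T) q = f.traceIntegral hf (u T') q}
  zero_mem' := ⟨fun _ => Submodule.zero_mem _, fun _ _ _ _ _ _ _ _ => rfl⟩
  add_mem' := by
    rintro u v ⟨hu, hu'⟩ ⟨hv, hv'⟩
    refine ⟨fun T => Submodule.add_mem _ (hu T) (hv T), fun f hf T T' h h' q hq => ?_⟩
    have cu := fun T => (contDiff_of_mem_S1plus (hu T)).continuous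
    have cv := fun T => (contDiff_of_mem_S1plus (hv T)).continuous
    have c1 := continuous_of_mem_Q1 hq
    simp only [Pi.add_apply]
    rw [traceIntegral_add f hf (cu T) (cv T) c1, traceIntegral_add f hf (cu T') (cv T') c1,
      hu' f hf T T' h h' q hq, hv' f hf T T' h h' q hq]
  smul_mem' := by
    rintro c u ⟨hu, hu'⟩
    refine ⟨fun T => Submodule.smul_mem _ c (hu T), fun f hf T T' h h' q hq => ?_⟩
    simp only [Pi.smul_apply]
    rw [traceIntegral_smul, traceIntegral_smul, hu' f hf T T' h h' q hq]

/-- `W_h`: the piecewise constant `k`-forms. -/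
def piecewiseConst {n : ℕ} (𝒯 : Finset (Cell n)) (k : ℕ) : Submodule ℝ (Broken 𝒯 k) where
  carrier := {u | ∀ T, ∃ a : Alt n k, u T = fun _ => a}
  zero_mem' := fun _ => ⟨0, rfl⟩
  add_mem' := fun hu hv T => by
    obtain ⟨a, ha⟩ := hu T
    obtain ⟨b, hb⟩ := hv T
    exact ⟨a + b, by rw [Pi.add_apply, ha, hb]; rfl⟩
  smul_mem' := fun c u hu T => by
    obtain ⟨a, ha⟩ := hu T
    exact ⟨c • a, by rw [Pi.smul_apply, ha]; rfl⟩

/-- `⟨u, v⟩_{h,T} = 2^{-n} |T| ∑_{x ∈ Δ₀(T)} ⟨u_x, v_x⟩`. -/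
def quadLocal {n k : ℕ} (T : Cell n) (u v : Form n k) : ℝ :=
  ((2 : ℝ) ^ n)⁻¹ * volume.real T.toSet * ∑ x ∈ T.vertices, altInner (u x) (v x)

/-- The bilinear form `⟨u, v⟩_h = ∑_T ⟨u, v⟩_{h,T}`. -/
def quadForm {n k : ℕ} (𝒯 : Finset (Cell n)) : LinearMap.BilinForm ℝ (Broken 𝒯 k) :=
  LinearMap.mk₂ ℝ (fun u v => ∑ T : 𝒯, quadLocal T.1 (u T) (v T))
    (fun u u' v => by
      simp [quadLocal, altInner_add_left, Finset.sum_add_distrib, mul_add])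
    (fun c u v => by
      simp only [quadLocal, altInner_smul_left, Pi.smul_apply, ← Finset.mul_sum, smul_eq_mul]
      rw [Finset.mul_sum]
      exact Finset.sum_congr rfl fun T _ => by ring)
    (fun u v v' => by
      simp [quadLocal, altInner_comm (u _ _), altInner_add_left, Finset.sum_add_distrib, mul_add])
    (fun c u v => by
      simp only [quadLocal, altInner_comm (u _ _), altInner_smul_left, Pi.smul_apply,
        ← Finset.mul_sum, smul_eq_mul]
      rw [Finset.mul_sum]
      exact Finset.sum_congr rfl fun T _ => by ring)

/-- `‖u‖_h = ⟨u, u⟩_h^{1/2}`. -/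
def quadNorm {n k : ℕ} {𝒯 : Finset (Cell n)} (u : Broken 𝒯 k) : ℝ := √(quadForm 𝒯 u u)

/-- `Π : 𝒮₁⁺Λ^k(𝒯) → 𝒬₁⁻Λ^k(𝒯)` preserves the degrees of freedom of `𝒬₁⁻Λ^k(𝒯)`:
`∫_f tr_f Π u = ∫_f tr_f u` for all `f ∈ Δ_k(𝒯)`. -/
def PreservesDOF {n k : ℕ} {𝒯 : Finset (Cell n)}
    (P : S1plusMesh 𝒯 k →ₗ[ℝ] Q1minusMesh 𝒯 k) : Prop :=
  ∀ (u : S1plusMesh 𝒯 k) (f : Cell n) (hf : f.dim = k) (T : 𝒯), f.IsFace T →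
    f.traceIntegral hf ((P u).1 T) 1 = f.traceIntegral hf (u.1 T) 1

/-- `D` is the discrete coderivative: `⟨D u, τ⟩_h = ⟨u, dτ⟩` for all `u ∈ 𝒬₁⁻Λ^{k+1}(𝒯)` and
`τ ∈ 𝒮₁⁺Λ^k(𝒯)`. -/
def IsDiscreteCoderivative {n k : ℕ} (Ω : Set (Vec n)) {𝒯 : Finset (Cell n)}
    (D : Q1minusMesh 𝒯 (k + 1) →ₗ[ℝ] S1plusMesh 𝒯 k) : Prop :=
  ∀ (u : Q1minusMesh 𝒯 (k + 1)) (τ : S1plusMesh 𝒯 k),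
    quadForm 𝒯 (D u).1 τ.1 = l2Inner Ω (glue u.1) (glue (brokenD τ.1))

/-- Locality: at each vertex `x` of the mesh, the values `(D u)_x` (from all elements with vertex
`x`) only depend on the restriction of `u` to the macroelement formed by the elements with
vertex `x`. -/
def IsLocalAtVertices {n k : ℕ} {𝒯 : Finset (Cell n)}
    (D : Q1minusMesh 𝒯 (k + 1) →ₗ[ℝ] S1plusMesh 𝒯 k) : Prop :=
  ∀ (x : Vec n) (u u' : Q1minusMesh 𝒯 (k + 1)),
    (∀ T : 𝒯, x ∈ T.1.vertices → EqOn (u.1 T) (u'.1 T) T.1.toSet) →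
      ∀ T : 𝒯, x ∈ T.1.vertices → (D u).1 T x = (D u').1 T x

end CubicalFEEC

end

open CubicalFEEC

/-!
The shape functions are studied through their coefficients `u_a = u(e_{a 1}, …, e_{a k})` and
through their values at the vertices of boxes. The space `𝒮₁⁺Λ^k` is enclosed in the larger space
`Kform n k` of the forms `u = w - κ c` with `w`, `c` multilinear and `du ∈ 𝒬₁⁻Λ^{k+1}`; this space
is invariant under translations and dilations of the coordinates, and unisolvence, the projection
and the norm estimates are treated on it.

*Unisolvence.* On a cell `F` one has `u_a = W_a - ∑ⱼ (xⱼ - loⱼ)(xⱼ - hiⱼ) ∂ⱼ c_{ja}` with `W_a`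
multilinear (`exists_vertex_decomposition`). At the vertices `u_a = W_a`, while `(du)_ω` is the
exterior derivative of `W` minus the graph Laplacian of `c_ω` in the directions `ω`. Since `(du)_ω`
does not depend on the variables in `ω`, summation against it over the vertices kills the
Laplacian. Therefore vanishing tangential vertex values on `F` imply `du = 0` tangentially, then
harmonicity of `c_ω`, and finally that the trace of `u` vanishes (`coef_eq_zero_on_hull`). So a
form is determined by its vertex values, and single-valued degrees of freedom are the same as
tangential continuity at the vertices (`mem_S1plusMesh_iff`). Conversely all vertex values occur in
`𝒮₁⁺Λ^k` (`exists_S1plus_vertex`), because `b ↦ dκb + freeze b` followed by interpolation at the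
vertices is an injective, hence surjective, endomorphism of the multilinear forms; injectivity rests
on Cartan's formula for `dκ + κd` and Euler's equation.

*Conformity.* Tangentially continuous forms have a weak exterior derivative: `φ du(t)` differs
from the terms with derivatives of `φ` by the divergence of `φ` times the field `flux u t`. By the
divergence theorem on each box only integrals over facets remain, and they cancel along almost every
line parallel to a coordinate axis, because consecutive elements on such a line share a face through
which the flux is continuous (`IsCubicalMesh.sum_crossed_eq`, `IsCubicalMesh.isWeakExtDeriv`).

*Norms.* On the unit cube the norm and the lumped norm are equivalent on `Kform n k`, by
unisolvence and finite dimension. The pullback of forms transports this to any box; the factors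
`∏ⱼ h_{σ j}` which it introduces are comparable for all `σ` by shape regularity
(`exists_local_norm_equivalence`).

*Projection and coderivative.* The projection is local: interpolate at the vertices, then freeze
the variables `x_{σ 1}, …, x_{σ k}` of the coefficient `u_σ` at the barycentre. This averages the
vertex values over reflections, so it is a contraction for `⟨·,·⟩_h` and preserves products with
constants, and it commutes with `d` by the discrete Stokes argument above (`extDeriv_proj`). The
coderivative exists because `⟨·,·⟩_h` is definite, and it is local because there are functions in
`𝒮₁⁺Λ^k(𝒯)` with prescribed admissible values at one vertex and zero at all others.
-/

noncomputable section

namespace CubicalFEEC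

open Function

/-! ### Functions of degree at most one in each variable -/

/-- The partial derivative `∂ᵢ g`. -/
def pd {n : ℕ} (i : Fin n) (g : Vec n → ℝ) : Vec n → ℝ := fun x => fderiv ℝ g x (Pi.single i 1)

section Multilinear
variable {n : ℕ}

theorem hasDerivAt_comp_update {g : Vec n → ℝ} (hg : Differentiable ℝ g) (x : Vec n) (i : Fin n)
    (t : ℝ) : HasDerivAt (fun s => g (update x i s)) (pd i g (update x i t)) t :=
  (hg _).hasFDerivAt.comp_hasDerivAt t (hasDerivAt_update x i t)

theorem mono_update (s : Finset (Fin n)) (x : Vec n) (i : Fin n) (t : ℝ) :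
    mono s (update x i t) = if i ∈ s then t * mono (s.erase i) x else mono s x := by
  unfold mono
  split_ifs with h
  · rw [← Finset.mul_prod_erase s _ h, update_self]
    congr 1
    exact Finset.prod_congr rfl fun j hj => update_of_ne (Finset.ne_of_mem_erase hj) _ _
  · exact Finset.prod_congr rfl fun j hj => update_of_ne (by rintro rfl; exact h hj) _ _

theorem contDiff_mono (s : Finset (Fin n)) : ContDiff ℝ (⊤ : ℕ∞) (mono s) := by
  unfold mono
  exact contDiff_prod fun i _ => contDiff_apply ℝ ℝ i

theorem pd_mono (i : Fin n) (s : Finset (Fin n)) :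
    pd i (mono s) = if i ∈ s then mono (s.erase i) else 0 := by
  funext x
  have h := hasDerivAt_comp_update ((contDiff_mono s).differentiable (by simp)) x i (x i)
  rw [update_eq_self] at h
  refine h.unique ?_
  simp only [mono_update]
  split_ifs with hi
  · simpa using (hasDerivAt_id (x i)).mul_const (mono (s.erase i) x)
  · simpa using hasDerivAt_const (x i) (mono s x)

theorem contDiff_of_mem_Q1 {g : Vec n → ℝ} (hg : g ∈ Q1 n) : ContDiff ℝ (⊤ : ℕ∞) g := by
  induction hg using Submodule.span_induction with
  | mem x h =>
    obtain ⟨s, rfl⟩ := h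
    exact contDiff_mono s
  | zero => exact contDiff_const
  | add x y _ _ hx hy => exact hx.add hy
  | smul a x _ hx => exact contDiff_const.smul hx

theorem differentiable_of_mem_Q1 {g : Vec n → ℝ} (hg : g ∈ Q1 n) : Differentiable ℝ g :=
  (contDiff_of_mem_Q1 hg).differentiable (by simp)

theorem pd_add (i : Fin n) {f g : Vec n → ℝ} (hf : Differentiable ℝ f)
    (hg : Differentiable ℝ g) : pd i (f + g) = pd i f + pd i g := by
  funext x
  simp [pd, fderiv_add (hf x) (hg x)]

theorem pd_sub (i : Fin n) {f g : Vec n → ℝ} (hf : Differentiable ℝ f)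
    (hg : Differentiable ℝ g) : pd i (f - g) = pd i f - pd i g := by
  funext x
  simp [pd, fderiv_sub (hf x) (hg x)]

theorem pd_smul (i : Fin n) (c : ℝ) {f : Vec n → ℝ} (hf : Differentiable ℝ f) :
    pd i (c • f) = c • pd i f := by
  funext x
  simp [pd, fderiv_const_smul (hf x)]

theorem pd_mul (i : Fin n) {f g : Vec n → ℝ} (hf : Differentiable ℝ f)
    (hg : Differentiable ℝ g) : pd i (f * g) = pd i f * g + f * pd i g := by
  funext x
  simp [pd, fderiv_mul (hf x) (hg x)]
  ring

@[simp]
theorem pd_zero (i : Fin n) : pd i (0 : Vec n → ℝ) = 0 := by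
  funext x
  simp only [pd, Pi.zero_apply]
  rw [fderiv_zero]
  rfl

theorem pd_sum {ι : Type*} (i : Fin n) (s : Finset ι) {f : ι → Vec n → ℝ}
    (hf : ∀ j ∈ s, Differentiable ℝ (f j)) : pd i (∑ j ∈ s, f j) = ∑ j ∈ s, pd i (f j) := by
  funext x
  simp only [pd]
  rw [fderiv_sum fun j hj => hf j hj x]
  simp [pd]

theorem pd_coord (i j : Fin n) : pd i (fun x : Vec n => x j) = fun _ => if i = j then 1 else 0 := by
  funext x
  have : fderiv ℝ (fun x : Vec n => x j) x = ContinuousLinearMap.proj j :=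
    (ContinuousLinearMap.proj (R := ℝ) (φ := fun _ : Fin n => ℝ) j).fderiv
  simp [pd, this, Pi.single_apply, eq_comm]

theorem pd_mem_Q1 (i : Fin n) {g : Vec n → ℝ} (hg : g ∈ Q1 n) : pd i g ∈ Q1 n := by
  induction hg using Submodule.span_induction with
  | mem x h =>
    obtain ⟨s, rfl⟩ := h
    rw [pd_mono]
    split_ifs
    · exact Submodule.subset_span ⟨_, rfl⟩
    · exact Submodule.zero_mem _
  | zero => simp
  | add x y hx hy h1 h2 =>
    rw [pd_add i (differentiable_of_mem_Q1 hx) (differentiable_of_mem_Q1 hy)]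
    exact Submodule.add_mem _ h1 h2
  | smul a x hx h =>
    rw [pd_smul i a (differentiable_of_mem_Q1 hx)]
    exact Submodule.smul_mem _ a h

/-- A member of `𝒬₁` is affine in each variable. -/
theorem apply_update_of_mem_Q1 {g : Vec n → ℝ} (hg : g ∈ Q1 n) (x : Vec n) (i : Fin n) (t : ℝ) :
    g (update x i t) = g x + (t - x i) * pd i g x := by
  induction hg using Submodule.span_induction with
  | mem g h =>
    obtain ⟨s, rfl⟩ := h
    rw [mono_update, pd_mono]
    split_ifs with hi
    · have : mono s x = x i * mono (s.erase i) x := (Finset.mul_prod_erase s _ hi).symm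
      rw [this]; ring
    · simp
  | zero => simp
  | add f g hf hg h1 h2 =>
    rw [pd_add i (differentiable_of_mem_Q1 hf) (differentiable_of_mem_Q1 hg)]
    simp only [Pi.add_apply, h1, h2]; ring
  | smul a g hg h =>
    rw [pd_smul i a (differentiable_of_mem_Q1 hg)]
    simp only [Pi.smul_apply, h, smul_eq_mul]; ring

/-- `g` does not depend on the variable `xᵢ`. -/
def IndepOf (i : Fin n) (g : Vec n → ℝ) : Prop := ∀ x t, g (update x i t) = g x

theorem IndepOf.pd_eq_zero {i : Fin n} {g : Vec n → ℝ} (h : IndepOf i g)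
    (hg : Differentiable ℝ g) : pd i g = 0 := by
  funext x
  have h1 := hasDerivAt_comp_update hg x i (x i)
  rw [update_eq_self] at h1
  refine h1.unique ?_
  simp only [h x]
  exact hasDerivAt_const _ _

theorem indepOf_iff_pd_eq_zero {i : Fin n} {g : Vec n → ℝ} (hg : g ∈ Q1 n) :
    IndepOf i g ↔ pd i g = 0 := by
  refine ⟨fun h => h.pd_eq_zero (differentiable_of_mem_Q1 hg), fun h x t => ?_⟩
  rw [apply_update_of_mem_Q1 hg, h]; simp

theorem IndepOf.add {i : Fin n} {f g : Vec n → ℝ} (hf : IndepOf i f) (hg : IndepOf i g) :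
    IndepOf i (f + g) := fun x t => by simp [hf x t, hg x t]

theorem IndepOf.smul {i : Fin n} {g : Vec n → ℝ} (c : ℝ) (hg : IndepOf i g) :
    IndepOf i (c • g) := fun x t => by simp [hg x t]

theorem IndepOf.mul {i : Fin n} {f g : Vec n → ℝ} (hf : IndepOf i f) (hg : IndepOf i g) :
    IndepOf i (f * g) := fun x t => by simp [hf x t, hg x t]

theorem IndepOf.sum {ι : Type*} {i : Fin n} (s : Finset ι) {f : ι → Vec n → ℝ}
    (hf : ∀ j ∈ s, IndepOf i (f j)) : IndepOf i (∑ j ∈ s, f j) := fun x t => by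
  simp only [Finset.sum_apply]
  exact Finset.sum_congr rfl fun j hj => hf j hj x t

theorem indepOf_zero (i : Fin n) : IndepOf i (0 : Vec n → ℝ) := fun _ _ => rfl

theorem indepOf_coord {i j : Fin n} (h : i ≠ j) : IndepOf i (fun x : Vec n => x j) :=
  fun _ _ => update_of_ne h.symm _ _

/-- `∂ᵢ g` does not depend on `xᵢ`. -/
theorem indepOf_pd_self (i : Fin n) {g : Vec n → ℝ} (hg : g ∈ Q1 n) : IndepOf i (pd i g) := by
  intro x t
  by_cases ht : t = x i
  · rw [ht, update_eq_self]
  have h1 := apply_update_of_mem_Q1 hg x i t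
  have h2 := apply_update_of_mem_Q1 hg (update x i t) i (x i)
  rw [update_idem, update_eq_self, update_self, h1] at h2
  have : (t - x i) * (pd i g (update x i t) - pd i g x) = 0 := by linarith
  rcases mul_eq_zero.1 this with h | h
  · exact absurd (sub_eq_zero.1 h) ht
  · exact sub_eq_zero.1 h

theorem IndepOf.pd {i : Fin n} (j : Fin n) {g : Vec n → ℝ} (hg : g ∈ Q1 n) (h : IndepOf i g) :
    IndepOf i (pd j g) := by
  by_cases hij : i = j
  · exact hij ▸ indepOf_pd_self i hg
  intro x t
  have h1 := apply_update_of_mem_Q1 hg x j (x j + 1)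
  have h2 := apply_update_of_mem_Q1 hg (update x i t) j (x j + 1)
  rw [update_comm hij, h, h, update_of_ne (Ne.symm hij)] at h2
  linarith

theorem mono_mem_Q1 (s : Finset (Fin n)) : mono s ∈ Q1 n := Submodule.subset_span ⟨s, rfl⟩

theorem const_mem_Q1 (c : ℝ) : (fun _ => c) ∈ Q1 n := by
  have : (fun _ : Vec n => c) = c • mono ∅ := by funext x; simp [mono]
  rw [this]
  exact Submodule.smul_mem _ _ (mono_mem_Q1 _)

/-- A product of affine functions of the single variables lies in `𝒬₁`. -/
theorem prod_affine_mem_Q1 (s : Finset (Fin n)) (a b : Fin n → ℝ) :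
    (fun x : Vec n => ∏ i ∈ s, (a i + b i * x i)) ∈ Q1 n := by
  have : (fun x : Vec n => ∏ i ∈ s, (a i + b i * x i)) =
      ∑ t ∈ s.powerset, ((∏ i ∈ t, a i) * ∏ i ∈ s \ t, b i) • mono (s \ t) := by
    funext x
    rw [Finset.prod_add]
    simp only [Finset.sum_apply, Pi.smul_apply, smul_eq_mul, mono, Finset.prod_mul_distrib]
    exact Finset.sum_congr rfl fun t _ => by ring
  rw [this]
  exact Submodule.sum_mem _ fun t _ => Submodule.smul_mem _ _ (mono_mem_Q1 _)

/-- `𝒬₁` is stable under affine substitutions `xᵢ ↦ aᵢ + bᵢ xᵢ`. -/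
theorem comp_affine_mem_Q1 {g : Vec n → ℝ} (hg : g ∈ Q1 n) (a b : Fin n → ℝ) :
    (fun x : Vec n => g fun i => a i + b i * x i) ∈ Q1 n := by
  induction hg using Submodule.span_induction with
  | mem g h =>
    obtain ⟨s, rfl⟩ := h
    exact prod_affine_mem_Q1 s a b
  | zero => exact Submodule.zero_mem _
  | add f g _ _ h1 h2 => exact Submodule.add_mem _ h1 h2
  | smul c g _ h => exact Submodule.smul_mem _ c h

theorem coord_mul_mem_Q1 {i : Fin n} {g : Vec n → ℝ} (hg : g ∈ Q1 n) (h : IndepOf i g) :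
    (fun x => x i * g x) ∈ Q1 n := by
  -- Setting `xᵢ = 0` makes the independence of `xᵢ` explicit, so that linearity in `g` applies.
  have key : (fun x : Vec n => x i * g (update x i 0)) ∈ Q1 n := by
    clear h
    induction hg using Submodule.span_induction with
    | mem g h =>
      obtain ⟨s, rfl⟩ := h
      by_cases hi : i ∈ s
      · simp [mono_update, hi]
        exact Submodule.zero_mem _
      · have : (fun x : Vec n => x i * mono s (update x i 0)) = mono (insert i s) := by
          funext x
          rw [mono_update, if_neg hi, mono, mono, Finset.prod_insert hi]
        rw [this]
        exact mono_mem_Q1 _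
    | zero => simp; exact Submodule.zero_mem _
    | add f g _ _ h1 h2 =>
      convert Submodule.add_mem _ h1 h2 using 1
      funext x
      simp [mul_add]
    | smul c g _ h =>
      have := Submodule.smul_mem _ c h
      convert this using 1
      funext x
      simp
      ring
  simpa [h _ 0] using key

/-- If `(x₁ ∂₁ + ⋯ + xₙ ∂ₙ + m) g = 0` with `m > 0` then `g = 0`: the function `t ↦ tᵐ g(t x)` is
constant. -/
theorem eq_zero_of_euler {g : Vec n → ℝ} (hg : Differentiable ℝ g) {m : ℕ} (hm : 0 < m)
    (h : ∀ x, fderiv ℝ g x x + m * g x = 0) : g = 0 := by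
  funext x
  have hd : ∀ t : ℝ, HasDerivAt (fun t : ℝ => t ^ m * g (t • x)) 0 t := by
    intro t
    have h1 : HasDerivAt (fun t : ℝ => g (t • x)) (fderiv ℝ g (t • x) x) t := by
      have h2 : HasDerivAt (fun t : ℝ => t • x) x t := by
        simpa using (hasDerivAt_id t).smul_const x
      exact (hg _).hasFDerivAt.comp_hasDerivAt t h2
    have h3 := (hasDerivAt_pow m t).mul h1
    refine h3.congr_deriv ?_
    have h4 := h (t • x)
    rw [map_smul, smul_eq_mul] at h4
    obtain ⟨m, rfl⟩ := Nat.exists_eq_succ_of_ne_zero hm.ne'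
    simp only [Nat.succ_eq_add_one, Nat.add_sub_cancel] at *
    have : t ^ m * (t * fderiv ℝ g (t • x) x + ((m + 1 : ℕ) : ℝ) * g (t • x)) = 0 := by
      rw [h4, mul_zero]
    linear_combination this
  have hc := is_const_of_deriv_eq_zero (fun t => (hd t).differentiableAt) (fun t => (hd t).deriv) 1 0
  simpa [hm.ne'] using hc

end Multilinear

/-! ### Vertices, reflections and quadrature on a cell -/

section Cells
variable {n : ℕ}

namespace Cell

/-- The affine hull of the cell. -/
def hull (F : Cell n) : Set (Vec n) := {x | ∀ i, i ∉ F.dirs → x i = F.lo i}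

/-- The barycentre of the cell. -/
def mid (F : Cell n) : Vec n := fun i => (F.lo i + F.hi i) / 2

/-- The reflection of a point at the barycentre in the `i`-th coordinate. -/
def flip (F : Cell n) (i : Fin n) (y : Vec n) : Vec n := update y i (F.lo i + F.hi i - y i)

/-- The `dim F`-dimensional volume of the cell. -/
def size (F : Cell n) : ℝ := ∏ i, if F.lo i < F.hi i then F.hi i - F.lo i else 1

theorem mem_dirs {F : Cell n} {i : Fin n} : i ∈ F.dirs ↔ F.lo i < F.hi i := by simp [dirs]

theorem hi_eq_lo {F : Cell n} {i : Fin n} (h : i ∉ F.dirs) : F.hi i = F.lo i :=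
  le_antisymm (not_lt.1 fun h' => h (mem_dirs.2 h')) (F.le i)

theorem mem_vertices {F : Cell n} {y : Vec n} :
    y ∈ F.vertices ↔ ∀ i, y i = F.lo i ∨ y i = F.hi i := by simp [vertices]

theorem vertices_subset_hull {F : Cell n} {y : Vec n} (hy : y ∈ F.vertices) : y ∈ F.hull := by
  intro i hi
  rcases mem_vertices.1 hy i with h | h
  · exact h
  · rw [h, hi_eq_lo hi]

theorem vertices_subset_toSet {F : Cell n} {y : Vec n} (hy : y ∈ F.vertices) : y ∈ F.toSet := by
  refine ⟨fun i => ?_, fun i => ?_⟩ <;> rcases mem_vertices.1 hy i with h | h <;> rw [h]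
  · exact F.le i
  · exact F.le i

theorem toSet_subset_hull {F : Cell n} {y : Vec n} (hy : y ∈ F.toSet) : y ∈ F.hull := by
  intro i hi
  exact le_antisymm ((hy.2 i).trans (hi_eq_lo hi).le) (hy.1 i)

theorem mid_mem_toSet (F : Cell n) : F.mid ∈ F.toSet := by
  refine ⟨fun i => ?_, fun i => ?_⟩ <;> have := F.le i <;> simp only [mid] <;> linarith

theorem flip_mem_vertices {F : Cell n} (i : Fin n) {y : Vec n} (hy : y ∈ F.vertices) :
    F.flip i y ∈ F.vertices := by
  rw [mem_vertices] at hy ⊢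
  intro j
  by_cases hj : j = i
  · subst hj
    rcases hy j with h | h <;> simp [flip, h]
  · simpa [flip, hj] using hy j

theorem flip_flip (F : Cell n) (i : Fin n) (y : Vec n) : F.flip i (F.flip i y) = y := by
  simp [flip]

/-- Summation over the vertices is invariant under reflections. -/
theorem sum_flip (F : Cell n) (i : Fin n) (f : Vec n → ℝ) :
    ∑ y ∈ F.vertices, f (F.flip i y) = ∑ y ∈ F.vertices, f y :=
  Finset.sum_nbij' (F.flip i) (F.flip i) (fun _ h => flip_mem_vertices i h)
    (fun _ h => flip_mem_vertices i h) (fun _ _ => F.flip_flip i _) (fun _ _ => F.flip_flip i _)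
    (fun _ _ => rfl)

theorem flip_mul_pd (F : Cell n) {g : Vec n → ℝ} (hg : g ∈ Q1 n) (i : Fin n) (y : Vec n) :
    (2 * y i - F.lo i - F.hi i) * pd i g y = g y - g (F.flip i y) := by
  rw [flip, apply_update_of_mem_Q1 hg]; ring

/-- A member of `𝒬₁` that vanishes at the vertices of a cell vanishes on its affine hull. -/
theorem eq_zero_of_vertices (F : Cell n) {g : Vec n → ℝ} (hg : g ∈ Q1 n)
    (h : ∀ y ∈ F.vertices, g y = 0) {x : Vec n} (hx : x ∈ F.hull) : g x = 0 := by
  suffices ∀ (A : Finset (Fin n)) (x : Vec n), x ∈ F.hull →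
      (∀ i ∉ A, x i = F.lo i ∨ x i = F.hi i) → g x = 0 from
    this Finset.univ x hx fun i hi => absurd (Finset.mem_univ i) hi
  intro A
  induction A using Finset.induction_on with
  | empty => exact fun x _ hA => h x (mem_vertices.2 fun i => hA i (Finset.notMem_empty i))
  | insert i A hi ih =>
    intro x hx hA
    by_cases hd : i ∈ F.dirs
    · have hup : ∀ t, (t = F.lo i ∨ t = F.hi i) → g (update x i t) = 0 := by
        intro t ht
        refine ih _ (fun j hj => ?_) fun j hj => ?_
        · rw [update_of_ne (by rintro rfl; exact hj hd)]
          exact hx j hj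
        · by_cases hji : j = i
          · subst hji; simpa using ht
          · rw [update_of_ne hji]
            exact hA j (by simp [hji, hj])
      have h1 := hup _ (Or.inl rfl)
      have h2 := hup _ (Or.inr rfl)
      rw [apply_update_of_mem_Q1 hg] at h1 h2
      have h3 : (F.hi i - F.lo i) * pd i g x = 0 := by linarith
      have h4 : pd i g x = 0 :=
        (mul_eq_zero.1 h3).resolve_left (sub_ne_zero.2 (mem_dirs.1 hd).ne')
      rw [h4] at h1
      linarith
    · refine ih x hx fun j hj => ?_
      by_cases hji : j = i
      · subst hji; exact Or.inl (hx j hd)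
      · exact hA j (by simp [hji, hj])

theorem eq_zero_of_vertices_of_lt {T : Cell n} (hT : ∀ i, T.lo i < T.hi i) {g : Vec n → ℝ}
    (hg : g ∈ Q1 n) (h : ∀ y ∈ T.vertices, g y = 0) : g = 0 := by
  funext x
  exact T.eq_zero_of_vertices hg h fun i hi => absurd (mem_dirs.2 (hT i)) hi

/-- The function of `𝒬₁` with value one at the vertex `y` of the box `T` and zero at the other
vertices. -/
def nodal (T : Cell n) (y : Vec n) : Vec n → ℝ := fun x =>
  ∏ i, if y i = T.lo i then (T.hi i - x i) / (T.hi i - T.lo i)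
    else (x i - T.lo i) / (T.hi i - T.lo i)

theorem nodal_mem_Q1 (T : Cell n) (y : Vec n) : T.nodal y ∈ Q1 n := by
  have := prod_affine_mem_Q1 Finset.univ
    (fun i => if y i = T.lo i then T.hi i / (T.hi i - T.lo i) else - T.lo i / (T.hi i - T.lo i))
    (fun i => if y i = T.lo i then - 1 / (T.hi i - T.lo i) else 1 / (T.hi i - T.lo i))
  convert this using 1
  funext x
  refine Finset.prod_congr rfl fun i _ => ?_
  split_ifs <;> ring

theorem nodal_apply {T : Cell n} (hT : ∀ i, T.lo i < T.hi i) {y z : Vec n}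
    (hy : y ∈ T.vertices) (hz : z ∈ T.vertices) : T.nodal y z = if y = z then 1 else 0 := by
  rw [mem_vertices] at hy hz
  split_ifs with h
  · subst h
    refine Finset.prod_eq_one fun i _ => ?_
    have h0 := sub_ne_zero.2 (hT i).ne'
    rcases hy i with h | h
    · simp [h, div_self h0]
    · rw [h, if_neg (hT i).ne', div_self h0]
  · obtain ⟨i, hi⟩ := Function.ne_iff.1 h
    refine Finset.prod_eq_zero (Finset.mem_univ i) ?_
    rcases hy i with h1 | h1 <;> rcases hz i with h2 | h2
    · exact absurd (h1.trans h2.symm) hi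
    · simp [h1, h2]
    · rw [if_neg (by rw [h1]; exact (hT i).ne'), h2]; simp
    · exact absurd (h1.trans h2.symm) hi

/-- The multilinear interpolant at the vertices of the box `T`. -/
def interp (T : Cell n) : (Vec n → ℝ) →ₗ[ℝ] (Vec n → ℝ) where
  toFun g := ∑ y ∈ T.vertices, g y • T.nodal y
  map_add' f g := by simp [add_smul, Finset.sum_add_distrib]
  map_smul' c g := by simp [Finset.smul_sum, mul_smul]

theorem interp_mem_Q1 (T : Cell n) (g : Vec n → ℝ) : T.interp g ∈ Q1 n :=
  Submodule.sum_mem _ fun y _ => Submodule.smul_mem _ _ (T.nodal_mem_Q1 y)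

theorem interp_apply {T : Cell n} (hT : ∀ i, T.lo i < T.hi i) (g : Vec n → ℝ) {y : Vec n}
    (hy : y ∈ T.vertices) : T.interp g y = g y := by
  simp only [interp, LinearMap.coe_mk, AddHom.coe_mk, Finset.sum_apply, Pi.smul_apply, smul_eq_mul]
  rw [Finset.sum_eq_single y]
  · simp [nodal_apply hT hy hy]
  · intro z hz hzy
    simp [nodal_apply hT hz hy, hzy]
  · exact fun h => absurd hy h

/-- Freezing the variables in `A` at the barycentre is an averaging over vertices: it does not
change sums against weights that are invariant under the reflections in the directions `A`. -/
theorem sum_mul_piecewise_mid (F : Cell n) (A : Finset (Fin n)) {w : Vec n → ℝ}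
    (hw : ∀ i ∈ A, ∀ y ∈ F.vertices, w (F.flip i y) = w y) {g : Vec n → ℝ} (hg : g ∈ Q1 n) :
    ∑ y ∈ F.vertices, w y * g (A.piecewise F.mid y) = ∑ y ∈ F.vertices, w y * g y := by
  induction A using Finset.induction_on generalizing g with
  | empty => simp
  | insert i A hi ih =>
    have hA := ih (fun j hj => hw j (Finset.mem_insert_of_mem hj)) hg
    have hflip : ∀ y, A.piecewise F.mid (F.flip i y) = F.flip i (A.piecewise F.mid y) := by
      intro y
      funext j
      by_cases hj : j = i
      · subst hj
        simp [flip, Finset.piecewise, hi]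
      · simp [flip, Finset.piecewise, hj]
    have hval : ∀ y, g ((insert i A).piecewise F.mid y) =
        (g (A.piecewise F.mid y) + g (A.piecewise F.mid (F.flip i y))) / 2 := by
      intro y
      rw [hflip, Finset.piecewise_insert, flip, apply_update_of_mem_Q1 hg,
        apply_update_of_mem_Q1 hg, mid]
      ring
    have h2 : ∑ y ∈ F.vertices, w y * g (A.piecewise F.mid (F.flip i y)) =
        ∑ y ∈ F.vertices, w y * g (A.piecewise F.mid y) := by
      rw [← F.sum_flip i fun y => w y * g (A.piecewise F.mid y)]
      exact Finset.sum_congr rfl fun y hy => by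
        rw [hw i (Finset.mem_insert_self i A) y hy]
    calc ∑ y ∈ F.vertices, w y * g ((insert i A).piecewise F.mid y)
        = (∑ y ∈ F.vertices, w y * g (A.piecewise F.mid y) +
          ∑ y ∈ F.vertices, w y * g (A.piecewise F.mid (F.flip i y))) / 2 := by
          rw [← Finset.sum_add_distrib, Finset.sum_div]
          exact Finset.sum_congr rfl fun y _ => by rw [hval]; ring
      _ = _ := by rw [h2, hA]; ring

/-- The vertex rule is exact on `𝒬₁`. -/
theorem sum_vertices (F : Cell n) {g : Vec n → ℝ} (hg : g ∈ Q1 n) :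
    ∑ y ∈ F.vertices, g y = F.vertices.card * g F.mid := by
  have h := F.sum_mul_piecewise_mid Finset.univ (w := 1) (fun _ _ _ _ => rfl) hg
  simpa using h.symm

theorem card_vertices {T : Cell n} (hT : ∀ i, T.lo i < T.hi i) : T.vertices.card = 2 ^ n := by
  rw [vertices, Fintype.card_piFinset]
  simp [Finset.card_pair (hT _).ne]

/-! ### Integration over a cell -/

/-- The one-dimensional factors of `planeMeasure`. -/
def factor (F : Cell n) (i : Fin n) : Measure ℝ :=
  if F.lo i < F.hi i then volume else Measure.dirac (F.lo i)

instance (F : Cell n) (i : Fin n) : SigmaFinite (F.factor i) := by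
  unfold factor
  split_ifs <;> infer_instance

theorem planeMeasure_eq (F : Cell n) : F.planeMeasure = Measure.pi F.factor := by
  unfold planeMeasure factor
  congr

theorem planeMeasure_eq_volume {T : Cell n} (hT : ∀ i, T.lo i < T.hi i) :
    T.planeMeasure = volume := by
  rw [planeMeasure_eq, volume_pi]
  congr 1
  funext i
  simp [factor, hT i]

theorem setIntegral_prod (F : Cell n) (f : Fin n → ℝ → ℝ) :
    ∫ x in F.toSet, ∏ i, f i (x i) ∂F.planeMeasure =
      ∏ i, ∫ t in Icc (F.lo i) (F.hi i), f i t ∂F.factor i := by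
  rw [planeMeasure_eq, toSet, ← Set.pi_univ_Icc, Measure.restrict_pi_pi]
  exact integral_fintype_prod_eq_prod (𝕜 := ℝ) f

theorem integral_factor_of_notMem (F : Cell n) {i : Fin n} (hi : i ∉ F.dirs) (f : ℝ → ℝ) :
    ∫ t in Icc (F.lo i) (F.hi i), f t ∂F.factor i = f (F.lo i) := by
  rw [factor, if_neg fun h => hi (mem_dirs.2 h), hi_eq_lo hi, Icc_self]
  simp

theorem integral_factor_of_mem (F : Cell n) {i : Fin n} (hi : i ∈ F.dirs) (f : ℝ → ℝ) :
    ∫ t in Icc (F.lo i) (F.hi i), f t ∂F.factor i = ∫ t in F.lo i..F.hi i, f t := by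
  rw [factor, if_pos (mem_dirs.1 hi), intervalIntegral.integral_of_le (F.le i),
    integral_Icc_eq_integral_Ioc]

theorem isCompact_toSet (F : Cell n) : IsCompact F.toSet := isCompact_Icc

theorem integrableOn_toSet (F : Cell n) {g : Vec n → ℝ} (hg : Continuous g) :
    IntegrableOn g F.toSet F.planeMeasure :=
  hg.continuousOn.integrableOn_compact F.isCompact_toSet

/-- The midpoint rule is exact on `𝒬₁`. -/
theorem setIntegral_of_mem_Q1 (F : Cell n) {g : Vec n → ℝ} (hg : g ∈ Q1 n) :
    ∫ x in F.toSet, g x ∂F.planeMeasure = F.size * g F.mid := by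
  induction hg using Submodule.span_induction with
  | mem g h =>
    obtain ⟨s, rfl⟩ := h
    have h1 : ∀ x : Vec n, mono s x = ∏ i, (fun t : ℝ => if i ∈ s then t else 1) (x i) := by
      intro x
      simp [mono, Finset.prod_ite_mem]
    refine (congrArg (fun f : Vec n → ℝ => ∫ x in F.toSet, f x ∂F.planeMeasure)
      (funext h1)).trans ((F.setIntegral_prod fun i t => if i ∈ s then t else 1).trans ?_)
    have h2 : mono s F.mid = ∏ i, if i ∈ s then F.mid i else 1 := by
      simp [mono, Finset.prod_ite_mem]
    rw [h2, size, ← Finset.prod_mul_distrib]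
    refine Finset.prod_congr rfl fun i _ => ?_
    by_cases hi : i ∈ F.dirs
    · rw [F.integral_factor_of_mem hi, if_pos (mem_dirs.1 hi), mid]
      split_ifs
      · rw [integral_id]; ring
      · simp
    · rw [F.integral_factor_of_notMem hi, if_neg fun h => hi (mem_dirs.2 h), mid, hi_eq_lo hi]
      simp
  | zero => simp
  | add f g hf hg h1 h2 =>
    simp only [Pi.add_apply]
    rw [integral_add (F.integrableOn_toSet (continuous_of_mem_Q1 hf))
      (F.integrableOn_toSet (continuous_of_mem_Q1 hg)), h1, h2]
    ring
  | smul c g _ h =>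
    simp only [Pi.smul_apply, smul_eq_mul]
    rw [integral_const_mul, h]
    ring

theorem size_pos (F : Cell n) : 0 < F.size := by
  refine Finset.prod_pos fun i _ => ?_
  split_ifs with h
  · exact sub_pos.2 h
  · exact one_pos

theorem volume_toSet {T : Cell n} (hT : ∀ i, T.lo i < T.hi i) :
    volume.real T.toSet = T.size := by
  have h := T.setIntegral_of_mem_Q1 (const_mem_Q1 1)
  rw [planeMeasure_eq_volume hT] at h
  simpa using h

theorem integral_affine (l h a b : ℝ) :
    ∫ t in l..h, (a + b * t) = a * (h - l) + b * ((h ^ 2 - l ^ 2) / 2) := by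
  rw [intervalIntegral.integral_add (f := fun _ => a) (g := fun t => b * t)
    (Continuous.intervalIntegrable (by fun_prop) _ _)
    (Continuous.intervalIntegrable (by fun_prop) _ _), intervalIntegral.integral_const_mul,
    integral_id]
  simp
  ring

theorem integral_mul_affine (l h a b : ℝ) :
    ∫ t in l..h, t * (a + b * t) = a * ((h ^ 2 - l ^ 2) / 2) + b * ((h ^ 3 - l ^ 3) / 3) := by
  have : ∀ t : ℝ, t * (a + b * t) = a * t + b * t ^ 2 := fun t => by ring
  simp only [this]
  rw [intervalIntegral.integral_add (f := fun t => a * t) (g := fun t => b * t ^ 2)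
    (Continuous.intervalIntegrable (by fun_prop) _ _)
    (Continuous.intervalIntegrable (by fun_prop) _ _), intervalIntegral.integral_const_mul,
    intervalIntegral.integral_const_mul, integral_id, integral_pow]
  norm_num

/-- Evaluation at a vertex of a cell is represented on `𝒬₁` by integration against a member of
`𝒬₁`. -/
theorem exists_dual (F : Cell n) {y : Vec n} (hy : y ∈ F.vertices) :
    ∃ q ∈ Q1 n, ∀ g ∈ Q1 n, ∫ x in F.toSet, g x * q x ∂F.planeMeasure = g y := by
  -- the inverse of the mass matrix of the hat functions on `[0, h]` is `2/h * !![2, -1; -1, 2]`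
  set a : Fin n → ℝ := fun i => if i ∈ F.dirs then
    (if y i = F.lo i then (4 * F.hi i + 2 * F.lo i) / (F.hi i - F.lo i) ^ 2
      else - (4 * F.lo i + 2 * F.hi i) / (F.hi i - F.lo i) ^ 2) else 1 with ha
  set b : Fin n → ℝ := fun i => if i ∈ F.dirs then
    (if y i = F.lo i then - 6 / (F.hi i - F.lo i) ^ 2 else 6 / (F.hi i - F.lo i) ^ 2) else 0
    with hb
  have hq := prod_affine_mem_Q1 Finset.univ a b
  obtain ⟨q, hqab⟩ : ∃ q : Vec n → ℝ, q = fun x => ∏ i, (a i + b i * x i) := ⟨_, rfl⟩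
  rw [← hqab] at hq
  refine ⟨q, hq, fun g hg => ?_⟩
  have hqc := continuous_of_mem_Q1 hq
  induction hg using Submodule.span_induction with
  | mem g h =>
    obtain ⟨s, rfl⟩ := h
    have h1 : ∀ x : Vec n, mono s x * q x =
        ∏ i, (fun t : ℝ => (if i ∈ s then t else 1) * (a i + b i * t)) (x i) := by
      intro x
      rw [Finset.prod_mul_distrib, hqab]
      simp [mono, Finset.prod_ite_mem]
    have h2 : mono s y = ∏ i, if i ∈ s then y i else 1 := by
      simp [mono, Finset.prod_ite_mem]
    refine (congrArg (fun f : Vec n → ℝ => ∫ x in F.toSet, f x ∂F.planeMeasure)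
      (funext h1)).trans ((F.setIntegral_prod
        fun i t => (if i ∈ s then t else 1) * (a i + b i * t)).trans ?_)
    rw [h2]
    refine Finset.prod_congr rfl fun i _ => ?_
    by_cases hi : i ∈ F.dirs
    · have hlt := sub_ne_zero.2 (mem_dirs.1 hi).ne'
      rw [F.integral_factor_of_mem hi]
      have e0 := integral_affine (F.lo i) (F.hi i) (a i) (b i)
      have e1 := integral_mul_affine (F.lo i) (F.hi i) (a i) (b i)
      by_cases hs : i ∈ s
      · simp only [hs, if_true]
        rw [e1]
        rcases mem_vertices.1 hy i with h | h
        · simp only [ha, hb, hi, h, if_true]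
          field_simp
          ring
        · simp only [ha, hb, hi, h, if_true, if_neg (mem_dirs.1 hi).ne']
          field_simp
          ring
      · simp only [hs, if_false, one_mul]
        rw [e0]
        rcases mem_vertices.1 hy i with h | h
        · simp only [ha, hb, hi, h, if_true]
          field_simp
          ring
        · simp only [ha, hb, hi, h, if_true, if_neg (mem_dirs.1 hi).ne']
          field_simp
          ring
    · rw [F.integral_factor_of_notMem hi]
      simp [ha, hb, hi, vertices_subset_hull hy i hi]
  | zero => simp
  | add f g hf hg h1 h2 =>
    simp only [Pi.add_apply, add_mul]
    rw [← h1, ← h2]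
    exact integral_add (F.integrableOn_toSet ((continuous_of_mem_Q1 hf).mul hqc))
      (F.integrableOn_toSet ((continuous_of_mem_Q1 hg).mul hqc))
  | smul c g _ h =>
    simp only [Pi.smul_apply, smul_eq_mul, mul_assoc]
    rw [integral_const_mul, h]

end Cell
end Cells

/-! ### Coefficients of forms -/

section Forms
variable {n k : ℕ}

/-- The vectors `e_{a 1}, …, e_{a k}` for an arbitrary sequence `a` of indices. -/
def frame (a : Fin k → Fin n) : Fin k → Vec n := fun j => Pi.single (a j) 1

/-- The coefficient `u_a = u(e_{a 1}, …, e_{a k})` of a form. -/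
def coef (u : Form n k) (a : Fin k → Fin n) : Vec n → ℝ := fun x => u x (frame a)

theorem frame_cons (i : Fin n) (a : Fin k → Fin n) :
    frame (Fin.cons i a : Fin (k + 1) → Fin n) = Fin.cons (Pi.single i 1) (frame a) := by
  funext j
  refine Fin.cases ?_ (fun j => ?_) j <;> simp [frame]

theorem alt_frame_eq_zero {A : Alt n k} {a : Fin k → Fin n} (ha : ¬ Injective a) :
    A (frame a) = 0 := by
  simp only [Injective, not_forall] at ha
  obtain ⟨i, j, h, hij⟩ := ha
  exact A.map_eq_zero_of_eq (frame a) (by simp [frame, h]) hij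

/-- If an alternating form vanishes on the increasing sequences of basis vectors in the directions
`S`, then it vanishes on all sequences of such basis vectors. -/
theorem alt_frame_eq_zero_of_increasing {A : Alt n k} {S : Finset (Fin n)}
    (h : ∀ σ : Fin k ↪o Fin n, (∀ j, σ j ∈ S) → A (frame σ) = 0) {a : Fin k → Fin n}
    (ha : ∀ j, a j ∈ S) : A (frame a) = 0 := by
  by_cases hi : Injective a
  swap
  · exact alt_frame_eq_zero hi
  have hc : (Finset.univ.image a).card = k := by
    rw [Finset.card_image_of_injective _ hi, Finset.card_univ, Fintype.card_fin]
  set σ := (Finset.univ.image a).orderEmbOfFin hc with hσ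
  have hr : range σ = range a := by simp [hσ]
  have hex : ∀ j, ∃ i, σ i = a j := fun j => by
    have : a j ∈ range σ := hr ▸ mem_range_self j
    exact this
  choose p hp using hex
  have hpi : Injective p := fun i j hij => hi (by rw [← hp, ← hp, hij])
  have h0 : A (frame σ) = 0 := h σ fun j => by
    have : σ j ∈ range a := hr ▸ mem_range_self j
    obtain ⟨i, hi⟩ := this
    exact hi ▸ ha i
  have h1 := A.toAlternatingMap.map_perm (frame σ)
    (Equiv.ofBijective p (Finite.injective_iff_bijective.1 hpi))
  have h2 : (frame σ) ∘ (Equiv.ofBijective p (Finite.injective_iff_bijective.1 hpi)) = frame a := by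
    funext j
    simp [frame, hp]
  rw [h2] at h1
  have h3 : A.toAlternatingMap (frame σ) = 0 := h0
  rw [h3, smul_zero] at h1
  exact h1

theorem alt_ext_frame {A B : Alt n k} (h : ∀ a : Fin k → Fin n, A (frame a) = B (frame a)) :
    A = B := by
  refine ContinuousAlternatingMap.toAlternatingMap_injective ?_
  refine Module.Basis.ext_alternating (Pi.basisFun ℝ (Fin n)) fun a _ => ?_
  simp only [Pi.basisFun_apply]
  exact h a

theorem alt_ext {A B : Alt n k} (h : ∀ σ : Fin k ↪o Fin n, A (frame σ) = B (frame σ)) :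
    A = B := by
  rw [← sub_eq_zero]
  refine alt_ext_frame fun a => ?_
  refine alt_frame_eq_zero_of_increasing (S := Finset.univ) (fun σ _ => ?_) fun _ =>
    Finset.mem_univ _
  simp [h σ]

theorem dx_frame_eq_zero_of_row {σ : Fin k ↪o Fin n} {a : Fin k → Fin n} {l : Fin k}
    (h : a l ∉ range σ) : dx σ (frame a) = 0 := by
  rw [dx_apply]
  refine Matrix.det_eq_zero_of_row_eq_zero l fun j => ?_
  simp only [Matrix.of_apply, frame]
  exact Pi.single_eq_of_ne (fun h' => h ⟨j, h'⟩) _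

theorem dx_frame (σ τ : Fin k ↪o Fin n) : dx σ (frame τ) = if σ = τ then 1 else 0 := by
  split_ifs with h
  · subst h
    rw [dx_apply]
    convert Matrix.det_one (n := Fin k) (R := ℝ) using 2
    ext i j
    simp [frame, Matrix.one_apply, Pi.single_apply, eq_comm]
  · by_contra h0
    refine h ?_
    have hsub : range τ ⊆ range σ := by
      rintro _ ⟨l, rfl⟩
      by_contra hl
      exact h0 (dx_frame_eq_zero_of_row hl)
    have heq : (Finset.univ.image τ) = Finset.univ.image σ := by
      refine Finset.eq_of_subset_of_card_le ?_ ?_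
      · intro i hi
        have : i ∈ range σ := hsub (by simpa using hi)
        simpa using this
      · rw [Finset.card_image_of_injective _ σ.injective,
          Finset.card_image_of_injective _ τ.injective]
    have hr : range σ = range τ := by
      have := congrArg (fun s : Finset (Fin n) => (s : Set (Fin n))) heq
      simpa using this.symm
    exact OrderEmbedding.range_inj.1 hr

theorem alt_eq_sum (A : Alt n k) : A = ∑ σ : Fin k ↪o Fin n, A (frame σ) • dx σ := by
  refine alt_ext fun τ => ?_
  simp [ContinuousAlternatingMap.sum_apply, dx_frame]

theorem form_eq_sum (u : Form n k) :
    u = fun x => ∑ σ : Fin k ↪o Fin n, coef u σ x • dx σ := funext fun x => alt_eq_sum (u x)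

theorem form_ext {u v : Form n k} (h : ∀ a : Fin k → Fin n, coef u a = coef v a) : u = v :=
  funext fun x => alt_ext_frame fun a => congrFun (h a) x

theorem coef_add (u v : Form n k) (a : Fin k → Fin n) : coef (u + v) a = coef u a + coef v a := rfl

theorem coef_sub (u v : Form n k) (a : Fin k → Fin n) : coef (u - v) a = coef u a - coef v a := by
  funext x; simp [coef]

theorem coef_smul (c : ℝ) (u : Form n k) (a : Fin k → Fin n) : coef (c • u) a = c • coef u a := rfl

@[simp]
theorem coef_zero (a : Fin k → Fin n) : coef (0 : Form n k) a = 0 := rfl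

theorem coef_sum_smul_dx (f : (Fin k ↪o Fin n) → Vec n → ℝ) (τ : Fin k ↪o Fin n) :
    coef (fun x => ∑ σ, f σ x • dx σ) τ = f τ := by
  funext x
  simp [coef, ContinuousAlternatingMap.sum_apply, dx_frame]

/-- Moving the `l`-th index to the front costs the sign `(-1)^l`. -/
theorem coef_cons_removeNth (u : Form n (k + 1)) (ω : Fin (k + 1) → Fin n) (l : Fin (k + 1)) :
    coef u (Fin.cons (ω l) (l.removeNth ω)) = (-1 : ℝ) ^ (l : ℕ) • coef u ω := by
  funext x
  have h := (u x).neg_one_pow_smul_map_insertNth l (frame ω l) (l.removeNth (frame ω))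
  rw [Fin.insertNth_self_removeNth] at h
  simp only [coef, Pi.smul_apply, frame_cons]
  rw [zsmul_eq_mul] at h
  push_cast at h
  exact h.symm

/-! ### Forms with coefficients in `𝒬₁` -/

variable (n k) in
/-- `𝒬₁Λ^k`: all coefficients in `𝒬₁`. -/
def Qform : Submodule ℝ (Form n k) where
  carrier := {u | ∀ a, coef u a ∈ Q1 n}
  zero_mem' := fun _ => Submodule.zero_mem _
  add_mem' := fun hu hv a => Submodule.add_mem _ (hu a) (hv a)
  smul_mem' := fun c _ hu a => Submodule.smul_mem _ c (hu a)

theorem contDiff_of_mem_Qform {u : Form n k} (hu : u ∈ Qform n k) : ContDiff ℝ (⊤ : ℕ∞) u := by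
  rw [form_eq_sum u]
  exact ContDiff.sum fun σ _ => (contDiff_of_mem_Q1 (hu σ)).smul contDiff_const

theorem differentiable_of_mem_Qform {u : Form n k} (hu : u ∈ Qform n k) : Differentiable ℝ u :=
  (contDiff_of_mem_Qform hu).differentiable (by simp)

theorem differentiable_coef {u : Form n k} (hu : Differentiable ℝ u) (a : Fin k → Fin n) :
    Differentiable ℝ (coef u a) :=
  (ContinuousAlternatingMap.apply ℝ (Vec n) ℝ (frame a)).differentiable.comp hu

theorem coef_extDeriv {u : Form n k} (hu : Differentiable ℝ u) (ω : Fin (k + 1) → Fin n) :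
    coef (extDeriv u) ω =
      ∑ l : Fin (k + 1), (-1 : ℝ) ^ (l : ℕ) • pd (ω l) (coef u (l.removeNth ω)) := by
  funext x
  simp only [coef]
  rw [extDeriv_apply (hu x)]
  simp only [Finset.sum_apply]
  refine Finset.sum_congr rfl fun l _ => ?_
  rw [zsmul_eq_mul]
  push_cast
  rfl

theorem extDeriv_mem_Qform {u : Form n k} (hu : u ∈ Qform n k) :
    extDeriv u ∈ Qform n (k + 1) := fun ω => by
  rw [coef_extDeriv (differentiable_of_mem_Qform hu)]
  exact Submodule.sum_mem _ fun l _ => Submodule.smul_mem _ _ (pd_mem_Q1 _ (hu _))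

/-- Expansion of the contraction of an alternating form with `x`. -/
theorem alt_cons (A : Alt n (k + 1)) (x : Vec n) (a : Fin k → Fin n) :
    A (Fin.cons x (frame a)) = ∑ j, x j * A (frame (Fin.cons j a : Fin (k + 1) → Fin n)) := by
  have h : A.curryLeft x = ∑ j, x j • A.curryLeft (Pi.single j 1) := by
    conv_lhs => rw [pi_eq_sum_univ' x]
    simp [map_sum]
  have h2 := congrArg (fun B : Alt n k => B (frame a)) h
  simp only [ContinuousAlternatingMap.sum_apply, ContinuousAlternatingMap.smul_apply,
    smul_eq_mul, ContinuousAlternatingMap.curryLeft_apply_apply] at h2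
  simp only [frame_cons]
  exact h2

theorem coef_koszul (c : Form n (k + 1)) (a : Fin k → Fin n) :
    coef (koszul c) a = fun x => ∑ j, x j * coef c (Fin.cons j a) x :=
  funext fun x => alt_cons (c x) x a

end Forms

/-! ### Shape functions and the Koszul operator -/

section Shape
variable {n k : ℕ}

theorem coef_formMono (s : Finset (Fin n)) (σ : Fin k ↪o Fin n) (a : Fin k → Fin n) :
    coef (formMono s σ) a = dx σ (frame a) • mono s := by
  funext x
  simp [coef, formMono, mul_comm]

theorem formMono_mem_Qform (s : Finset (Fin n)) (σ : Fin k ↪o Fin n) :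
    formMono s σ ∈ Qform n k := fun a => by
  rw [coef_formMono]
  exact Submodule.smul_mem _ _ (mono_mem_Q1 s)

/-- A subspace that contains the form monomials in `dx_σ` without the variables in `A` contains
every `g dx_σ` with `g ∈ 𝒬₁` after the variables in `A` have been frozen. -/
theorem smul_dx_mem {V : Submodule ℝ (Form n k)} {A : Finset (Fin n)} {p : Vec n}
    {σ : Fin k ↪o Fin n} (hV : ∀ s, (∀ i ∈ s, i ∉ A) → formMono s σ ∈ V) {g : Vec n → ℝ}
    (hg : g ∈ Q1 n) : (fun x => g (A.piecewise p x) • dx σ) ∈ V := by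
  induction hg using Submodule.span_induction with
  | mem g h =>
    obtain ⟨s, rfl⟩ := h
    have : (fun x : Vec n => mono s (A.piecewise p x) • dx σ) =
        (∏ i ∈ s ∩ A, p i) • formMono (s \ A) σ := by
      funext x
      rw [mono, Finset.prod_piecewise]
      simp [formMono, mono, smul_smul]
    rw [this]
    exact Submodule.smul_mem _ _ (hV _ fun i hi => (Finset.mem_sdiff.1 hi).2)
  | zero => convert Submodule.zero_mem V using 1; funext x; simp
  | add f g _ _ h1 h2 =>
    convert Submodule.add_mem V h1 h2 using 1; funext x; simp [add_smul]
  | smul c g _ h => convert Submodule.smul_mem V c h using 1; funext x; simp [mul_smul]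

/-- The form with coefficients `u_σ`, in which the variables `x_{σ 1}, …, x_{σ k}` are frozen at
the coordinates of the point `p`. -/
def freeze (p : Vec n) : Form n k →ₗ[ℝ] Form n k where
  toFun u := fun x => ∑ σ : Fin k ↪o Fin n, coef u σ ((Finset.univ.image σ).piecewise p x) • dx σ
  map_add' u v := by
    funext x
    simp [coef_add, add_smul, Finset.sum_add_distrib]
  map_smul' c u := by
    funext x
    simp [coef_smul, mul_smul, Finset.smul_sum]

theorem coef_freeze (p : Vec n) (u : Form n k) (σ : Fin k ↪o Fin n) (x : Vec n) :
    coef (freeze p u) σ x = coef u σ ((Finset.univ.image σ).piecewise p x) :=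
  congrFun (coef_sum_smul_dx
    (fun (σ : Fin k ↪o Fin n) x => coef u σ ((Finset.univ.image σ).piecewise p x)) σ) x

theorem freeze_mem_Q1minus (p : Vec n) {u : Form n k} (hu : u ∈ Qform n k) :
    freeze p u ∈ Q1minus n k := by
  have : freeze p u = ∑ σ : Fin k ↪o Fin n,
      fun x => coef u σ ((Finset.univ.image σ).piecewise p x) • dx σ := by
    funext x
    rw [Finset.sum_apply]
    rfl
  rw [this]
  refine Submodule.sum_mem _ fun σ _ => smul_dx_mem (fun s hs => ?_) (hu σ)
  refine Submodule.subset_span ⟨s, σ, fun i hi h => hs i hi ?_, rfl⟩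
  simpa using h

theorem piecewise_of_indepOf {g : Vec n → ℝ} (A : Finset (Fin n)) (h : ∀ i ∈ A, IndepOf i g)
    (p x : Vec n) : g (A.piecewise p x) = g x := by
  induction A using Finset.induction_on with
  | empty => simp
  | insert i A hi ih =>
    rw [Finset.piecewise_insert, h i (Finset.mem_insert_self i A),
      ih fun j hj => h j (Finset.mem_insert_of_mem hj)]

/-- `𝒬₁⁻Λ^k` consists of the forms with coefficients in `𝒬₁` such that `u_a` does not depend on
the variables `x_{a 1}, …, x_{a k}`. -/
theorem mem_Q1minus_iff {u : Form n k} :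
    u ∈ Q1minus n k ↔ u ∈ Qform n k ∧ ∀ a l, IndepOf (a l) (coef u a) := by
  constructor
  · intro h
    induction h using Submodule.span_induction with
    | mem u h =>
      obtain ⟨s, σ, hs, rfl⟩ := h
      refine ⟨formMono_mem_Qform s σ, fun a l => ?_⟩
      rw [coef_formMono]
      by_cases hl : a l ∈ range σ
      · refine IndepOf.smul _ fun x t => ?_
        rw [mono_update, if_neg fun h => hs _ h hl]
      · rw [dx_frame_eq_zero_of_row hl, zero_smul]
        exact indepOf_zero _
    | zero => exact ⟨Submodule.zero_mem _, fun a l => indepOf_zero _⟩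
    | add u v _ _ h1 h2 =>
      exact ⟨Submodule.add_mem _ h1.1 h2.1, fun a l => (h1.2 a l).add (h2.2 a l)⟩
    | smul c u _ h => exact ⟨Submodule.smul_mem _ c h.1, fun a l => (h.2 a l).smul c⟩
  · rintro ⟨h1, h2⟩
    have : freeze 0 u = u := by
      funext x
      refine alt_ext fun σ => ?_
      refine (coef_freeze 0 u σ x).trans ?_
      exact piecewise_of_indepOf _ (fun i hi => by
        obtain ⟨l, -, rfl⟩ := Finset.mem_image.1 hi
        exact h2 σ l) 0 x
    rw [← this]
    exact freeze_mem_Q1minus 0 h1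

theorem freeze_eq_self (p : Vec n) {u : Form n k} (hu : u ∈ Q1minus n k) : freeze p u = u := by
  funext x
  refine alt_ext fun σ => ?_
  refine (coef_freeze p u σ x).trans ?_
  exact piecewise_of_indepOf _ (fun i hi => by
    obtain ⟨l, -, rfl⟩ := Finset.mem_image.1 hi
    exact (mem_Q1minus_iff.1 hu).2 σ l) p x

theorem Q1minus_le_Qform : Q1minus n k ≤ Qform n k := fun _ h => (mem_Q1minus_iff.1 h).1

theorem extDeriv_mem_Q1minus {u : Form n k} (hu : u ∈ Q1minus n k) :
    extDeriv u ∈ Q1minus n (k + 1) := by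
  obtain ⟨h1, h2⟩ := mem_Q1minus_iff.1 hu
  refine mem_Q1minus_iff.2 ⟨extDeriv_mem_Qform h1, fun ω m => ?_⟩
  rw [coef_extDeriv (differentiable_of_mem_Qform h1)]
  refine IndepOf.sum _ fun l _ => IndepOf.smul _ ?_
  by_cases hml : m = l
  · subst hml
    exact indepOf_pd_self _ (h1 _)
  · obtain ⟨j, rfl⟩ := Fin.exists_succAbove_eq hml
    exact IndepOf.pd _ (h1 _) (h2 (l.removeNth ω) j)

theorem koszul_mem_Q1minus {u : Form n (k + 1)} (hu : u ∈ Q1minus n (k + 1)) :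
    koszul u ∈ Q1minus n k := by
  obtain ⟨h1, h2⟩ := mem_Q1minus_iff.1 hu
  have hs : ∀ a, coef (koszul u) a =
      ∑ j, fun x : Vec n => x j * coef u (Fin.cons j a) x := by
    intro a
    rw [coef_koszul]
    funext x
    simp
  refine mem_Q1minus_iff.2 ⟨fun a => ?_, fun a l => ?_⟩
  · rw [hs]
    exact Submodule.sum_mem _ fun j _ => coord_mul_mem_Q1 (h1 _) (h2 (Fin.cons j a) 0)
  · rw [hs]
    refine IndepOf.sum _ fun j _ => ?_
    by_cases hj : a l = j
    · have : coef u (Fin.cons j a) = 0 := by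
        funext x
        refine alt_frame_eq_zero fun hinj => ?_
        have := @hinj 0 l.succ (by simp [hj])
        exact absurd this (Fin.succ_ne_zero l).symm
      rw [this]
      exact fun x t => by simp
    · exact (indepOf_coord hj).mul (h2 (Fin.cons j a) l.succ)

theorem pd_comm {g : Vec n → ℝ} (hg : g ∈ Q1 n) (i j : Fin n) :
    pd i (pd j g) = pd j (pd i g) := by
  induction hg using Submodule.span_induction with
  | mem g h =>
    obtain ⟨s, rfl⟩ := h
    rw [pd_mono, pd_mono]
    by_cases hij : i = j
    · rw [hij]
    by_cases hi : i ∈ s <;> by_cases hj : j ∈ s <;>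
      simp [hi, hj, pd_mono, hij, Ne.symm hij, Finset.erase_right_comm]
  | zero => simp
  | add f g hf hg h1 h2 =>
    have d := fun i => differentiable_of_mem_Q1 (pd_mem_Q1 i hf)
    have e := fun i => differentiable_of_mem_Q1 (pd_mem_Q1 i hg)
    rw [pd_add _ (differentiable_of_mem_Q1 hf) (differentiable_of_mem_Q1 hg),
      pd_add _ (differentiable_of_mem_Q1 hf) (differentiable_of_mem_Q1 hg),
      pd_add _ (d _) (e _), pd_add _ (d _) (e _), h1, h2]
  | smul c g hg h =>
    have e := fun i => differentiable_of_mem_Q1 (pd_mem_Q1 i hg)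
    rw [pd_smul _ _ (differentiable_of_mem_Q1 hg), pd_smul _ _ (differentiable_of_mem_Q1 hg),
      pd_smul _ _ (e _), pd_smul _ _ (e _), h]

/-- The Euler field `x₁ ∂₁ + ⋯ + xₙ ∂ₙ` applied to `g`. -/
def euler (g : Vec n → ℝ) : Vec n → ℝ := ∑ j, (fun x : Vec n => x j) * pd j g

theorem fderiv_apply_self {g : Vec n → ℝ} (x : Vec n) : fderiv ℝ g x x = euler g x := by
  conv_lhs => rw [show fderiv ℝ g x x = fderiv ℝ g x (∑ j, x j • Pi.single j 1) by
    rw [← pi_eq_sum_univ']]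
  simp [euler, pd, map_sum]

theorem euler_mem_Q1 {g : Vec n → ℝ} (hg : g ∈ Q1 n) : euler g ∈ Q1 n :=
  Submodule.sum_mem _ fun j _ => coord_mul_mem_Q1 (pd_mem_Q1 j hg) (indepOf_pd_self j hg)

theorem differentiable_coord (j : Fin n) : Differentiable ℝ fun x : Vec n => x j :=
  differentiable_apply j

theorem pd_euler {g : Vec n → ℝ} (hg : g ∈ Q1 n) (i : Fin n) :
    pd i (euler g) = pd i g + euler (pd i g) := by
  have hd := fun j => differentiable_of_mem_Q1 (pd_mem_Q1 j hg)
  rw [euler, pd_sum _ _ fun j _ => (differentiable_coord j).mul (hd j)]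
  have : ∀ j, pd i ((fun x : Vec n => x j) * pd j g) =
      (if i = j then pd j g else 0) + (fun x : Vec n => x j) * pd j (pd i g) := by
    intro j
    rw [pd_mul i (differentiable_coord j) (hd j), pd_coord, pd_comm hg i j]
    congr 1
    funext x
    split_ifs <;> simp
  rw [Finset.sum_congr rfl fun j _ => this j, Finset.sum_add_distrib]
  simp [euler]

theorem eq_zero_of_mul_add_euler {g : Vec n → ℝ} (hg : g ∈ Q1 n) {m : ℕ} (hm : 0 < m)
    (h : (m : ℝ) • g + euler g = 0) : g = 0 :=
  eq_zero_of_euler (differentiable_of_mem_Q1 hg) hm fun x => by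
    have := congrFun h x
    simp only [Pi.add_apply, Pi.smul_apply, smul_eq_mul, Pi.zero_apply] at this
    rw [fderiv_apply_self]; linarith

/-- Cartan's formula `dκ + κd = k + x₁ ∂₁ + ⋯ + xₙ ∂ₙ`. -/
theorem coef_extDeriv_koszul {b : Form n (k + 1)} (hb : Differentiable ℝ b)
    (ω : Fin (k + 1) → Fin n) :
    coef (extDeriv (koszul b)) ω + coef (koszul (extDeriv b)) ω =
      ((k + 1 : ℕ) : ℝ) • coef b ω + euler (coef b ω) := by
  have hk : ∀ a, coef (koszul b) a = ∑ j, (fun x : Vec n => x j) * coef b (Fin.cons j a) := by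
    intro a
    rw [coef_koszul]
    funext x
    simp
  have hkd : Differentiable ℝ (koszul b) := by
    rw [form_eq_sum (koszul b)]
    refine Differentiable.fun_sum fun σ _ => Differentiable.smul_const ?_ _
    rw [hk]
    exact Differentiable.sum fun j _ => (differentiable_coord j).mul (differentiable_coef hb _)
  -- In `dκ`, differentiating the factor `xⱼ` with `j = ω l` gives one copy of `b_ω` for each `l`.
  have h1 : ∀ l : Fin (k + 1), (-1 : ℝ) ^ (l : ℕ) • pd (ω l) (coef (koszul b) (l.removeNth ω)) =
      coef b ω + (-1 : ℝ) ^ (l : ℕ) • ∑ j, (fun x : Vec n => x j) *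
        pd (ω l) (coef b (Fin.cons j (l.removeNth ω))) := by
    intro l
    rw [hk, pd_sum _ _ fun j _ => (differentiable_coord j).mul (differentiable_coef hb _)]
    have : ∀ j, pd (ω l) ((fun x : Vec n => x j) * coef b (Fin.cons j (l.removeNth ω))) =
        (if ω l = j then coef b (Fin.cons j (l.removeNth ω)) else 0) +
          (fun x : Vec n => x j) * pd (ω l) (coef b (Fin.cons j (l.removeNth ω))) := by
      intro j
      rw [pd_mul _ (differentiable_coord j) (differentiable_coef hb _), pd_coord]
      congr 1
      funext x
      split_ifs <;> simp
    rw [Finset.sum_congr rfl fun j _ => this j, Finset.sum_add_distrib, smul_add]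
    congr 1
    rw [Finset.sum_ite_eq]
    simp only [Finset.mem_univ, if_true]
    rw [coef_cons_removeNth, smul_smul, ← mul_pow]
    simp
  -- In `κd`, the derivative in the contracted direction gives the Euler field; the rest cancels.
  have h2 : coef (koszul (extDeriv b)) ω = euler (coef b ω) -
      ∑ l : Fin (k + 1), (-1 : ℝ) ^ (l : ℕ) • ∑ j, (fun x : Vec n => x j) *
        pd (ω l) (coef b (Fin.cons j (l.removeNth ω))) := by
    rw [coef_koszul]
    funext x
    simp only [coef_extDeriv hb, Fin.sum_univ_succ (n := k + 1), Pi.sub_apply,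
      Finset.sum_apply, Pi.smul_apply, Pi.mul_apply, smul_eq_mul, euler, Fin.cons_zero,
      Fin.cons_succ, Fin.val_zero, pow_zero, one_mul, Fin.val_succ, pow_succ, mul_add,
      Finset.sum_add_distrib, Fin.removeNth_zero, Fin.tail_cons]
    have h3 : ∀ (j : Fin n) (l : Fin (k + 1)),
        (l.succ.removeNth (Fin.cons j ω : Fin (k + 2) → Fin n) : Fin (k + 1) → Fin n) =
          Fin.cons j (l.removeNth ω) := by
      intro j l
      funext i
      refine Fin.cases ?_ (fun i => ?_) i <;> simp [Fin.removeNth]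
    simp only [h3, Finset.mul_sum]
    rw [Finset.sum_comm, sub_eq_add_neg, ← Finset.sum_neg_distrib]
    congr 1
    refine Finset.sum_congr rfl fun l _ => ?_
    rw [← Finset.sum_neg_distrib]
    exact Finset.sum_congr rfl fun j _ => by ring
  rw [coef_extDeriv hkd, Finset.sum_congr rfl fun l _ => h1 l, Finset.sum_add_distrib, h2]
  simp only [Finset.sum_const, Finset.card_univ, Fintype.card_fin]
  rw [Nat.cast_smul_eq_nsmul]
  abel

end Shape

/-! ### The space of forms `w - κ c` -/

section KForms
variable {n k : ℕ}

theorem koszul_add (u v : Form n (k + 1)) : koszul (u + v) = koszul u + koszul v := rfl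

theorem koszul_smul (c : ℝ) (u : Form n (k + 1)) : koszul (c • u) = c • koszul u := rfl

theorem extDeriv_add_of_contDiff {u v : Form n k} (hu : ContDiff ℝ (⊤ : ℕ∞) u)
    (hv : ContDiff ℝ (⊤ : ℕ∞) v) : extDeriv (u + v) = extDeriv u + extDeriv v :=
  funext fun _ => extDeriv_add (hu.differentiable (by simp) _) (hv.differentiable (by simp) _)

theorem extDeriv_smul' (c : ℝ) (u : Form n k) : extDeriv (c • u) = c • extDeriv u :=
  funext fun _ => extDeriv_smul c u

theorem extDeriv_extDeriv_of_contDiff {u : Form n k} (hu : ContDiff ℝ (⊤ : ℕ∞) u) :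
    extDeriv (extDeriv u) = 0 :=
  extDeriv_extDeriv (r := (⊤ : ℕ∞)) hu (by
    simpa using (WithTop.coe_le_coe.2 le_top : ((2 : ℕ∞) : WithTop ℕ∞) ≤ ((⊤ : ℕ∞) : WithTop ℕ∞)))

theorem contDiff_sub_koszul {w : Form n k} (hw : w ∈ Qform n k) {c : Form n (k + 1)}
    (hc : c ∈ Qform n (k + 1)) : ContDiff ℝ (⊤ : ℕ∞) (w - koszul c) :=
  (contDiff_of_mem_Qform hw).sub (contDiff_koszul (contDiff_of_mem_Qform hc))

variable (n k) in
/-- The forms `u = w - κ c` with `w` and `c` having coefficients in `𝒬₁` and with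
`du ∈ 𝒬₁⁻Λ^{k+1}`. This space contains `𝒮₁⁺Λ^k`; unlike the definition of the latter, the
conditions are visibly stable under the affine substitutions that preserve the coordinate axes. -/
def Kform : Submodule ℝ (Form n k) where
  carrier := {u | (∃ w ∈ Qform n k, ∃ c ∈ Qform n (k + 1), u = w - koszul c) ∧
    extDeriv u ∈ Q1minus n (k + 1)}
  zero_mem' := by
    refine ⟨⟨0, Submodule.zero_mem _, 0, Submodule.zero_mem _, ?_⟩, ?_⟩
    · funext x
      simp [koszul]
    · have : extDeriv (0 : Form n k) = 0 := by
        have := extDeriv_smul' 0 (0 : Form n k)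
        simpa using this
      rw [this]
      exact Submodule.zero_mem _
  add_mem' := by
    rintro _ _ ⟨⟨w, hw, c, hc, rfl⟩, h⟩ ⟨⟨w', hw', c', hc', rfl⟩, h'⟩
    refine ⟨⟨w + w', Submodule.add_mem _ hw hw', c + c', Submodule.add_mem _ hc hc', ?_⟩, ?_⟩
    · rw [koszul_add]; abel
    · rw [extDeriv_add_of_contDiff (contDiff_sub_koszul hw hc) (contDiff_sub_koszul hw' hc')]
      exact Submodule.add_mem _ h h'
  smul_mem' := by
    rintro r _ ⟨⟨w, hw, c, hc, rfl⟩, h⟩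
    refine ⟨⟨r • w, Submodule.smul_mem _ r hw, r • c, Submodule.smul_mem _ r hc, ?_⟩, ?_⟩
    · rw [koszul_smul, smul_sub]
    · rw [extDeriv_smul']
      exact Submodule.smul_mem _ r h

theorem contDiff_of_mem_Kform {u : Form n k} (hu : u ∈ Kform n k) : ContDiff ℝ (⊤ : ℕ∞) u := by
  obtain ⟨⟨w, hw, c, hc, rfl⟩, -⟩ := hu
  exact contDiff_sub_koszul hw hc

theorem differentiable_of_mem_Kform {u : Form n k} (hu : u ∈ Kform n k) : Differentiable ℝ u :=
  (contDiff_of_mem_Kform hu).differentiable (by simp)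

theorem Q1minus_le_Kform : Q1minus n k ≤ Kform n k := fun u hu =>
  ⟨⟨u, Q1minus_le_Qform hu, 0, Submodule.zero_mem _, by funext x; simp [koszul]⟩,
    extDeriv_mem_Q1minus hu⟩

/-- By Cartan's formula `dκb = (k + 1 + x₁ ∂₁ + ⋯ + xₙ ∂ₙ) b - κ db`. -/
theorem extDeriv_koszul_mem_Kform {b : Form n (k + 1)} (hb : b ∈ Qform n (k + 1)) :
    extDeriv (koszul b) ∈ Kform n (k + 1) := by
  refine ⟨⟨extDeriv (koszul b) + koszul (extDeriv b), fun ω => ?_, extDeriv b,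
    extDeriv_mem_Qform hb, by abel⟩, ?_⟩
  · rw [coef_add, coef_extDeriv_koszul (differentiable_of_mem_Qform hb)]
    exact Submodule.add_mem _ (Submodule.smul_mem _ _ (hb ω)) (euler_mem_Q1 (hb ω))
  · rw [extDeriv_extDeriv_of_contDiff (contDiff_koszul (contDiff_of_mem_Qform hb))]
    exact Submodule.zero_mem _

theorem BLambda_le_Qform : BLambda n k ≤ Qform n k := by
  refine Submodule.span_le.2 ?_
  rintro _ ⟨s, σ, -, rfl⟩
  exact formMono_mem_Qform s σ

theorem S1plus_le_Kform : S1plus n k ≤ Kform n k := by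
  cases k with
  | zero => exact Q1minus_le_Kform
  | succ k =>
    refine sup_le Q1minus_le_Kform (Submodule.span_le.2 ?_)
    rintro _ ⟨b, hb, rfl⟩
    exact extDeriv_koszul_mem_Kform (BLambda_le_Qform hb)

theorem Q1minus_le_S1plus : Q1minus n k ≤ S1plus n k := by
  cases k with
  | zero => exact le_rfl
  | succ k => exact le_sup_left

theorem Qform_le {V : Submodule ℝ (Form n k)} (hV : ∀ s σ, formMono s σ ∈ V) : Qform n k ≤ V := by
  intro u hu
  have : u = ∑ σ : Fin k ↪o Fin n, fun x => coef u σ ((∅ : Finset (Fin n)).piecewise 0 x) • dx σ := by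
    funext x
    rw [Finset.sum_apply]
    simpa using congrFun (form_eq_sum u) x
  rw [this]
  exact Submodule.sum_mem _ fun σ _ => smul_dx_mem (fun s _ => hV s σ) (hu σ)

theorem Qform_le_sup : Qform n k ≤ Q1minus n k ⊔ BLambda n k := by
  refine Qform_le fun s σ => ?_
  by_cases h : ∃ i ∈ s, i ∈ range σ
  · exact Submodule.mem_sup_right (Submodule.subset_span ⟨s, σ, h, rfl⟩)
  · push Not at h
    exact Submodule.mem_sup_left (Submodule.subset_span ⟨s, σ, h, rfl⟩)

/-- The operator `dκ` maps all of `𝒬₁Λ`, not only `ℬΛ`, into `𝒮₁⁺Λ`, since `dκ` preserves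
`𝒬₁⁻Λ`. -/
theorem extDeriv_koszul_mem_S1plus {b : Form n (k + 1)} (hb : b ∈ Qform n (k + 1)) :
    extDeriv (koszul b) ∈ S1plus n (k + 1) := by
  obtain ⟨b₀, h₀, b₁, h₁, rfl⟩ := Submodule.mem_sup.1 (Qform_le_sup hb)
  rw [koszul_add, extDeriv_add_of_contDiff
    (contDiff_koszul (contDiff_of_mem_Qform (Q1minus_le_Qform h₀)))
    (contDiff_koszul (contDiff_of_mem_BLambda h₁))]
  exact Submodule.add_mem _
    (Submodule.mem_sup_left (extDeriv_mem_Q1minus (koszul_mem_Q1minus h₀)))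
    (Submodule.mem_sup_right (Submodule.subset_span ⟨b₁, h₁, rfl⟩))

instance : FiniteDimensional ℝ (Qform n k) := by
  have : FiniteDimensional ℝ (Submodule.span ℝ
      (range fun p : Finset (Fin n) × (Fin k ↪o Fin n) => formMono p.1 p.2)) :=
    FiniteDimensional.span_of_finite ℝ (Set.finite_range _)
  exact Submodule.finiteDimensional_of_le
    (Qform_le (V := Submodule.span ℝ
      (range fun p : Finset (Fin n) × (Fin k ↪o Fin n) => formMono p.1 p.2))
      fun s σ => Submodule.subset_span ⟨(s, σ), rfl⟩)

/-! ### Vertex values: unisolvence -/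

/-- `(xⱼ - loⱼ)(xⱼ - hiⱼ)`, which vanishes at the vertices of the cell. -/
def Cell.bubble (F : Cell n) (j : Fin n) : Vec n → ℝ := fun x => (x j - F.lo j) * (x j - F.hi j)

theorem Cell.bubble_vertex {F : Cell n} (j : Fin n) {y : Vec n} (hy : y ∈ F.vertices) :
    F.bubble j y = 0 := by
  rcases Cell.mem_vertices.1 hy j with h | h <;> simp [Cell.bubble, h]

theorem Cell.differentiable_bubble (F : Cell n) (j : Fin n) : Differentiable ℝ (F.bubble j) :=
  ((differentiable_coord j).sub_const _).mul ((differentiable_coord j).sub_const _)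

theorem Cell.pd_bubble (F : Cell n) (i j : Fin n) (x : Vec n) :
    pd i (F.bubble j) x = if i = j then 2 * x j - F.lo j - F.hi j else 0 := by
  have h := hasDerivAt_comp_update (F.differentiable_bubble j) x i (x i)
  rw [update_eq_self] at h
  refine h.unique ?_
  split_ifs with hij
  · subst hij
    simp only [Cell.bubble, update_self]
    refine (((hasDerivAt_id (x i)).sub_const (F.lo i)).mul
      ((hasDerivAt_id (x i)).sub_const (F.hi i))).congr_deriv ?_
    simp
    ring
  · simp only [Cell.bubble, update_of_ne (Ne.symm hij)]
    exact hasDerivAt_const _ _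

/-- On each cell, a form of `Kform` is the sum of a form with coefficients in `𝒬₁` and of terms
that vanish at the vertices: `u_a = W_a - ∑ⱼ (xⱼ - loⱼ)(xⱼ - hiⱼ) ∂ⱼ c_{ja}`. -/
theorem exists_vertex_decomposition {u : Form n k} (hu : u ∈ Kform n k) :
    ∃ c ∈ Qform n (k + 1), ∀ F : Cell n, ∃ W : (Fin k → Fin n) → Vec n → ℝ,
      ∀ a, W a ∈ Q1 n ∧
        coef u a = W a - ∑ j, F.bubble j * pd j (coef c (Fin.cons j a)) := by
  obtain ⟨⟨w, hw, c, hc, rfl⟩, -⟩ := hu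
  refine ⟨c, hc, fun F => ?_⟩
  have hex : ∀ a, ∃ W : Vec n → ℝ, W ∈ Q1 n ∧
      coef (w - koszul c) a = W - ∑ j, F.bubble j * pd j (coef c (Fin.cons j a)) := by
    intro a
    have hp := fun j => pd_mem_Q1 j (hc (Fin.cons j a))
    have hpi := fun j => indepOf_pd_self j (hc (Fin.cons j a))
    -- `W a` is obtained from `w_a - ∑ⱼ xⱼ c_{ja}` by reducing each `xⱼ²` modulo
    -- `(xⱼ - loⱼ)(xⱼ - hiⱼ)`.
    refine ⟨coef w a - ∑ j, ((fun x => x j * (coef c (Fin.cons j a) x -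
      x j * pd j (coef c (Fin.cons j a)) x)) + (F.lo j + F.hi j) •
        (fun x => x j * pd j (coef c (Fin.cons j a)) x) -
          (F.lo j * F.hi j) • pd j (coef c (Fin.cons j a))), ?_, ?_⟩
    · refine Submodule.sub_mem _ (hw a) (Submodule.sum_mem _ fun j _ => ?_)
      have hm := coord_mul_mem_Q1 (hp j) (hpi j)
      refine Submodule.sub_mem _ (Submodule.add_mem _ (coord_mul_mem_Q1
        (Submodule.sub_mem _ (hc _) hm) fun x t => ?_) (Submodule.smul_mem _ _ hm))
        (Submodule.smul_mem _ _ (hp j))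
      change coef c (Fin.cons j a) (update x j t) -
          update x j t j * pd j (coef c (Fin.cons j a)) (update x j t) =
        coef c (Fin.cons j a) x - x j * pd j (coef c (Fin.cons j a)) x
      rw [apply_update_of_mem_Q1 (hc _), hpi j x t, update_self]
      ring
    · rw [coef_sub, coef_koszul]
      funext x
      simp only [Pi.sub_apply, Finset.sum_apply, Pi.add_apply, Pi.smul_apply, Pi.mul_apply,
        smul_eq_mul, sub_sub, ← Finset.sum_add_distrib]
      congr 1
      refine Finset.sum_congr rfl fun j _ => ?_
      simp only [Cell.bubble]
      ring
  choose W hW using hex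
  exact ⟨W, hW⟩

section Decomposed

variable {u : Form n k} {c : Form n (k + 1)} {F : Cell n} {W : (Fin k → Fin n) → Vec n → ℝ}

theorem coef_vertex (hW : ∀ a, W a ∈ Q1 n ∧
      coef u a = W a - ∑ j, F.bubble j * pd j (coef c (Fin.cons j a)))
    (a : Fin k → Fin n) {y : Vec n} (hy : y ∈ F.vertices) : coef u a y = W a y := by
  rw [(hW a).2]
  simp [Cell.bubble_vertex _ hy]

theorem pd_coef_vertex (hc : c ∈ Qform n (k + 1)) (hW : ∀ a, W a ∈ Q1 n ∧
      coef u a = W a - ∑ j, F.bubble j * pd j (coef c (Fin.cons j a)))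
    (a : Fin k → Fin n) (i : Fin n) {y : Vec n} (hy : y ∈ F.vertices) :
    pd i (coef u a) y = pd i (W a) y -
      (coef c (Fin.cons i a) y - coef c (Fin.cons i a) (F.flip i y)) := by
  have hd := fun j => differentiable_of_mem_Q1 (pd_mem_Q1 j (hc (Fin.cons j a)))
  have hb := fun j => (F.differentiable_bubble j).mul (hd j)
  rw [(hW a).2, pd_sub _ (differentiable_of_mem_Q1 (hW a).1)
    (Differentiable.sum fun j _ => hb j), pd_sum _ _ fun j _ => hb j]
  have : ∀ j, pd i (F.bubble j * pd j (coef c (Fin.cons j a))) y =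
      if i = j then (2 * y i - F.lo i - F.hi i) * pd i (coef c (Fin.cons i a)) y else 0 := by
    intro j
    rw [pd_mul _ (F.differentiable_bubble j) (hd j)]
    simp only [Pi.add_apply, Pi.mul_apply, Cell.pd_bubble, Cell.bubble_vertex j hy, zero_mul,
      add_zero]
    split_ifs with h
    · subst h; rfl
    · simp
  simp only [Pi.sub_apply, Finset.sum_apply]
  rw [Finset.sum_congr rfl fun j _ => this j, Finset.sum_ite_eq, if_pos (Finset.mem_univ i),
    F.flip_mul_pd (hc _)]

/-- At the vertices, `du` differs from the exterior derivative of the multilinear interpolant by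
graph Laplacians of the hypercube. -/
theorem coef_extDeriv_vertex (hu : Differentiable ℝ u) (hc : c ∈ Qform n (k + 1))
    (hW : ∀ a, W a ∈ Q1 n ∧
      coef u a = W a - ∑ j, F.bubble j * pd j (coef c (Fin.cons j a)))
    (ω : Fin (k + 1) → Fin n) {y : Vec n} (hy : y ∈ F.vertices) :
    coef (extDeriv u) ω y =
      ∑ l : Fin (k + 1), (-1 : ℝ) ^ (l : ℕ) * pd (ω l) (W (l.removeNth ω)) y -
        ∑ l, (coef c ω y - coef c ω (F.flip (ω l) y)) := by
  rw [coef_extDeriv hu, ← Finset.sum_sub_distrib]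
  simp only [Finset.sum_apply, Pi.smul_apply, smul_eq_mul]
  refine Finset.sum_congr rfl fun l _ => ?_
  rw [pd_coef_vertex hc hW _ _ hy, coef_cons_removeNth]
  simp only [Pi.smul_apply, smul_eq_mul]
  have : ((-1 : ℝ) ^ (l : ℕ)) * (-1) ^ (l : ℕ) = 1 := by rw [← mul_pow]; simp
  linear_combination (-(coef c ω y - coef c ω (F.flip (ω l) y))) * this

theorem Cell.sum_mul_sub_flip (F : Cell n) (i : Fin n) {D : Vec n → ℝ} (ψ : Vec n → ℝ)
    (hD : ∀ y ∈ F.vertices, D (F.flip i y) = D y) :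
    ∑ y ∈ F.vertices, D y * (ψ y - ψ (F.flip i y)) = 0 := by
  have h := F.sum_flip i fun y => D y * ψ y
  simp only [mul_sub, Finset.sum_sub_distrib]
  rw [← h, sub_eq_zero]
  exact Finset.sum_congr rfl fun y hy => by rw [hD y hy]

/-- A function on the vertices that is harmonic for the graph Laplacian in the directions `ω` is
invariant under the reflections in these directions. -/
theorem Cell.eq_flip_of_harmonic (F : Cell n) {m : ℕ} (ω : Fin m → Fin n) {ψ : Vec n → ℝ}
    (h : ∀ y ∈ F.vertices, ∑ l, (ψ y - ψ (F.flip (ω l) y)) = 0) (l : Fin m) {y : Vec n}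
    (hy : y ∈ F.vertices) : ψ y = ψ (F.flip (ω l) y) := by
  have key : ∀ l, ∑ y ∈ F.vertices, (ψ y - ψ (F.flip (ω l) y)) ^ 2 =
      2 * ∑ y ∈ F.vertices, ψ y * (ψ y - ψ (F.flip (ω l) y)) := by
    intro l
    have h1 := F.sum_flip (ω l) fun y => ψ y * (ψ y - ψ (F.flip (ω l) y))
    simp only [F.flip_flip] at h1
    rw [two_mul]
    nth_rewrite 2 [← h1]
    rw [← Finset.sum_add_distrib]
    exact Finset.sum_congr rfl fun y _ => by ring
  have h0 : ∑ l, ∑ y ∈ F.vertices, (ψ y - ψ (F.flip (ω l) y)) ^ 2 = 0 := by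
    rw [Finset.sum_congr rfl fun l _ => key l, ← Finset.mul_sum, Finset.sum_comm]
    rw [Finset.sum_eq_zero, mul_zero]
    intro y hy
    rw [← Finset.mul_sum, h y hy, mul_zero]
  have h1 := (Finset.sum_eq_zero_iff_of_nonneg fun l _ =>
    Finset.sum_nonneg fun y _ => sq_nonneg _).1 h0 l (Finset.mem_univ l)
  have h2 := (Finset.sum_eq_zero_iff_of_nonneg fun y _ => sq_nonneg _).1 h1 y hy
  exact sub_eq_zero.1 (pow_eq_zero_iff two_ne_zero |>.1 h2)

/-- A discrete Stokes theorem: `(du)_ω` vanishes at the vertices if the relevant averages of the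
interpolants of the coefficients of `u` do. Indeed `(du)_ω` is invariant under the reflections in
the directions `ω`, so summing its square over the vertices removes the graph Laplacians and
replaces the interpolants by their averages. -/
theorem coef_extDeriv_vertex_eq_zero (hu : u ∈ Kform n k) (hc : c ∈ Qform n (k + 1))
    (hW : ∀ a, W a ∈ Q1 n ∧
      coef u a = W a - ∑ j, F.bubble j * pd j (coef c (Fin.cons j a)))
    (ω : Fin (k + 1) → Fin n)
    (h : ∀ l, ∀ y ∈ F.vertices,
      pd (ω l) (W (l.removeNth ω)) ((Finset.univ.image ω).piecewise F.mid y) = 0)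
    {y : Vec n} (hy : y ∈ F.vertices) : coef (extDeriv u) ω y = 0 := by
  have hind := (mem_Q1minus_iff.1 hu.2).2 ω
  set D := coef (extDeriv u) ω with hD
  have hflip : ∀ i ∈ Finset.univ.image ω, ∀ y ∈ F.vertices, D (F.flip i y) = D y := by
    intro i hi y _
    obtain ⟨l, -, rfl⟩ := Finset.mem_image.1 hi
    exact hind l _ _
  have hsum : ∑ y ∈ F.vertices, D y ^ 2 = 0 := by
    have h1 : ∀ y ∈ F.vertices, D y ^ 2 =
        ∑ l : Fin (k + 1), (-1 : ℝ) ^ (l : ℕ) * (D y * pd (ω l) (W (l.removeNth ω)) y) -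
          ∑ l, D y * (coef c ω y - coef c ω (F.flip (ω l) y)) := by
      intro y hy
      rw [sq]
      nth_rewrite 2 [hD]
      rw [coef_extDeriv_vertex (differentiable_of_mem_Kform hu) hc hW ω hy, mul_sub,
        Finset.mul_sum, Finset.mul_sum]
      congr 1
      exact Finset.sum_congr rfl fun l _ => by ring
    rw [Finset.sum_congr rfl h1, Finset.sum_sub_distrib, Finset.sum_comm,
      Finset.sum_comm (s := F.vertices)]
    rw [Finset.sum_eq_zero, Finset.sum_eq_zero, sub_zero]
    · intro l _
      exact F.sum_mul_sub_flip (ω l) _ (hflip _ (Finset.mem_image_of_mem _ (Finset.mem_univ l)))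
    · intro l _
      rw [← Finset.mul_sum, ← F.sum_mul_piecewise_mid _ hflip (pd_mem_Q1 _ (hW _).1),
        Finset.sum_eq_zero, mul_zero]
      intro y hy
      rw [h l y hy, mul_zero]
  exact pow_eq_zero_iff two_ne_zero |>.1
    ((Finset.sum_eq_zero_iff_of_nonneg fun y _ => sq_nonneg _).1 hsum y hy)

end Decomposed

theorem Cell.update_mem_hull {F : Cell n} {x : Vec n} (hx : x ∈ F.hull) {i : Fin n}
    (hi : i ∈ F.dirs) (t : ℝ) : update x i t ∈ F.hull := fun j hj => by
  rw [update_of_ne (by rintro rfl; exact hj hi)]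
  exact hx j hj

theorem Cell.pd_eq_zero_on_hull {F : Cell n} {g : Vec n → ℝ} (hg : g ∈ Q1 n)
    (h : ∀ x ∈ F.hull, g x = 0) {i : Fin n} (hi : i ∈ F.dirs) {x : Vec n} (hx : x ∈ F.hull) :
    pd i g x = 0 := by
  have h1 := apply_update_of_mem_Q1 hg x i (x i + 1)
  rw [h _ (Cell.update_mem_hull hx hi _), h x hx] at h1
  linarith

/-- Unisolvence on faces: the trace of `u` on (the affine hull of) a cell is determined by the
tangential components at the vertices of the cell. If these vanish, so do the interpolants `W`,
and then the tangential part of `du`, by `coef_extDeriv_vertex_eq_zero`. What is left of the formula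
for `du` at the vertices says that the `c_ω` are harmonic, hence invariant under the reflections in
the directions `ω`, and the terms `(xⱼ - loⱼ)(xⱼ - hiⱼ) ∂ⱼ c_{ja}` vanish too. -/
theorem coef_eq_zero_on_hull {u : Form n k} (hu : u ∈ Kform n k) (F : Cell n)
    (h : ∀ σ : Fin k ↪o Fin n, (∀ j, σ j ∈ F.dirs) → ∀ y ∈ F.vertices, coef u σ y = 0)
    {a : Fin k → Fin n} (ha : ∀ j, a j ∈ F.dirs) {x : Vec n} (hx : x ∈ F.hull) :
    coef u a x = 0 := by
  obtain ⟨c, hc, hF⟩ := exists_vertex_decomposition hu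
  obtain ⟨W, hW⟩ := hF F
  have hW0 : ∀ a : Fin k → Fin n, (∀ j, a j ∈ F.dirs) → ∀ x ∈ F.hull, W a x = 0 := by
    intro a ha x hx
    refine F.eq_zero_of_vertices (hW a).1 (fun y hy => ?_) hx
    rw [← coef_vertex hW a hy]
    exact alt_frame_eq_zero_of_increasing (fun σ hσ => h σ hσ y hy) ha
  have hharm : ∀ ω : Fin (k + 1) → Fin n, (∀ l, ω l ∈ F.dirs) → ∀ l, ∀ x ∈ F.hull,
      pd (ω l) (coef c ω) x = 0 := by
    intro ω hω l x hx
    have hpW : ∀ l, ∀ x ∈ F.hull, pd (ω l) (W (l.removeNth ω)) x = 0 := fun l x hx =>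
      Cell.pd_eq_zero_on_hull (hW _).1 (hW0 _ fun j => hω _) (hω l) hx
    refine F.eq_zero_of_vertices (pd_mem_Q1 _ (hc ω)) (fun y hy => ?_) hx
    have hlap : ∀ y ∈ F.vertices, ∑ l, (coef c ω y - coef c ω (F.flip (ω l) y)) = 0 := by
      intro y hy
      have h1 := coef_extDeriv_vertex (differentiable_of_mem_Kform hu) hc hW ω hy
      rw [coef_extDeriv_vertex_eq_zero hu hc hW ω (fun l y hy => hpW l _ fun j hj => ?_) hy,
        Finset.sum_eq_zero] at h1
      · linarith
      · intro l _
        rw [hpW l y (Cell.vertices_subset_hull hy), mul_zero]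
      · simp only [Finset.piecewise]
        split_ifs
        · exact Cell.toSet_subset_hull F.mid_mem_toSet j hj
        · exact Cell.vertices_subset_hull hy j hj
    have h2 := F.eq_flip_of_harmonic ω hlap l hy
    have h3 := F.flip_mul_pd (hc ω) (ω l) y
    rw [h2, sub_self] at h3
    refine (mul_eq_zero.1 h3).resolve_left ?_
    have hlt := Cell.mem_dirs.1 (hω l)
    rcases Cell.mem_vertices.1 hy (ω l) with h | h <;> rw [h]
    · exact ne_of_lt (by linarith)
    · exact ne_of_gt (by linarith)
  rw [(hW a).2]
  simp only [Pi.sub_apply, Finset.sum_apply, Pi.mul_apply]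
  rw [hW0 a ha x hx, Finset.sum_eq_zero, sub_zero]
  intro j _
  by_cases hj : j ∈ F.dirs
  · have := hharm (Fin.cons j a) (fun l => by
      refine Fin.cases ?_ (fun l => ?_) l
      · simpa using hj
      · simpa using ha l) 0 x hx
    rw [Fin.cons_zero] at this
    rw [this, mul_zero]
  · simp [Cell.bubble, hx j hj]

theorem Cell.mem_dirs_of_lt {T : Cell n} (hT : ∀ i, T.lo i < T.hi i) (i : Fin n) : i ∈ T.dirs :=
  Cell.mem_dirs.2 (hT i)

theorem Cell.mem_hull {T : Cell n} (hT : ∀ i, T.lo i < T.hi i) (x : Vec n) : x ∈ T.hull :=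
  fun i hi => absurd (T.mem_dirs_of_lt hT i) hi

/-- A form of `Kform` is determined by its values at the vertices of a box. -/
theorem eq_zero_of_vertices {u : Form n k} (hu : u ∈ Kform n k) {T : Cell n}
    (hT : ∀ i, T.lo i < T.hi i) (h : ∀ y ∈ T.vertices, u y = 0) : u = 0 := by
  refine form_ext fun a => ?_
  funext x
  refine coef_eq_zero_on_hull hu T (fun σ _ y hy => ?_) (fun j => T.mem_dirs_of_lt hT _)
    (Cell.mem_hull hT x)
  simp [coef, h y hy]

end KForms

/-! ### Vertex values: existence -/

section Local
variable {n k : ℕ}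

/-- The multilinear interpolant of a form at the vertices of the box `T`. -/
def interpForm (T : Cell n) : Form n k →ₗ[ℝ] Form n k where
  toFun u := fun x => ∑ σ : Fin k ↪o Fin n, T.interp (coef u σ) x • dx σ
  map_add' u v := by
    funext x
    simp [coef_add, add_smul, Finset.sum_add_distrib]
  map_smul' c u := by
    funext x
    simp [coef_smul, mul_smul, Finset.smul_sum]

theorem coef_interpForm (T : Cell n) (u : Form n k) (σ : Fin k ↪o Fin n) :
    coef (interpForm T u) σ = T.interp (coef u σ) :=
  coef_sum_smul_dx (fun (σ : Fin k ↪o Fin n) => T.interp (coef u σ)) σ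

theorem interpForm_mem_Qform (T : Cell n) (u : Form n k) : interpForm T u ∈ Qform n k := by
  intro a
  have : coef (interpForm T u) a =
      ∑ σ : Fin k ↪o Fin n, dx σ (frame a) • T.interp (coef u σ) := by
    funext x
    simp [interpForm, coef, ContinuousAlternatingMap.sum_apply, mul_comm]
  rw [this]
  exact Submodule.sum_mem _ fun σ _ => Submodule.smul_mem _ _ (T.interp_mem_Q1 _)

theorem interpForm_vertex {T : Cell n} (hT : ∀ i, T.lo i < T.hi i) (u : Form n k) {y : Vec n}
    (hy : y ∈ T.vertices) : interpForm T u y = u y := by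
  refine alt_ext fun σ => ?_
  have h := congrFun (coef_interpForm T u σ) y
  rw [Cell.interp_apply hT _ hy] at h
  exact h

/-- If `x₁ G₁ + ⋯ + xₙ Gₙ` has no terms of degree two in `xᵢ`, then `Gᵢ` does not depend on
`xᵢ`. -/
theorem pd_eq_zero_of_sum_coord_mul {G : Fin n → Vec n → ℝ} (hG : ∀ j, G j ∈ Q1 n)
    {H : Vec n → ℝ} (hH : H ∈ Q1 n) (h : ∀ x, ∑ j, x j * G j x = H x) (i : Fin n) :
    pd i (G i) = 0 := by
  funext x
  have hval : ∀ s : ℝ, ∑ j, (x j + if i = j then s else 0) * (G j x + s * pd i (G j) x) =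
      H x + s * pd i H x := by
    intro s
    have h1 := h (update x i (x i + s))
    rw [apply_update_of_mem_Q1 hH, add_sub_cancel_left] at h1
    rw [← h1]
    refine Finset.sum_congr rfl fun j _ => ?_
    rw [apply_update_of_mem_Q1 (hG j), add_sub_cancel_left]
    congr 1
    by_cases hij : i = j
    · subst hij; simp
    · simp [hij, update_of_ne (Ne.symm hij)]
  have h1 := hval 1
  have h2 := hval (-1)
  have h3 := h x
  have h4 : ∑ j, ((x j + if i = j then 1 else 0) * (G j x + 1 * pd i (G j) x) +
      (x j + if i = j then -1 else 0) * (G j x + -1 * pd i (G j) x) - 2 * (x j * G j x)) =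
      ∑ j, if i = j then 2 * pd i (G j) x else 0 := by
    refine Finset.sum_congr rfl fun j _ => ?_
    split_ifs <;> ring
  rw [Finset.sum_sub_distrib, Finset.sum_add_distrib, ← Finset.mul_sum, h1, h2, h3,
    Finset.sum_ite_eq, if_pos (Finset.mem_univ i)] at h4
  simp only [Pi.zero_apply]
  linarith

/-- The map `b ↦ dκb + freeze b` is injective on `𝒬₁Λ^{k+1}`: if the image of `b` is zero, then
Cartan's formula forces `b ∈ 𝒬₁⁻Λ` and `db = 0`, and reduces to `(k + 2 + x₁ ∂₁ + ⋯) b = 0`. -/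
theorem extDeriv_koszul_add_freeze_injective {b : Form n (k + 1)} (hb : b ∈ Qform n (k + 1))
    (h : extDeriv (koszul b) + freeze 0 b = 0) : b = 0 := by
  have hbd := differentiable_of_mem_Qform hb
  have hfr := mem_Q1minus_iff.1 (freeze_mem_Q1minus 0 hb)
  have hdb := extDeriv_mem_Qform hb
  have heq : ∀ ω, coef (koszul (extDeriv b)) ω =
      ((k + 1 : ℕ) : ℝ) • coef b ω + euler (coef b ω) + coef (freeze 0 b) ω := by
    intro ω
    have h1 := coef_extDeriv_koszul hbd ω
    have h2 : coef (extDeriv (koszul b)) ω + coef (freeze 0 b) ω = 0 := by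
      rw [← coef_add, h, coef_zero]
    rw [← h1, add_assoc, add_comm (coef (koszul (extDeriv b)) ω), ← add_assoc, h2, zero_add]
  -- comparison of the terms of degree two shows `db ∈ 𝒬₁⁻Λ`
  have hdb' : extDeriv b ∈ Q1minus n (k + 2) := by
    refine mem_Q1minus_iff.2 ⟨hdb, fun ν l => (indepOf_iff_pd_eq_zero (hdb ν)).2 ?_⟩
    have h1 : pd (ν l) (coef (extDeriv b) (Fin.cons (ν l) (l.removeNth ν))) = 0 := by
      refine pd_eq_zero_of_sum_coord_mul (G := fun j => coef (extDeriv b)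
        (Fin.cons j (l.removeNth ν))) (H := ((k + 1 : ℕ) : ℝ) • coef b (l.removeNth ν) +
          euler (coef b (l.removeNth ν)) + coef (freeze 0 b) (l.removeNth ν))
        (fun j => hdb _) (Submodule.add_mem _ (Submodule.add_mem _
          (Submodule.smul_mem _ _ (hb _)) (euler_mem_Q1 (hb _))) (hfr.1 _)) (fun x => ?_) (ν l)
      have h2 := congrFun (heq (l.removeNth ν)) x
      rw [coef_koszul] at h2
      exact h2
    rw [coef_cons_removeNth, pd_smul _ _ (differentiable_of_mem_Q1 (hdb ν))] at h1
    exact (smul_eq_zero.1 h1).resolve_left (pow_ne_zero _ (by norm_num))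
  have hkd := mem_Q1minus_iff.1 (koszul_mem_Q1minus hdb')
  -- differentiation of the identity in the directions of `ω` shows `b ∈ 𝒬₁⁻Λ`
  have hb' : b ∈ Q1minus n (k + 1) := by
    refine mem_Q1minus_iff.2 ⟨hb, fun ω l => (indepOf_iff_pd_eq_zero (hb ω)).2 ?_⟩
    have h1 := congrArg (pd (ω l)) (heq ω)
    have d1 := differentiable_of_mem_Q1 (hb ω)
    have d2 := differentiable_of_mem_Q1 (euler_mem_Q1 (hb ω))
    have d3 := differentiable_of_mem_Q1 (Submodule.smul_mem _ ((k + 1 : ℕ) : ℝ) (hb ω))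
    rw [pd_add _ (d3.add d2) (differentiable_of_mem_Q1 (hfr.1 ω)), pd_add _ d3 d2,
      pd_smul _ _ d1, pd_euler (hb ω), (indepOf_iff_pd_eq_zero (hkd.1 ω)).1 (hkd.2 ω l),
      (indepOf_iff_pd_eq_zero (hfr.1 ω)).1 (hfr.2 ω l), add_zero] at h1
    refine eq_zero_of_mul_add_euler (pd_mem_Q1 _ (hb ω)) (Nat.succ_pos (k + 1)) ?_
    rw [h1]
    push_cast
    module
  rw [freeze_eq_self 0 hb'] at h
  have hd0 : extDeriv b = 0 := by
    have h1 := congrArg (fun u : Form n (k + 1) => extDeriv u) h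
    change extDeriv (extDeriv (koszul b) + b) = extDeriv 0 at h1
    rw [extDeriv_add_of_contDiff
      (contDiff_extDeriv (contDiff_koszul (contDiff_of_mem_Qform hb))) (contDiff_of_mem_Qform hb),
      extDeriv_extDeriv_of_contDiff (contDiff_koszul (contDiff_of_mem_Qform hb)), zero_add] at h1
    rw [h1]
    have := extDeriv_smul' 0 (0 : Form n (k + 1))
    simpa using this
  refine form_ext fun ω => ?_
  refine eq_zero_of_mul_add_euler (hb ω) (Nat.succ_pos (k + 1)) ?_
  have h1 := heq ω
  rw [freeze_eq_self 0 hb', hd0] at h1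
  have h2 : coef (koszul (0 : Form n (k + 2))) ω = 0 := by
    rw [coef_koszul]
    funext x
    simp
  rw [h2] at h1
  rw [h1]
  push_cast
  module

theorem surjective_of_ker_eq_zero {V : Type*} [AddCommGroup V] [Module ℝ V]
    [FiniteDimensional ℝ V] (Φ : V →ₗ[ℝ] V) (h : ∀ b, Φ b = 0 → b = 0) : Surjective Φ :=
  LinearMap.injective_iff_surjective.1 ((injective_iff_map_eq_zero Φ).2 h)

/-- Arbitrary values at the vertices of a box are attained by a form of `𝒮₁⁺Λ^k`. The dimension
of `𝒮₁⁺Λ^k` is not computed: for `k > 0` the forms `dκb + freeze b`, `b ∈ 𝒬₁Λ^k`, already take all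
vertex values. -/
theorem exists_S1plus_vertex {T : Cell n} (hT : ∀ i, T.lo i < T.hi i) (D : Form n k) :
    ∃ u ∈ S1plus n k, ∀ y ∈ T.vertices, u y = D y := by
  cases k with
  | zero =>
    exact ⟨interpForm T D, mem_Q1minus_iff.2 ⟨interpForm_mem_Qform T D, fun _ l => l.elim0⟩,
      fun y hy => interpForm_vertex hT D hy⟩
  | succ k =>
    -- `b ↦ dκb + freeze b` followed by interpolation is an injective endomorphism of `𝒬₁Λ`
    set Ψ : Qform n (k + 1) →ₗ[ℝ] Form n (k + 1) :=
      { toFun := fun b => extDeriv (koszul b.1) + freeze 0 b.1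
        map_add' := fun b b' => by
          simp only [Submodule.coe_add, koszul_add, map_add]
          rw [extDeriv_add_of_contDiff (contDiff_koszul (contDiff_of_mem_Qform b.2))
            (contDiff_koszul (contDiff_of_mem_Qform b'.2))]
          abel
        map_smul' := fun c b => by
          simp only [Submodule.coe_smul, koszul_smul, map_smul, extDeriv_smul', RingHom.id_apply,
            smul_add] } with hΨ
    have hΨS : ∀ b, Ψ b ∈ S1plus n (k + 1) := fun b =>
      Submodule.add_mem _ (extDeriv_koszul_mem_S1plus b.2)
        (Q1minus_le_S1plus (freeze_mem_Q1minus 0 b.2))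
    set Φ : Qform n (k + 1) →ₗ[ℝ] Qform n (k + 1) :=
      ((interpForm T).comp Ψ).codRestrict _ fun b => interpForm_mem_Qform T _ with hΦ
    have hinj : ∀ b, Φ b = 0 → b = 0 := by
      intro b hb
      have h1 : interpForm T (Ψ b) = 0 := congrArg Subtype.val hb
      have h2 : Ψ b = 0 := by
        refine eq_zero_of_vertices (S1plus_le_Kform (hΨS b)) hT fun y hy => ?_
        rw [← interpForm_vertex hT (Ψ b) hy, h1]
        rfl
      exact Subtype.ext (extDeriv_koszul_add_freeze_injective b.2 h2)
    obtain ⟨b, hb⟩ := surjective_of_ker_eq_zero (V := Qform n (k + 1)) Φ hinj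
      ⟨interpForm T D, interpForm_mem_Qform T D⟩
    have h1 : interpForm T (Ψ b) = interpForm T D := congrArg Subtype.val hb
    refine ⟨Ψ b, hΨS b, fun y hy => ?_⟩
    rw [← interpForm_vertex hT (Ψ b) hy, h1, interpForm_vertex hT D hy]

/-! ### Faces and degrees of freedom -/

namespace Cell

theorem tangent_mem_dirs (f : Cell n) (hf : f.dim = k) (j : Fin k) : f.tangent hf j ∈ f.dirs :=
  Finset.orderEmbOfFin_mem _ _ _

theorem image_tangent (f : Cell n) (hf : f.dim = k) :
    Finset.univ.image (f.tangent hf) = f.dirs := by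
  ext i
  have : range (f.tangent hf) = f.dirs := Finset.range_orderEmbOfFin _ _
  simpa using Set.ext_iff.1 this i

theorem IsFace.vertices_subset {f T : Cell n} (h : f.IsFace T) : f.vertices ⊆ T.vertices := by
  intro y hy
  rw [mem_vertices] at hy ⊢
  intro i
  rcases h i with ⟨h1, h2⟩ | ⟨h1, h2⟩ | ⟨h1, h2⟩ <;> rcases hy i with h | h <;>
    simp [h, h1, h2]

theorem IsFace.trans {f F T : Cell n} (h : f.IsFace F) (h' : F.IsFace T) : f.IsFace T := by
  intro i
  rcases h i with ⟨h1, h2⟩ | ⟨h1, h2⟩ | ⟨h1, h2⟩ <;>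
    rcases h' i with ⟨h3, h4⟩ | ⟨h3, h4⟩ | ⟨h3, h4⟩ <;> simp [h1, h2, h3, h4]

theorem IsFace.mid_eq {f T : Cell n} (h : f.IsFace T) {i : Fin n} (hi : i ∈ f.dirs) :
    f.mid i = T.mid i := by
  have hlt := mem_dirs.1 hi
  rcases h i with ⟨h1, h2⟩ | ⟨h1, h2⟩ | ⟨h1, h2⟩
  · simp [mid, h1, h2]
  · exact absurd hlt (by rw [h1, h2]; exact lt_irrefl _)
  · exact absurd hlt (by rw [h1, h2]; exact lt_irrefl _)

/-- Through each vertex of a cell there is a face with given directions. -/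
theorem exists_face (F : Cell n) (σ : Fin k ↪o Fin n) (hσ : ∀ j, σ j ∈ F.dirs) {y : Vec n}
    (hy : y ∈ F.vertices) :
    ∃ (f : Cell n) (hf : f.dim = k), f.IsFace F ∧ f.tangent hf = σ ∧ y ∈ f.vertices := by
  classical
  set f : Cell n :=
    { lo := fun i => if i ∈ range σ then F.lo i else y i
      hi := fun i => if i ∈ range σ then F.hi i else y i
      le := fun i => by
        dsimp only
        split_ifs
        · exact F.le i
        · exact le_rfl } with hfdef
  have hdirs : f.dirs = Finset.univ.image σ := by
    ext i
    rw [mem_dirs]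
    by_cases hi : i ∈ range σ
    · obtain ⟨j, rfl⟩ := hi
      simpa [hfdef] using mem_dirs.1 (hσ j)
    · have : ∀ j, σ j ≠ i := fun j hj => hi ⟨j, hj⟩
      simp [hfdef, this]
  have hdim : f.dim = k := by
    rw [dim, hdirs, Finset.card_image_of_injective _ σ.injective]
    simp
  have hin : ∀ i ∈ range σ, f.lo i = F.lo i ∧ f.hi i = F.hi i := fun i hi =>
    ⟨if_pos hi, if_pos hi⟩
  have hout : ∀ i ∉ range σ, f.lo i = y i ∧ f.hi i = y i := fun i hi => ⟨if_neg hi, if_neg hi⟩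
  refine ⟨f, hdim, fun i => ?_, ?_, mem_vertices.2 fun i => ?_⟩
  · by_cases hi : i ∈ range σ
    · exact Or.inl (hin i hi)
    · rw [(hout i hi).1, (hout i hi).2]
      rcases mem_vertices.1 hy i with h | h <;> simp [h]
  · exact (Finset.orderEmbOfFin_unique' hdim fun j => by rw [hdirs]; simp).symm
  · by_cases hi : i ∈ range σ
    · rw [(hin i hi).1, (hin i hi).2]
      exact mem_vertices.1 hy i
    · exact Or.inl (hout i hi).1.symm

end Cell

/-- The trace of `u` on a `k`-dimensional cell has its coefficient in `𝒬₁`. -/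
theorem exists_trace_mem_Q1 {u : Form n k} (hu : u ∈ Kform n k) (f : Cell n) (hf : f.dim = k) :
    ∃ g ∈ Q1 n, ∀ x ∈ f.hull, coef u (f.tangent hf) x = g x := by
  obtain ⟨c, hc, hF⟩ := exists_vertex_decomposition hu
  obtain ⟨W, hW⟩ := hF f
  refine ⟨W (f.tangent hf), (hW _).1, fun x hx => ?_⟩
  rw [(hW _).2]
  simp only [Pi.sub_apply, Finset.sum_apply, Pi.mul_apply]
  rw [Finset.sum_eq_zero, sub_zero]
  intro j _
  by_cases hj : j ∈ f.dirs
  · have h0 : coef c (Fin.cons j (f.tangent hf)) = 0 := by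
      funext x
      refine alt_frame_eq_zero fun hinj => ?_
      have : j ∈ Finset.univ.image (f.tangent hf) := by rwa [f.image_tangent hf]
      obtain ⟨l, -, hl⟩ := Finset.mem_image.1 this
      exact absurd (@hinj 0 l.succ (by simp [hl])) (Fin.succ_ne_zero l).symm
    simp [h0]
  · simp [Cell.bubble, hx j hj]

theorem traceIntegral_eq {u : Form n k} {f : Cell n} {hf : f.dim = k} {g : Vec n → ℝ}
    (h : ∀ x ∈ f.hull, coef u (f.tangent hf) x = g x) (q : Vec n → ℝ) :
    f.traceIntegral hf u q = ∫ x in f.toSet, g x * q x ∂f.planeMeasure := by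
  refine setIntegral_congr_fun f.isCompact_toSet.measurableSet fun x hx => ?_
  change coef u (f.tangent hf) x * q x = _
  rw [h x (Cell.toSet_subset_hull hx)]

theorem traceIntegral_one_eq {u : Form n k} {f : Cell n} {hf : f.dim = k} {g : Vec n → ℝ}
    (hg : g ∈ Q1 n) (h : ∀ x ∈ f.hull, coef u (f.tangent hf) x = g x) :
    f.traceIntegral hf u 1 = f.size * g f.mid := by
  rw [traceIntegral_eq h]
  simpa using f.setIntegral_of_mem_Q1 hg

/-- The degrees of freedom of `𝒮₁⁺Λ^k` on a face determine the tangential components at its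
vertices, and conversely. -/
theorem traceIntegral_eq_iff {u u' : Form n k} (hu : u ∈ Kform n k) (hu' : u' ∈ Kform n k)
    (f : Cell n) (hf : f.dim = k) :
    (∀ q ∈ Q1 n, f.traceIntegral hf u q = f.traceIntegral hf u' q) ↔
      ∀ y ∈ f.vertices, coef u (f.tangent hf) y = coef u' (f.tangent hf) y := by
  obtain ⟨g, hg, hug⟩ := exists_trace_mem_Q1 hu f hf
  obtain ⟨g', hg', hug'⟩ := exists_trace_mem_Q1 hu' f hf
  constructor
  · intro h y hy
    obtain ⟨q, hq, hd⟩ := f.exists_dual hy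
    have h1 := h q hq
    rw [traceIntegral_eq hug, traceIntegral_eq hug', hd g hg, hd g' hg'] at h1
    rw [hug y (Cell.vertices_subset_hull hy), hug' y (Cell.vertices_subset_hull hy), h1]
  · intro h q _
    refine (traceIntegral_eq hug q).trans (traceIntegral_eq (fun x hx => ?_) q).symm
    have h1 := f.eq_zero_of_vertices (Submodule.sub_mem _ hg hg') (fun y hy => ?_) hx
    · rw [hug' x hx]
      simp only [Pi.sub_apply] at h1
      linarith
    · have := h y hy
      rw [hug y (Cell.vertices_subset_hull hy), hug' y (Cell.vertices_subset_hull hy)] at this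
      simp [this]

theorem coef_tangent_eq_of_mem_Q1minus {u : Form n k} (hu : u ∈ Q1minus n k) {f : Cell n}
    (hf : f.dim = k) {x x' : Vec n} (hx : x ∈ f.hull) (hx' : x' ∈ f.hull) :
    coef u (f.tangent hf) x = coef u (f.tangent hf) x' := by
  have h := piecewise_of_indepOf f.dirs (g := coef u (f.tangent hf)) (fun i hi => by
    rw [← f.image_tangent hf] at hi
    obtain ⟨l, -, rfl⟩ := Finset.mem_image.1 hi
    exact (mem_Q1minus_iff.1 hu).2 _ l) x x'
  rw [← h]
  congr 1
  funext i
  by_cases hi : i ∈ f.dirs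
  · simp [hi]
  · simp [hi, hx i hi, hx' i hi]

theorem traceIntegral_one_of_mem_Q1minus {u : Form n k} (hu : u ∈ Q1minus n k) {f : Cell n}
    (hf : f.dim = k) {x : Vec n} (hx : x ∈ f.hull) :
    f.traceIntegral hf u 1 = f.size * coef u (f.tangent hf) x := by
  obtain ⟨g, hg, hug⟩ := exists_trace_mem_Q1 (Q1minus_le_Kform hu) f hf
  have hm := Cell.toSet_subset_hull f.mid_mem_toSet
  rw [traceIntegral_one_eq hg hug, ← hug _ hm, coef_tangent_eq_of_mem_Q1minus hu hf hm hx]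

/-! ### The local projection onto `𝒬₁⁻Λ^k` -/

/-- The local projection onto `𝒬₁⁻Λ^k`: the variables `x_{σ 1}, …, x_{σ k}` are frozen at the
barycentre in the multilinear interpolant of the coefficient `u_σ`. -/
def proj (T : Cell n) : Form n k →ₗ[ℝ] Form n k := (freeze T.mid).comp (interpForm T)

theorem proj_mem_Q1minus (T : Cell n) (u : Form n k) : proj T u ∈ Q1minus n k :=
  freeze_mem_Q1minus _ (interpForm_mem_Qform T u)

theorem coef_proj (T : Cell n) (u : Form n k) (σ : Fin k ↪o Fin n) (x : Vec n) :
    coef (proj T u) σ x = T.interp (coef u σ) ((Finset.univ.image σ).piecewise T.mid x) := by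
  rw [← coef_interpForm]
  exact coef_freeze _ _ _ _

theorem sum_mul_proj {T : Cell n} (hT : ∀ i, T.lo i < T.hi i) (u : Form n k)
    (σ : Fin k ↪o Fin n) {w : Vec n → ℝ}
    (hw : ∀ j, ∀ y ∈ T.vertices, w (T.flip (σ j) y) = w y) :
    ∑ y ∈ T.vertices, w y * coef (proj T u) σ y = ∑ y ∈ T.vertices, w y * coef u σ y := by
  simp only [coef_proj]
  rw [T.sum_mul_piecewise_mid (Finset.univ.image σ) (fun i hi y hy => by
    obtain ⟨j, -, rfl⟩ := Finset.mem_image.1 hi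
    exact hw j y hy) (T.interp_mem_Q1 _)]
  exact Finset.sum_congr rfl fun y hy => by rw [Cell.interp_apply hT _ hy]

theorem traceIntegral_proj {T : Cell n} (hT : ∀ i, T.lo i < T.hi i) {u : Form n k}
    (hu : u ∈ Kform n k) {f : Cell n} (hf : f.dim = k) (hfT : f.IsFace T) :
    f.traceIntegral hf (proj T u) 1 = f.traceIntegral hf u 1 := by
  obtain ⟨g, hg, hug⟩ := exists_trace_mem_Q1 hu f hf
  have hm := Cell.toSet_subset_hull f.mid_mem_toSet
  rw [traceIntegral_one_of_mem_Q1minus (proj_mem_Q1minus T u) hf hm, traceIntegral_one_eq hg hug,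
    coef_proj, f.image_tangent hf]
  have h1 : f.dirs.piecewise T.mid f.mid = f.mid := by
    funext i
    by_cases hi : i ∈ f.dirs
    · simp [hi, hfT.mid_eq hi]
    · simp [hi]
  rw [h1]
  congr 1
  have h2 := f.eq_zero_of_vertices (Submodule.sub_mem _ (T.interp_mem_Q1
    (coef u (f.tangent hf))) hg) (fun y hy => ?_) hm
  · exact sub_eq_zero.1 h2
  · simp only [Pi.sub_apply]
    rw [Cell.interp_apply hT _ (hfT.vertices_subset hy), hug y (Cell.vertices_subset_hull hy),
      sub_self]

/-- The local projection commutes with the exterior derivative, `d ∘ proj = d`. -/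
theorem extDeriv_proj {T : Cell n} (hT : ∀ i, T.lo i < T.hi i) {u : Form n k}
    (hu : u ∈ Kform n k) : extDeriv (proj T u) = extDeriv u := by
  have hP := Q1minus_le_Kform (proj_mem_Q1minus T u)
  have hv : proj T u - u ∈ Kform n k := Submodule.sub_mem _ hP hu
  have hd : extDeriv (proj T u) = extDeriv (proj T u - u) + extDeriv u := by
    rw [← extDeriv_add_of_contDiff (contDiff_of_mem_Kform hv) (contDiff_of_mem_Kform hu),
      sub_add_cancel]
  suffices extDeriv (proj T u - u) = 0 by rw [hd, this, zero_add]
  obtain ⟨c, hc, hF⟩ := exists_vertex_decomposition hv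
  obtain ⟨W, hW⟩ := hF T
  -- the interpolants of the coefficients of `proj u - u` vanish at the barycentres of the faces
  have hWf : ∀ (σ : Fin k ↪o Fin n) x, W σ ((Finset.univ.image σ).piecewise T.mid x) = 0 := by
    intro σ x
    have hQ := Q1minus_le_Qform (proj_mem_Q1minus T u) σ
    have h1 : W σ = coef (proj T u) σ - T.interp (coef u σ) := by
      refine sub_eq_zero.1 (Cell.eq_zero_of_vertices_of_lt hT (Submodule.sub_mem _ (hW σ).1
        (Submodule.sub_mem _ hQ (T.interp_mem_Q1 _))) fun y hy => ?_)
      simp only [Pi.sub_apply]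
      rw [← coef_vertex hW σ hy, Cell.interp_apply hT _ hy, coef_sub]
      simp
    rw [h1]
    simp [coef_proj]
  have hQ : extDeriv (proj T u - u) ∈ Qform n (k + 1) := Q1minus_le_Qform hv.2
  funext x
  refine alt_ext fun ω => ?_
  refine congrFun (Cell.eq_zero_of_vertices_of_lt hT (hQ ω) fun y hy => ?_) x
  refine coef_extDeriv_vertex_eq_zero hv hc hW ω (fun l y hy => ?_) hy
  set σ : Fin k ↪o Fin n := (Fin.succAboveOrderEmb l).trans ω with hσ
  have hσl : l.removeNth ω = σ := rfl
  set z := (Finset.univ.image ω).piecewise T.mid y with hz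
  have hl : ω l ∉ Finset.univ.image σ := by
    simp [hσ, Fin.succAbove_ne]
  have hzp : (Finset.univ.image σ).piecewise T.mid z = z := by
    funext i
    by_cases hi : i ∈ Finset.univ.image σ
    · have hi' : i ∈ Finset.univ.image ω := by
        obtain ⟨j, -, rfl⟩ := Finset.mem_image.1 hi
        exact Finset.mem_image_of_mem _ (Finset.mem_univ _)
      rw [Finset.piecewise_eq_of_mem _ _ _ hi, hz, Finset.piecewise_eq_of_mem _ _ _ hi']
    · rw [Finset.piecewise_eq_of_notMem _ _ _ hi]
  have hup : update z (ω l) (z (ω l) + 1) =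
      (Finset.univ.image σ).piecewise T.mid (update z (ω l) (z (ω l) + 1)) := by
    funext i
    by_cases hi : i ∈ Finset.univ.image σ
    · rw [Finset.piecewise_eq_of_mem _ _ _ hi, update_of_ne (by rintro rfl; exact hl hi),
        ← hzp, Finset.piecewise_eq_of_mem _ _ _ hi]
    · rw [Finset.piecewise_eq_of_notMem _ _ _ hi]
  rw [hσl]
  have h1 := apply_update_of_mem_Q1 (hW σ).1 z (ω l) (z (ω l) + 1)
  rw [hup, hWf, ← hzp, hWf, hzp] at h1
  linarith

end Local

/-! ### Meshes and integration over the elements -/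

section Mesh
variable {n k : ℕ} {Ω : Set (Vec n)} {𝒯 : Finset (Cell n)}

theorem Cell.interior_toSet (T : Cell n) :
    interior T.toSet = Set.pi univ fun i => Ioo (T.lo i) (T.hi i) := by
  rw [Cell.toSet, ← Set.pi_univ_Icc, interior_pi_set finite_univ]
  simp

theorem Cell.mem_interior {T : Cell n} {x : Vec n} :
    x ∈ interior T.toSet ↔ ∀ i, T.lo i < x i ∧ x i < T.hi i := by
  rw [Cell.interior_toSet]
  simp [Set.mem_pi]

theorem Cell.mem_toSet {T : Cell n} {x : Vec n} :
    x ∈ T.toSet ↔ ∀ i, T.lo i ≤ x i ∧ x i ≤ T.hi i :=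
  ⟨fun h i => ⟨h.1 i, h.2 i⟩, fun h => ⟨fun i => (h i).1, fun i => (h i).2⟩⟩

theorem Cell.interior_ae_eq (T : Cell n) : interior T.toSet =ᵐ[volume] T.toSet := by
  rw [Cell.interior_toSet]
  exact Measure.univ_pi_Ioo_ae_eq_Icc

/-- Two elements with a common interior point coincide. -/
theorem IsCubicalMesh.eq_of_mem_interior (hM : IsCubicalMesh Ω 𝒯) {T T' : Cell n} (hT : T ∈ 𝒯)
    (hT' : T' ∈ 𝒯) {x : Vec n} (hx : x ∈ interior T.toSet) (hx' : x ∈ interior T'.toSet) :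
    T = T' := by
  obtain ⟨f, hf, hf', hfe⟩ := hM.conforming T hT T' hT'
    ⟨x, _root_.interior_subset hx, _root_.interior_subset hx'⟩
  have hxf : x ∈ f.toSet := hfe ▸ ⟨_root_.interior_subset hx, _root_.interior_subset hx'⟩
  rw [Cell.mem_toSet] at hxf
  rw [Cell.mem_interior] at hx hx'
  have key : ∀ T : Cell n, f.IsFace T → (∀ i, T.lo i < x i ∧ x i < T.hi i) →
      f.lo = T.lo ∧ f.hi = T.hi := by
    intro T hf hx
    refine ⟨funext fun i => ?_, funext fun i => ?_⟩ <;>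
      rcases hf i with ⟨h1, h2⟩ | ⟨h1, h2⟩ | ⟨h1, h2⟩ <;>
        first
        | exact h1
        | exact h2
        | (have := hxf i; have := hx i; rw [h1, h2] at *; linarith)
  obtain ⟨h1, h2⟩ := key T hf hx
  obtain ⟨h3, h4⟩ := key T' hf' hx'
  exact Cell.ext (h1.symm.trans h3) (h2.symm.trans h4)

theorem IsCubicalMesh.pairwise_disjoint (hM : IsCubicalMesh Ω 𝒯) :
    Pairwise (Disjoint on fun T : 𝒯 => interior T.1.toSet) := by
  intro T T' hne
  refine Set.disjoint_left.2 fun x hx hx' => hne ?_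
  exact Subtype.ext (hM.eq_of_mem_interior T.2 T'.2 hx hx')

theorem IsCubicalMesh.ae_eq (hM : IsCubicalMesh Ω 𝒯) :
    (⋃ T : 𝒯, interior T.1.toSet : Set (Vec n)) =ᵐ[volume] Ω := by
  refine Filter.EventuallyLE.antisymm ?_ ?_
  · exact (LE.le.eventuallyLE (iUnion_subset fun T => hM.interior_subset T.1 T.2))
  · refine ae_le_set.2 (measure_mono_null (t := ⋃ T : 𝒯, T.1.toSet \ interior T.1.toSet) ?_ ?_)
    · rintro x ⟨hx, hx'⟩
      have h1 : x ∈ closure Ω := subset_closure hx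
      rw [hM.closure_eq] at h1
      obtain ⟨T, hT, hxT⟩ := mem_iUnion₂.1 h1
      refine mem_iUnion.2 ⟨⟨T, hT⟩, hxT, fun h => hx' (mem_iUnion.2 ⟨⟨T, hT⟩, h⟩)⟩
    · exact measure_iUnion_null fun T => (ae_le_set.1 T.1.interior_ae_eq.symm.le)

theorem IsCubicalMesh.glue_eq (hM : IsCubicalMesh Ω 𝒯) (u : Broken 𝒯 k) (T : 𝒯) {x : Vec n}
    (hx : x ∈ interior T.1.toSet) : glue u x = u T x := by
  unfold glue
  rw [Finset.sum_eq_single T]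
  · rw [indicator_of_mem hx]
  · intro T' _ hne
    refine indicator_of_notMem (fun hx' => hne ?_) _
    exact Subtype.ext (hM.eq_of_mem_interior T'.2 T.2 hx' hx)
  · exact fun h => absurd (Finset.mem_univ T) h

/-- Integration over `Ω` is summation of the integrals over the elements. -/
theorem IsCubicalMesh.setIntegral_eq (hM : IsCubicalMesh Ω 𝒯) {F : Vec n → ℝ}
    {G : 𝒯 → Vec n → ℝ} (hG : ∀ T, Continuous (G T))
    (hFG : ∀ T : 𝒯, ∀ x ∈ interior T.1.toSet, F x = G T x) :
    ∫ x in Ω, F x = ∑ T : 𝒯, ∫ x in T.1.toSet, G T x := by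
  rw [← setIntegral_congr_set hM.ae_eq, integral_iUnion_fintype (fun T => isOpen_interior.measurableSet)
    hM.pairwise_disjoint]
  · refine Finset.sum_congr rfl fun T _ => ?_
    rw [setIntegral_congr_fun isOpen_interior.measurableSet fun x hx => hFG T x hx,
      setIntegral_congr_set T.1.interior_ae_eq]
  · intro T
    have : IntegrableOn (G T) (interior T.1.toSet) :=
      ((hG T).continuousOn.integrableOn_compact T.1.isCompact_toSet).mono_set _root_.interior_subset
    exact this.congr_fun (fun x hx => (hFG T x hx).symm) isOpen_interior.measurableSet

theorem memL2_glue {u : Broken 𝒯 k} (hu : ∀ T, Continuous (u T)) :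
    MemL2 Ω (glue u) := by
  intro t
  have h : (fun x => glue u x t) =
      fun x => ∑ T : 𝒯, (interior T.1.toSet).indicator (fun x => u T x t) x := by
    funext x
    simp only [glue, ContinuousAlternatingMap.sum_apply]
    refine Finset.sum_congr rfl fun T _ => ?_
    by_cases hx : x ∈ interior T.1.toSet
    · simp [indicator_of_mem hx]
    · simp [indicator_of_notMem hx]
  rw [h]
  refine memLp_finsetSum _ fun T _ => ?_
  have hc : Continuous fun x => u T x t :=
    (ContinuousAlternatingMap.apply ℝ (Vec n) ℝ t).continuous.comp (hu T)
  obtain ⟨C, hC⟩ := T.1.isCompact_toSet.exists_bound_of_continuousOn hc.continuousOn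
  have hfin : IsFiniteMeasure (volume.restrict (interior T.1.toSet)) :=
    ⟨by
      rw [Measure.restrict_apply_univ]
      exact (measure_mono _root_.interior_subset).trans_lt T.1.isCompact_toSet.measure_lt_top⟩
  have h1 : MemLp ((interior T.1.toSet).indicator fun x => u T x t) 2 volume := by
    rw [memLp_indicator_iff_restrict isOpen_interior.measurableSet]
    refine MemLp.of_bound hc.aestronglyMeasurable C ?_
    exact (ae_restrict_mem isOpen_interior.measurableSet).mono fun x hx => hC x (_root_.interior_subset hx)
  exact h1.restrict Ω

theorem continuous_coef {u : Form n k} (hu : Continuous u) (a : Fin k → Fin n) :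
    Continuous (coef u a) :=
  (ContinuousAlternatingMap.apply ℝ (Vec n) ℝ (frame a)).continuous.comp hu

theorem altInner_eq (u v : Form n k) (x : Vec n) :
    altInner (u x) (v x) = ∑ σ : Fin k ↪o Fin n, coef u σ x * coef v σ x := rfl

theorem continuous_altInner {u v : Form n k} (hu : Continuous u) (hv : Continuous v) :
    Continuous fun x => altInner (u x) (v x) := by
  simp only [altInner_eq]
  exact continuous_finsetSum _ fun σ _ => (continuous_coef hu σ).mul (continuous_coef hv σ)

theorem altInner_self_nonneg (a : Alt n k) : 0 ≤ altInner a a :=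
  Finset.sum_nonneg fun _ _ => mul_self_nonneg _

theorem altInner_self_eq_zero {a : Alt n k} (h : altInner a a = 0) : a = 0 := by
  refine alt_ext fun σ => ?_
  have := (Finset.sum_eq_zero_iff_of_nonneg fun σ _ => mul_self_nonneg _).1 h σ
    (Finset.mem_univ σ)
  exact mul_self_eq_zero.1 this

theorem IsCubicalMesh.l2Inner_eq (hM : IsCubicalMesh Ω 𝒯) {u v : Broken 𝒯 k}
    (hu : ∀ T, Continuous (u T)) (hv : ∀ T, Continuous (v T)) :
    l2Inner Ω (glue u) (glue v) = ∑ T : 𝒯, l2Inner T.1.toSet (u T) (v T) :=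
  hM.setIntegral_eq (fun T => continuous_altInner (hu T) (hv T)) fun T x hx => by
    rw [hM.glue_eq u T hx, hM.glue_eq v T hx]

theorem quadForm_apply (u v : Broken 𝒯 k) :
    quadForm 𝒯 u v = ∑ T : 𝒯, quadLocal T.1 (u T) (v T) := rfl

theorem quadForm_comm (u v : Broken 𝒯 k) : quadForm 𝒯 u v = quadForm 𝒯 v u := by
  simp only [quadForm_apply, quadLocal, altInner_comm]

theorem quadLocal_self_nonneg (T : Cell n) (u : Form n k) : 0 ≤ quadLocal T u u :=
  mul_nonneg (mul_nonneg (by positivity) measureReal_nonneg)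
    (Finset.sum_nonneg fun _ _ => altInner_self_nonneg _)

theorem quadForm_self_nonneg (u : Broken 𝒯 k) : 0 ≤ quadForm 𝒯 u u :=
  Finset.sum_nonneg fun _ _ => quadLocal_self_nonneg _ _

theorem quadLocal_weight_pos {T : Cell n} (hT : ∀ i, T.lo i < T.hi i) :
    0 < ((2 : ℝ) ^ n)⁻¹ * volume.real T.toSet := by
  rw [Cell.volume_toSet hT]
  exact mul_pos (by positivity) T.size_pos

/-! ### Tangential continuity of the finite element spaces -/

theorem mem_Kform_of_mem_S1plusMesh {u : Broken 𝒯 k} (hu : u ∈ S1plusMesh 𝒯 k) (T : 𝒯) :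
    u T ∈ Kform n k := S1plus_le_Kform (hu.1 T)

/-- Membership in `𝒮₁⁺Λ^k(𝒯)` amounts to continuity of the tangential components at the
vertices of the faces. -/
theorem mem_S1plusMesh_iff {u : Broken 𝒯 k} :
    u ∈ S1plusMesh 𝒯 k ↔ (∀ T, u T ∈ S1plus n k) ∧
      ∀ (f : Cell n) (hf : f.dim = k) (T T' : 𝒯), f.IsFace T → f.IsFace T' →
        ∀ y ∈ f.vertices, coef (u T) (f.tangent hf) y = coef (u T') (f.tangent hf) y := by
  refine ⟨fun h => ⟨h.1, fun f hf T T' hT hT' => ?_⟩, fun h => ⟨h.1, fun f hf T T' hT hT' => ?_⟩⟩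
  · exact (traceIntegral_eq_iff (S1plus_le_Kform (h.1 T)) (S1plus_le_Kform (h.1 T')) f hf).1
      (h.2 f hf T T' hT hT')
  · exact (traceIntegral_eq_iff (S1plus_le_Kform (h.1 T)) (S1plus_le_Kform (h.1 T')) f hf).2
      (h.2 f hf T T' hT hT')

theorem Q1minusMesh_le_S1plusMesh : Q1minusMesh 𝒯 k ≤ S1plusMesh 𝒯 k := by
  intro u hu
  refine mem_S1plusMesh_iff.2 ⟨fun T => Q1minus_le_S1plus (hu.1 T),
    fun f hf T T' hT hT' y hy => ?_⟩
  have h := hu.2 f hf T T' hT hT'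
  have hy' := Cell.vertices_subset_hull hy
  rw [traceIntegral_one_of_mem_Q1minus (hu.1 T) hf hy',
    traceIntegral_one_of_mem_Q1minus (hu.1 T') hf hy'] at h
  exact mul_left_cancel₀ f.size_pos.ne' h

/-- Tangential continuity: if a cell `F` is a common face of two elements, the tangential components
of the two restrictions of `u` agree on `F`. -/
theorem coef_eq_on_face {u : Broken 𝒯 k} (hu : u ∈ S1plusMesh 𝒯 k) {F : Cell n} {T T' : 𝒯}
    (hF : F.IsFace T) (hF' : F.IsFace T') {a : Fin k → Fin n} (ha : ∀ j, a j ∈ F.dirs)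
    {x : Vec n} (hx : x ∈ F.hull) : coef (u T) a x = coef (u T') a x := by
  have h := coef_eq_zero_on_hull (Submodule.sub_mem _ (mem_Kform_of_mem_S1plusMesh hu T)
    (mem_Kform_of_mem_S1plusMesh hu T')) F (fun σ hσ y hy => ?_) ha hx
  · rw [coef_sub] at h
    exact sub_eq_zero.1 h
  · obtain ⟨f, hf, hfF, rfl, hyf⟩ := F.exists_face σ hσ hy
    rw [coef_sub]
    exact sub_eq_zero.2 ((mem_S1plusMesh_iff.1 hu).2 f hf T T' (hfF.trans hF) (hfF.trans hF') y hyf)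

/-- The derivative in a tangential direction depends only on the values on the affine hull. -/
theorem Cell.pd_eq_on_hull {F : Cell n} {g g' : Vec n → ℝ} (hg : Differentiable ℝ g)
    (hg' : Differentiable ℝ g') (h : ∀ x ∈ F.hull, g x = g' x) {i : Fin n} (hi : i ∈ F.dirs)
    {x : Vec n} (hx : x ∈ F.hull) : pd i g x = pd i g' x := by
  have h1 := hasDerivAt_comp_update hg x i (x i)
  have h2 := hasDerivAt_comp_update hg' x i (x i)
  rw [update_eq_self] at h1 h2
  refine h1.unique ?_
  simp only [h _ (Cell.update_mem_hull hx hi _)]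
  exact h2

theorem brokenD_mem_Q1minusMesh {u : Broken 𝒯 k} (hu : u ∈ S1plusMesh 𝒯 k) :
    brokenD u ∈ Q1minusMesh 𝒯 (k + 1) := by
  refine ⟨fun T => (mem_Kform_of_mem_S1plusMesh hu T).2, fun f hf T T' hT hT' => ?_⟩
  have hd := fun T => differentiable_of_mem_Kform (mem_Kform_of_mem_S1plusMesh hu T)
  refine setIntegral_congr_fun f.isCompact_toSet.measurableSet fun x hx => ?_
  have hx' := Cell.toSet_subset_hull hx
  congr 1
  change coef (extDeriv (u T)) (f.tangent hf) x = coef (extDeriv (u T')) (f.tangent hf) x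
  rw [coef_extDeriv (hd T), coef_extDeriv (hd T')]
  simp only [Finset.sum_apply, Pi.smul_apply]
  refine Finset.sum_congr rfl fun l _ => ?_
  congr 1
  refine Cell.pd_eq_on_hull (differentiable_coef (hd T) _) (differentiable_coef (hd T') _)
    (fun y hy => ?_) (f.tangent_mem_dirs hf l) hx'
  exact coef_eq_on_face hu hT hT' (fun j => f.tangent_mem_dirs hf _) hy

end Mesh

/-! ### Lines through the mesh -/

section WeakDerivative

/-- A form without components in directions avoiding `i` is annihilated by `dxᵢ ∧ ·`. -/
theorem flux_eq_zero {n k : ℕ} {A : Alt n k} {i : Fin n}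
    (h : ∀ a : Fin k → Fin n, (∀ j, a j ≠ i) → A (frame a) = 0) (t : Fin (k + 1) → Vec n) :
    ∑ j : Fin (k + 1), (-1 : ℝ) ^ (j : ℕ) * (t j i * A (j.removeNth t)) = 0 := by
  set B : Alt n (k + 1) := ContinuousAlternatingMap.alternatizeUncurryFin
    ((ContinuousLinearMap.proj (R := ℝ) (φ := fun _ : Fin n => ℝ) i).smulRight A) with hB
  have hBv : ∀ v : Fin (k + 1) → Vec n,
      B v = ∑ j : Fin (k + 1), (-1 : ℝ) ^ (j : ℕ) * (v j i * A (j.removeNth v)) := by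
    intro v
    rw [hB, ContinuousAlternatingMap.alternatizeUncurryFin_apply]
    refine Finset.sum_congr rfl fun j _ => ?_
    rw [zsmul_eq_mul]
    push_cast
    simp
  have h0 : B = 0 := by
    refine alt_ext_frame fun b => ?_
    by_cases hb : Injective b
    · rw [hBv, Finset.sum_eq_zero]
      · simp
      intro j _
      by_cases hj : b j = i
      · have h1 : A (j.removeNth (frame b)) = 0 :=
          h (j.removeNth b) fun l hl => Fin.succAbove_ne j l (hb (hl.trans hj.symm))
        rw [h1]; simp
      · have : frame b j i = 0 := Pi.single_eq_of_ne (Ne.symm hj) _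
        rw [this]; simp
    · rw [alt_frame_eq_zero hb]; rfl
  rw [← hBv, h0]
  rfl

variable {m k : ℕ} {Ω : Set (Vec (m + 1))} {𝒯 : Finset (Cell (m + 1))}

/-- Next to a point of `Ω`, in a given coordinate direction, there is an element of the mesh. -/
theorem IsCubicalMesh.exists_adjacent (hM : IsCubicalMesh Ω 𝒯) {p : Vec (m + 1)} (hp : p ∈ Ω)
    (i : Fin (m + 1)) (s : ℝ) :
    ∃ T ∈ 𝒯, p ∈ T.toSet ∧ ∃ δ > 0, update p i (p i + s * δ) ∈ T.toSet := by
  classical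
  -- Near `p`, the set `Ω` is covered by those elements that contain `p`.
  set N := Ω ∩ ⋂ T ∈ 𝒯.filter (fun T => p ∉ T.toSet), T.toSetᶜ with hN
  have hNo : IsOpen N := hM.isOpen.inter
    (isOpen_biInter_finset fun T _ => T.isCompact_toSet.isClosed.isOpen_compl)
  have hpN : p ∈ N := ⟨hp, by simp⟩
  have hc : Continuous fun δ : ℝ => update p i (p i + s * δ) := by
    refine continuous_const.update i ?_
    fun_prop
  have h0 : (fun δ : ℝ => update p i (p i + s * δ)) 0 ∈ N := by simpa using hpN
  have hev := hc.continuousAt.eventually (hNo.mem_nhds h0)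
  obtain ⟨ε, hε, hball⟩ := Metric.eventually_nhds_iff.1 hev
  have hq := @hball (ε / 2) (by simp [abs_of_pos hε]; linarith)
  set q := update p i (p i + s * (ε / 2))
  have h1 : q ∈ closure Ω := subset_closure hq.1
  rw [hM.closure_eq] at h1
  obtain ⟨T, hT, hqT⟩ := mem_iUnion₂.1 h1
  refine ⟨T, hT, ?_, ε / 2, by linarith, hqT⟩
  by_contra hpT
  exact (mem_iInter₂.1 hq.2 T (by simp [hT, hpT])) hqT

section Pairing

variable {i : Fin (m + 1)} {x : Vec m}

/-- The elements that are crossed by the line in direction `i` through `x`. -/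
def crossed (𝒯 : Finset (Cell (m + 1))) (i : Fin (m + 1)) (x : Vec m) : Finset (Cell (m + 1)) := by
  classical
  exact 𝒯.filter fun T => ∀ j, T.lo (i.succAbove j) < x j ∧ x j < T.hi (i.succAbove j)

theorem mem_crossed {T : Cell (m + 1)} : T ∈ crossed 𝒯 i x ↔
    T ∈ 𝒯 ∧ ∀ j, T.lo (i.succAbove j) < x j ∧ x j < T.hi (i.succAbove j) := by
  simp [crossed]

theorem insertNth_mem_interior {T : Cell (m + 1)} (hT : T ∈ crossed 𝒯 i x) {r : ℝ}
    (h1 : T.lo i < r) (h2 : r < T.hi i) :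
    (Fin.insertNth i r x : Vec (m + 1)) ∈ interior T.toSet := by
  rw [Cell.mem_interior]
  intro j
  refine Fin.succAboveCases i ?_ (fun j => ?_) j
  · simpa using ⟨h1, h2⟩
  · simpa using (mem_crossed.1 hT).2 j

theorem insertNth_mem_toSet {T : Cell (m + 1)} (hT : T ∈ crossed 𝒯 i x) {r : ℝ}
    (h1 : T.lo i ≤ r) (h2 : r ≤ T.hi i) : (Fin.insertNth i r x : Vec (m + 1)) ∈ T.toSet := by
  rw [Cell.mem_toSet]
  intro j
  refine Fin.succAboveCases i ?_ (fun j => ?_) j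
  · simpa using ⟨h1, h2⟩
  · have := (mem_crossed.1 hT).2 j
    simpa using ⟨this.1.le, this.2.le⟩

theorem crossed_of_mem_toSet {T : Cell (m + 1)} (hT : T ∈ 𝒯)
    (hx : ∀ j, x j ≠ T.lo (i.succAbove j) ∧ x j ≠ T.hi (i.succAbove j)) {r : ℝ}
    (h : (Fin.insertNth i r x : Vec (m + 1)) ∈ T.toSet) : T ∈ crossed 𝒯 i x := by
  refine mem_crossed.2 ⟨hT, fun j => ?_⟩
  have := Cell.mem_toSet.1 h (i.succAbove j)
  rw [Fin.insertNth_apply_succAbove] at this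
  exact ⟨lt_of_le_of_ne this.1 (hx j).1.symm, lt_of_le_of_ne this.2 (hx j).2⟩

theorem IsCubicalMesh.crossed_unique (hM : IsCubicalMesh Ω 𝒯) {T T' : Cell (m + 1)}
    (hT : T ∈ crossed 𝒯 i x) (hT' : T' ∈ crossed 𝒯 i x)
    (h : max (T.lo i) (T'.lo i) < min (T.hi i) (T'.hi i)) : T = T' := by
  obtain ⟨r, h1, h2⟩ := exists_between h
  rw [max_lt_iff] at h1
  rw [lt_min_iff] at h2
  exact hM.eq_of_mem_interior (mem_crossed.1 hT).1 (mem_crossed.1 hT').1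
    (insertNth_mem_interior hT h1.1 h2.1) (insertNth_mem_interior hT' h1.2 h2.2)

theorem IsCubicalMesh.exists_next
    (hx : ∀ T ∈ 𝒯, ∀ j, x j ≠ T.lo (i.succAbove j) ∧ x j ≠ T.hi (i.succAbove j))
    (hM : IsCubicalMesh Ω 𝒯) {T : Cell (m + 1)}
    (hT : T ∈ crossed 𝒯 i x) (hp : (Fin.insertNth i (T.hi i) x : Vec (m + 1)) ∈ Ω) :
    ∃ T' ∈ crossed 𝒯 i x, T'.lo i = T.hi i := by
  obtain ⟨T', hT', hpT', δ, hδ, hqT'⟩ := hM.exists_adjacent hp i 1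
  have hc := crossed_of_mem_toSet hT' (hx T' hT') hpT'
  refine ⟨T', hc, ?_⟩
  have h1 := (Cell.mem_toSet.1 hpT' i).1
  have h2 := (Cell.mem_toSet.1 hqT' i).2
  simp only [Fin.insertNth_apply_same, update_self, one_mul] at h1 h2
  by_contra hne
  have h3 := lt_of_le_of_ne h1 hne
  have h4 := hM.lt T (mem_crossed.1 hT).1 i
  have := hM.crossed_unique hT hc (by
    rw [max_lt_iff, lt_min_iff, lt_min_iff]
    exact ⟨⟨h4, by linarith⟩, h3, by linarith⟩)
  rw [this] at h2
  linarith

theorem IsCubicalMesh.exists_prev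
    (hx : ∀ T ∈ 𝒯, ∀ j, x j ≠ T.lo (i.succAbove j) ∧ x j ≠ T.hi (i.succAbove j))
    (hM : IsCubicalMesh Ω 𝒯) {T : Cell (m + 1)}
    (hT : T ∈ crossed 𝒯 i x) (hp : (Fin.insertNth i (T.lo i) x : Vec (m + 1)) ∈ Ω) :
    ∃ T' ∈ crossed 𝒯 i x, T'.hi i = T.lo i := by
  obtain ⟨T', hT', hpT', δ, hδ, hqT'⟩ := hM.exists_adjacent hp i (-1)
  have hc := crossed_of_mem_toSet hT' (hx T' hT') hpT'
  refine ⟨T', hc, ?_⟩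
  have h1 := (Cell.mem_toSet.1 hpT' i).2
  have h2 := (Cell.mem_toSet.1 hqT' i).1
  simp only [Fin.insertNth_apply_same, update_self] at h1 h2
  by_contra hne
  have h3 := lt_of_le_of_ne h1 (Ne.symm hne)
  have h4 := hM.lt T (mem_crossed.1 hT).1 i
  have := hM.crossed_unique hT hc (by
    rw [max_lt_iff, lt_min_iff, lt_min_iff]
    exact ⟨⟨h4, by linarith⟩, by linarith, by linarith⟩)
  rw [this] at h2
  linarith

/-- Along a line that avoids the lower-dimensional faces, the boundary values of a function with
continuous flux cancel. -/
theorem IsCubicalMesh.sum_crossed_eq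
    (hx : ∀ T ∈ 𝒯, ∀ j, x j ≠ T.lo (i.succAbove j) ∧ x j ≠ T.hi (i.succAbove j))
    (hM : IsCubicalMesh Ω 𝒯) {φ : Vec (m + 1) → ℝ}
    (hφ : ∀ p, φ p ≠ 0 → p ∈ Ω) {g : Cell (m + 1) → Vec (m + 1) → ℝ}
    (hg : ∀ T ∈ crossed 𝒯 i x, ∀ T' ∈ crossed 𝒯 i x, T.hi i = T'.lo i →
      g T (Fin.insertNth i (T.hi i) x) = g T' (Fin.insertNth i (T.hi i) x)) :
    ∑ T ∈ crossed 𝒯 i x, φ (Fin.insertNth i (T.hi i) x) * g T (Fin.insertNth i (T.hi i) x) =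
      ∑ T ∈ crossed 𝒯 i x, φ (Fin.insertNth i (T.lo i) x) * g T (Fin.insertNth i (T.lo i) x) := by
  have hnext : ∀ T (hT : T ∈ crossed 𝒯 i x),
      φ (Fin.insertNth i (T.hi i) x) * g T (Fin.insertNth i (T.hi i) x) ≠ 0 →
        ∃ T' ∈ crossed 𝒯 i x, T'.lo i = T.hi i := fun T hT h =>
    hM.exists_next hx hT (hφ _ (left_ne_zero_of_mul h))
  have hlt : ∀ T ∈ crossed 𝒯 i x, T.lo i < T.hi i := fun T hT =>
    hM.lt T (mem_crossed.1 hT).1 i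
  choose! N hN hN' using hnext
  refine Finset.sum_bij_ne_zero (fun T _ _ => N T) (fun T hT h => hN T hT h) ?_ ?_ ?_
  · intro T hT h T' hT' h' hTT'
    have h1 : T.hi i = T'.hi i := by
      rw [← hN' T hT h, ← hN' T' hT' h', hTT']
    refine hM.crossed_unique hT hT' ?_
    rw [← h1, min_self, max_lt_iff]
    exact ⟨hlt T hT, h1 ▸ hlt T' hT'⟩
  · intro T hT h
    obtain ⟨T', hT', h1⟩ := hM.exists_prev hx hT (hφ _ (left_ne_zero_of_mul h))
    have h2 : φ (Fin.insertNth i (T'.hi i) x) * g T' (Fin.insertNth i (T'.hi i) x) ≠ 0 := by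
      rw [hg T' hT' T hT h1, h1]
      exact h
    refine ⟨T', hT', h2, ?_⟩
    have h3 := (hN' T' hT' h2).trans h1
    refine hM.crossed_unique (hN T' hT' h2) hT ?_
    rw [h3, max_self, lt_min_iff]
    exact ⟨h3 ▸ hlt _ (hN T' hT' h2), hlt T hT⟩
  · intro T hT h
    rw [hN' T hT h, hg T hT _ (hN T hT h) (hN' T hT h).symm]

end Pairing

end WeakDerivative

/-! ### The weak exterior derivative -/

section WeakDerivative

/-- The `i`-th component of the vector field `x ↦ ∑_j (-1)^j u_x(t_0, …, t̂_j, …, t_k) t_j`, whose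
divergence is `du(t_0, …, t_k)`. -/
def flux {n k : ℕ} (u : Form n k) (t : Fin (k + 1) → Vec n) (i : Fin n) : Vec n → ℝ :=
  fun x => ∑ j : Fin (k + 1), (-1 : ℝ) ^ (j : ℕ) * (t j i * u x (j.removeNth t))

theorem contDiff_flux {n k : ℕ} {u : Form n k} (hu : ContDiff ℝ (⊤ : ℕ∞) u)
    (t : Fin (k + 1) → Vec n) (i : Fin n) : ContDiff ℝ (⊤ : ℕ∞) (flux u t i) := by
  refine ContDiff.sum fun j _ => contDiff_const.mul (contDiff_const.mul ?_)
  exact (ContinuousAlternatingMap.apply ℝ (Vec n) ℝ (j.removeNth t)).contDiff.comp hu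

theorem sum_mul_pd {n : ℕ} (g : Vec n → ℝ) (x v : Vec n) :
    ∑ i, v i * pd i g x = fderiv ℝ g x v := by
  have h := LinearMap.pi_apply_eq_sum_univ (fderiv ℝ g x : Vec n →ₗ[ℝ] ℝ) v
  simp only [ContinuousLinearMap.coe_coe, smul_eq_mul] at h
  rw [h]
  refine Finset.sum_congr rfl fun i _ => ?_
  change v i * fderiv ℝ g x (Pi.single i 1) = _
  congr 2
  funext j
  simp [Pi.single_apply, eq_comm]

/-- The product rule for the divergence of `φ` times the flux of `u`. -/
theorem sum_pd_mul_flux {n k : ℕ} {u : Form n k} (hu : ContDiff ℝ (⊤ : ℕ∞) u) {φ : Vec n → ℝ}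
    (hφ : ContDiff ℝ (⊤ : ℕ∞) φ) (t : Fin (k + 1) → Vec n) (x : Vec n) :
    ∑ i, pd i (φ * flux u t i) x = φ x * extDeriv u x t +
      ∑ j : Fin (k + 1), (-1 : ℝ) ^ (j : ℕ) * (fderiv ℝ φ x (t j) * u x (j.removeNth t)) := by
  have hφd : Differentiable ℝ φ := hφ.differentiable (by simp)
  have hud : Differentiable ℝ u := hu.differentiable (by simp)
  have hw : ∀ w : Fin k → Vec n, Differentiable ℝ fun x => u x w := fun w =>
    (ContinuousAlternatingMap.apply ℝ (Vec n) ℝ w).differentiable.comp hud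
  have hpd : ∀ i, pd i (flux u t i) x =
      ∑ j : Fin (k + 1), (-1 : ℝ) ^ (j : ℕ) * (t j i * pd i (fun x => u x (j.removeNth t)) x) := by
    intro i
    have h1 : flux u t i = ∑ j : Fin (k + 1),
        ((-1 : ℝ) ^ (j : ℕ) * t j i) • fun x => u x (j.removeNth t) := by
      funext x
      simp [flux, mul_assoc]
    rw [h1, pd_sum _ _ fun j _ => (hw _).const_smul _]
    simp only [Finset.sum_apply, pd_smul _ _ (hw _), Pi.smul_apply, smul_eq_mul, mul_assoc]
  have hext : extDeriv u x t = ∑ j : Fin (k + 1), (-1 : ℝ) ^ (j : ℕ) *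
      fderiv ℝ (fun x => u x (j.removeNth t)) x (t j) := by
    rw [extDeriv_apply (hud x)]
    refine Finset.sum_congr rfl fun j _ => ?_
    have h2 : HasFDerivAt (fun x => u x (j.removeNth t))
        ((ContinuousAlternatingMap.apply ℝ (Vec n) ℝ (j.removeNth t)).comp (fderiv ℝ u x)) x :=
      (ContinuousAlternatingMap.apply ℝ (Vec n) ℝ (j.removeNth t)).hasFDerivAt.comp x
        (hud x).hasFDerivAt
    rw [h2.fderiv, zsmul_eq_mul]
    push_cast
    rfl
  have hfd : ∀ i, Differentiable ℝ (flux u t i) := fun i =>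
    (contDiff_flux hu t i).differentiable (by simp)
  simp only [pd_mul _ hφd (hfd _), Pi.add_apply, Pi.mul_apply, Finset.sum_add_distrib, hpd, hext,
    Finset.mul_sum, ← sum_mul_pd, flux, Finset.sum_mul]
  rw [add_comm]
  congr 1
  · rw [Finset.sum_comm]
  · rw [Finset.sum_comm]
    refine Finset.sum_congr rfl fun j _ => Finset.sum_congr rfl fun i _ => ?_
    ring

variable {m k : ℕ} {Ω : Set (Vec (m + 1))} {𝒯 : Finset (Cell (m + 1))}

/-- The facet of a box orthogonal to the direction `i`, in the remaining coordinates. -/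
def Cell.facet (T : Cell (m + 1)) (i : Fin (m + 1)) : Set (Vec m) :=
  Icc (T.lo ∘ i.succAbove) (T.hi ∘ i.succAbove)

theorem Cell.integral_divergence (T : Cell (m + 1)) {F : Fin (m + 1) → Vec (m + 1) → ℝ}
    (hF : ∀ i, ContDiff ℝ (⊤ : ℕ∞) (F i)) :
    ∫ x in T.toSet, ∑ i, pd i (F i) x =
      ∑ i, ((∫ x in T.facet i, F i (Fin.insertNth i (T.hi i) x)) -
        ∫ x in T.facet i, F i (Fin.insertNth i (T.lo i) x)) := by
  refine integral_divergence_of_hasFDerivAt_off_countable' T.lo T.hi T.le F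
    (fun i x => fderiv ℝ (F i) x) ∅ countable_empty (fun i => (hF i).continuous.continuousOn)
    (fun x _ i => ((hF i).differentiable (by simp) x).hasFDerivAt) ?_
  have h : Continuous fun x => ∑ i, fderiv ℝ (F i) x (Pi.single i 1) :=
    continuous_finsetSum _ fun i _ =>
      ((hF i).continuous_fderiv (by simp)).clm_apply continuous_const
  exact h.continuousOn.integrableOn_compact isCompact_Icc

/-- Almost every line in a coordinate direction avoids the lower-dimensional faces. -/
theorem ae_ne_endpoints (𝒯 : Finset (Cell (m + 1))) (i : Fin (m + 1)) :
    ∀ᵐ x : Vec m, ∀ T ∈ 𝒯, ∀ j, x j ≠ T.lo (i.succAbove j) ∧ x j ≠ T.hi (i.succAbove j) := by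
  have h : ∀ (j : Fin m) (c : ℝ), ∀ᵐ x : Vec m, x j ≠ c := fun j c =>
    Measure.ae_eval_ne (μ := fun _ => (volume : Measure ℝ)) j c
  rw [Filter.eventually_all_finset]
  intro T _
  rw [Filter.eventually_all]
  exact fun j => (h j _).and (h j _)

/-- If the fluxes of a piecewise smooth field are continuous across the interelement faces, the
elementwise integrals of its divergence add up to zero once the field is cut off inside `Ω`. -/
theorem IsCubicalMesh.sum_integral_divergence (hM : IsCubicalMesh Ω 𝒯)
    {φ : Vec (m + 1) → ℝ} (hφ : ContDiff ℝ (⊤ : ℕ∞) φ) (hφΩ : ∀ p, φ p ≠ 0 → p ∈ Ω)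
    {G : Cell (m + 1) → Fin (m + 1) → Vec (m + 1) → ℝ}
    (hG : ∀ T i, ContDiff ℝ (⊤ : ℕ∞) (G T i))
    (hGc : ∀ i x, ∀ T ∈ crossed 𝒯 i x, ∀ T' ∈ crossed 𝒯 i x, T.hi i = T'.lo i →
      G T i (Fin.insertNth i (T.hi i) x) = G T' i (Fin.insertNth i (T.hi i) x)) :
    ∑ T ∈ 𝒯, ∫ x in T.toSet, ∑ i, pd i (φ * G T i) x = 0 := by
  have hdiv := fun T : Cell (m + 1) =>
    T.integral_divergence (F := fun i => φ * G T i) fun i => hφ.mul (hG T i)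
  simp only [hdiv]
  rw [Finset.sum_comm]
  refine Finset.sum_eq_zero fun i _ => ?_
  have hcont : ∀ (T : Cell (m + 1)) (r : ℝ), Continuous fun x : Vec m =>
      (φ * G T i) (Fin.insertNth i r x) := fun T r =>
    (hφ.mul (hG T i)).continuous.comp (Continuous.finInsertNth i continuous_const continuous_id)
  have hint : ∀ (T : Cell (m + 1)) (r : ℝ), IntegrableOn (fun x : Vec m =>
      (φ * G T i) (Fin.insertNth i r x)) (T.facet i) := fun T r =>
    (hcont T r).continuousOn.integrableOn_compact isCompact_Icc
  have hmeas : ∀ T : Cell (m + 1), MeasurableSet (T.facet i) := fun T => measurableSet_Icc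
  have h1 : ∀ T : Cell (m + 1), (∫ x in T.facet i, (φ * G T i) (Fin.insertNth i (T.hi i) x)) -
      ∫ x in T.facet i, (φ * G T i) (Fin.insertNth i (T.lo i) x) =
      ∫ x, (T.facet i).indicator (fun x => (φ * G T i) (Fin.insertNth i (T.hi i) x) -
        (φ * G T i) (Fin.insertNth i (T.lo i) x)) x := fun T => by
    rw [← integral_sub (hint T _) (hint T _), integral_indicator (hmeas T)]
  simp only [h1]
  have h4 : ∀ T ∈ 𝒯, Integrable ((T.facet i).indicator fun x =>
      (φ * G T i) (Fin.insertNth i (T.hi i) x) - (φ * G T i) (Fin.insertNth i (T.lo i) x)) :=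
    fun T _ => ((hint T _).sub (hint T _)).integrable_indicator (hmeas T)
  rw [← integral_finsetSum _ h4]
  refine integral_eq_zero_of_ae ?_
  filter_upwards [ae_ne_endpoints 𝒯 i] with x hx
  -- The indicators of the facets select the elements crossed by the line through `x`.
  have h2 : ∀ T ∈ 𝒯, x ∈ T.facet i ↔ T ∈ crossed 𝒯 i x := fun T hT => by
    rw [mem_crossed]
    refine ⟨fun h => ⟨hT, fun j => ⟨lt_of_le_of_ne (h.1 j) (hx T hT j).1.symm,
      lt_of_le_of_ne (h.2 j) (hx T hT j).2⟩⟩, fun h => ⟨fun j => (h.2 j).1.le, fun j => (h.2 j).2.le⟩⟩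
  have h3 : crossed 𝒯 i x ⊆ 𝒯 := fun T hT => (mem_crossed.1 hT).1
  rw [← Finset.sum_subset h3 fun T hT hT' => indicator_of_notMem (fun h => hT' ((h2 T hT).1 h)) _]
  rw [Finset.sum_congr rfl fun T hT => indicator_of_mem ((h2 T (h3 hT)).2 hT) _,
    Finset.sum_sub_distrib]
  exact sub_eq_zero.2 (IsCubicalMesh.sum_crossed_eq hx hM hφΩ (g := fun T => G T i)
    fun T hT T' hT' h => hGc i x T hT T' hT' h)

/-- The elementwise exterior derivative of a tangentially continuous form is its weak exterior
derivative. -/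
theorem IsCubicalMesh.isWeakExtDeriv (hM : IsCubicalMesh Ω 𝒯) {u : Broken 𝒯 k}
    (hu : u ∈ S1plusMesh 𝒯 k) : IsWeakExtDeriv Ω (glue u) (glue (brokenD u)) := by
  classical
  intro φ hφ _ hφs t
  have hφΩ : ∀ p, φ p ≠ 0 → p ∈ Ω := fun p hp => hφs (subset_tsupport φ hp)
  have hus : ∀ T, ContDiff ℝ (⊤ : ℕ∞) (u T) := fun T => contDiff_of_mem_S1plus (hu.1 T)
  have hev : ∀ {l : ℕ} {v : Form (m + 1) l} (w : Fin l → Vec (m + 1)), Continuous v →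
      Continuous fun x => v x w := fun {l v} w hv =>
    (ContinuousAlternatingMap.apply ℝ (Vec (m + 1)) ℝ w).continuous.comp hv
  have hfd : ∀ v : Vec (m + 1), Continuous fun x => fderiv ℝ φ x v := fun v =>
    (hφ.continuous_fderiv (by simp)).clm_apply continuous_const
  have hc1 : ∀ T : 𝒯, Continuous fun x => φ x * extDeriv (u T) x t := fun T =>
    hφ.continuous.mul (hev t (contDiff_extDeriv (hus T)).continuous)
  have hc2 : ∀ (j : Fin (k + 1)) (T : 𝒯), Continuous fun x =>
      fderiv ℝ φ x (t j) * u T x (j.removeNth t) := fun j T =>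
    (hfd _).mul (hev _ (hus T).continuous)
  rw [hM.setIntegral_eq (G := fun T x => φ x * extDeriv (u T) x t) hc1 fun T x hx => by
    rw [hM.glue_eq (brokenD u) T hx]; rfl]
  have h2 : ∀ j : Fin (k + 1), ∫ x in Ω, fderiv ℝ φ x (t j) * glue u x (j.removeNth t) =
      ∑ T : 𝒯, ∫ x in T.1.toSet, fderiv ℝ φ x (t j) * u T x (j.removeNth t) := fun j =>
    hM.setIntegral_eq (hc2 j) fun T x hx => by rw [hM.glue_eq u T hx]
  simp only [h2]
  set G : Cell (m + 1) → Fin (m + 1) → Vec (m + 1) → ℝ := fun T i =>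
    if h : T ∈ 𝒯 then flux (u ⟨T, h⟩) t i else 0 with hGdef
  have hG : ∀ (T : 𝒯) i, G T.1 i = flux (u T) t i := fun T i => by simp [hGdef, T.2]
  have key := hM.sum_integral_divergence hφ hφΩ (G := G) (fun T i => ?_) ?_
  · rw [← Finset.sum_coe_sort 𝒯] at key
    simp only [hG, sum_pd_mul_flux (hus _) hφ] at key
    rw [eq_neg_iff_add_eq_zero, ← key]
    simp only [Finset.mul_sum]
    rw [Finset.sum_comm, ← Finset.sum_add_distrib]
    refine Finset.sum_congr rfl fun T _ => ?_
    have hK := T.1.isCompact_toSet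
    rw [integral_add ((hc1 T).continuousOn.integrableOn_compact hK), integral_finsetSum]
    · simp only [integral_const_mul]
    · exact fun j _ => ((continuous_const.mul (hc2 j T)).continuousOn.integrableOn_compact hK)
    · exact (continuous_finsetSum _ fun j _ =>
        continuous_const.mul (hc2 j T)).continuousOn.integrableOn_compact hK
  · simp only [hGdef]
    split_ifs with h
    · exact contDiff_flux (hus _) t i
    · exact contDiff_const
  · intro i x T hT T' hT' hTT'
    have hT0 := (mem_crossed.1 hT).1
    have hT0' := (mem_crossed.1 hT').1
    have e := hG ⟨T, hT0⟩ i
    have e' := hG ⟨T', hT0'⟩ i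
    simp only at e e'
    rw [e, e']
    set p : Vec (m + 1) := Fin.insertNth i (T.hi i) x with hp
    have hpT : p ∈ T.toSet := insertNth_mem_toSet hT (hM.lt T hT0 i).le le_rfl
    have hpT' : p ∈ T'.toSet := insertNth_mem_toSet hT' hTT'.ge (hTT' ▸ (hM.lt T' hT0' i).le)
    obtain ⟨f, hf, hf', hfs⟩ := hM.conforming T hT0 T' hT0' ⟨p, hpT, hpT'⟩
    have hpf : p ∈ f.toSet := hfs ▸ ⟨hpT, hpT'⟩
    -- The other coordinates of `p` are strictly inside, so the common face contains a facet.
    have hdir : ∀ j, j ≠ i → j ∈ f.dirs := by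
      intro j hj
      obtain ⟨l, rfl⟩ := Fin.exists_succAbove_eq hj
      have hl := (mem_crossed.1 hT).2 l
      have hpl := Cell.mem_toSet.1 hpf (i.succAbove l)
      rw [hp, Fin.insertNth_apply_succAbove] at hpl
      rw [Cell.mem_dirs]
      rcases hf (i.succAbove l) with ⟨h1, h2⟩ | ⟨h1, h2⟩ | ⟨h1, h2⟩
      · rw [h1, h2]; exact hl.1.trans hl.2
      · rw [h2] at hpl; linarith [hl.1]
      · rw [h1] at hpl; linarith [hl.2]
    have h0 := flux_eq_zero (A := u ⟨T, hT0⟩ p - u ⟨T', hT0'⟩ p) (i := i) (fun a ha => by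
      have := coef_eq_on_face hu (T := ⟨T, hT0⟩) (T' := ⟨T', hT0'⟩) hf hf'
        (fun j => hdir _ (ha j)) (Cell.toSet_subset_hull hpf)
      exact sub_eq_zero.2 this) t
    rw [← sub_eq_zero, ← h0]
    simp only [flux, ← Finset.sum_sub_distrib]
    refine Finset.sum_congr rfl fun j _ => ?_
    change _ = (-1 : ℝ) ^ (j : ℕ) * (t j i * (u ⟨T, hT0⟩ p (j.removeNth t) - u ⟨T', hT0'⟩ p (j.removeNth t)))
    ring

end WeakDerivative

theorem IsCubicalMesh.memHLambda {n k : ℕ} (hn : 0 < n) {Ω : Set (Vec n)} {𝒯 : Finset (Cell n)}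
    (hM : IsCubicalMesh Ω 𝒯) {u : Broken 𝒯 k} (hu : u ∈ S1plusMesh 𝒯 k) :
    MemHLambda Ω (glue u) (glue (brokenD u)) := by
  obtain ⟨m, rfl⟩ := Nat.exists_eq_add_of_lt hn
  have hc := fun T => contDiff_of_mem_S1plus (hu.1 T)
  rw [zero_add] at *
  exact ⟨memL2_glue fun T => (hc T).continuous,
    memL2_glue fun T => (contDiff_extDeriv (hc T)).continuous, hM.isWeakExtDeriv hu⟩

/-! ### Pullback to the unit cube -/

section NormEquivalence

theorem exists_bilinForm_self_le_inner {V : Type*} [NormedAddCommGroup V] [InnerProductSpace ℝ V]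
    [FiniteDimensional ℝ V] (B : LinearMap.BilinForm ℝ V) :
    ∃ C, 1 ≤ C ∧ ∀ u, B u u ≤ C * inner ℝ u u := by
  set L : V →L[ℝ] V →L[ℝ] ℝ := LinearMap.toContinuousLinearMap
    ((LinearMap.toContinuousLinearMap : (V →ₗ[ℝ] ℝ) ≃ₗ[ℝ] (V →L[ℝ] ℝ)).toLinearMap ∘ₗ B) with hL
  refine ⟨max 1 ‖L‖, le_max_left _ _, fun u => ?_⟩
  have h1 : ‖u‖ * ‖u‖ = inner ℝ u u := (real_inner_self_eq_norm_mul_norm u).symm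
  have h2 : B u u = L u u := rfl
  calc B u u ≤ ‖L u u‖ := h2 ▸ le_abs_self _
    _ ≤ ‖L‖ * ‖u‖ * ‖u‖ := L.le_opNorm₂ u u
    _ = ‖L‖ * inner ℝ u u := by rw [mul_assoc, h1]
    _ ≤ _ := mul_le_mul_of_nonneg_right (le_max_right _ _) real_inner_self_nonneg

/-- On a finite-dimensional space every quadratic form is bounded by any positive definite one. -/
theorem exists_bilinForm_self_le {V : Type*} [AddCommGroup V] [Module ℝ V] [FiniteDimensional ℝ V]
    (B₁ B₂ : LinearMap.BilinForm ℝ V) (hs : ∀ u v, B₂ u v = B₂ v u) (hn : ∀ u, 0 ≤ B₂ u u)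
    (hd : ∀ u, B₂ u u = 0 → u = 0) : ∃ C, 1 ≤ C ∧ ∀ u, B₁ u u ≤ C * B₂ u u := by
  let core : InnerProductSpace.Core ℝ V :=
    { inner := fun u v => B₂ u v
      conj_inner_symm := fun u v => by simpa using hs v u
      re_inner_nonneg := fun u => by simpa using hn u
      add_left := fun u v w => by simp
      smul_left := fun u v r => by simp
      definite := fun u h => hd u h }
  exact @exists_bilinForm_self_le_inner V core.toNormedAddCommGroup (.ofCore core.toCore) ‹_› B₁

variable {n k : ℕ}

namespace Cell

/-- The unit cube. -/
def unit (n : ℕ) : Cell n := ⟨0, 1, zero_le_one⟩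

theorem unit_lt (i : Fin n) : (unit n).lo i < (unit n).hi i := zero_lt_one

/-- The affine map from the unit cube onto a box. -/
def chart (T : Cell n) (x : Vec n) : Vec n := fun i => T.lo i + (T.hi i - T.lo i) * x i

/-- The linear part of `Cell.chart`. -/
def scaling (T : Cell n) : Vec n →L[ℝ] Vec n :=
  ContinuousLinearMap.pi fun i => (T.hi i - T.lo i) • ContinuousLinearMap.proj (φ := fun _ => ℝ) i

theorem hasFDerivAt_chart (T : Cell n) (x : Vec n) : HasFDerivAt T.chart T.scaling x := by
  have h : T.chart = fun x => T.lo + T.scaling x := by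
    funext x i
    simp [chart, scaling]
  rw [h]
  exact T.scaling.hasFDerivAt.const_add _

theorem chart_injective {T : Cell n} (hT : ∀ i, T.lo i < T.hi i) : Injective T.chart := by
  intro x y h
  funext i
  have h1 := congrFun h i
  simp only [chart, add_right_inj] at h1
  exact mul_left_cancel₀ (sub_pos.2 (hT i)).ne' h1

theorem chart_surjective {T : Cell n} (hT : ∀ i, T.lo i < T.hi i) : Surjective T.chart := by
  intro y
  refine ⟨fun i => (y i - T.lo i) / (T.hi i - T.lo i), funext fun i => ?_⟩
  have := (sub_pos.2 (hT i)).ne'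
  simp only [chart]
  field_simp
  ring

theorem chart_mem_toSet_iff {T : Cell n} (hT : ∀ i, T.lo i < T.hi i) {x : Vec n} :
    T.chart x ∈ T.toSet ↔ x ∈ (unit n).toSet := by
  rw [mem_toSet, mem_toSet]
  refine forall_congr' fun i => ?_
  have h := sub_pos.2 (hT i)
  simp only [chart, unit, Pi.zero_apply, Pi.one_apply]
  constructor
  · rintro ⟨h1, h2⟩
    constructor <;> by_contra! h3 <;> nlinarith
  · rintro ⟨h1, h2⟩
    constructor <;> nlinarith

theorem image_chart {T : Cell n} (hT : ∀ i, T.lo i < T.hi i) :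
    T.chart '' (unit n).toSet = T.toSet := by
  ext y
  obtain ⟨x, rfl⟩ := chart_surjective hT y
  rw [(chart_injective hT).mem_set_image, chart_mem_toSet_iff hT]

theorem chart_mem_vertices_iff {T : Cell n} (hT : ∀ i, T.lo i < T.hi i) {x : Vec n} :
    T.chart x ∈ T.vertices ↔ x ∈ (unit n).vertices := by
  rw [mem_vertices, mem_vertices]
  refine forall_congr' fun i => ?_
  have h := sub_pos.2 (hT i)
  simp only [chart, unit, Pi.zero_apply, Pi.one_apply]
  refine or_congr ⟨fun h1 => ?_, fun h1 => by simp [h1]⟩ ⟨fun h1 => ?_, fun h1 => by simp [h1]⟩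
  · have : (T.hi i - T.lo i) * x i = 0 := by linarith
    exact (mul_eq_zero.1 this).resolve_left h.ne'
  · exact mul_left_cancel₀ h.ne' (by linarith)

theorem sum_vertices_chart {T : Cell n} (hT : ∀ i, T.lo i < T.hi i) (g : Vec n → ℝ) :
    ∑ y ∈ T.vertices, g y = ∑ x ∈ (unit n).vertices, g (T.chart x) := by
  refine (Finset.sum_bij (fun x _ => T.chart x) (fun x hx => (chart_mem_vertices_iff hT).2 hx)
    (fun x _ y _ h => chart_injective hT h) (fun y hy => ?_) fun x _ => rfl).symm
  obtain ⟨x, rfl⟩ := chart_surjective hT y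
  exact ⟨x, (chart_mem_vertices_iff hT).1 hy, rfl⟩

theorem integral_chart {T : Cell n} (hT : ∀ i, T.lo i < T.hi i) (g : Vec n → ℝ) :
    ∫ y in T.toSet, g y = |T.scaling.det| * ∫ x in (unit n).toSet, g (T.chart x) := by
  rw [← image_chart hT, integral_image_eq_integral_abs_det_fderiv_smul volume
    (unit n).isCompact_toSet.measurableSet
    (fun x _ => (T.hasFDerivAt_chart x).hasFDerivWithinAt) (chart_injective hT).injOn]
  simp only [smul_eq_mul, integral_const_mul]

theorem volume_chart {T : Cell n} (hT : ∀ i, T.lo i < T.hi i) :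
    volume.real T.toSet = |T.scaling.det| * volume.real (unit n).toSet := by
  have h := integral_chart hT fun _ => 1
  simpa using h

end Cell

/-- The pullback of a form on a box to the unit cube. -/
def pull (T : Cell n) : Form n k →ₗ[ℝ] Form n k where
  toFun u := fun x => (u (T.chart x)).compContinuousLinearMap T.scaling
  map_add' _ _ := rfl
  map_smul' _ _ := rfl

theorem coef_pull (T : Cell n) (u : Form n k) (a : Fin k → Fin n) (x : Vec n) :
    coef (pull T u) a x = (∏ j, (T.hi (a j) - T.lo (a j))) * coef u a (T.chart x) := by
  have h : (fun j => T.scaling (frame a j)) =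
      fun j => (T.hi (a j) - T.lo (a j)) • frame a j := by
    funext j i
    by_cases hi : i = a j
    · subst hi; simp [Cell.scaling, frame]
    · simp [Cell.scaling, frame, Pi.single_eq_of_ne hi]
  change u (T.chart x) (fun j => T.scaling (frame a j)) = _
  rw [h]
  exact (u (T.chart x)).toMultilinearMap.map_smul_univ _ _

theorem comp_chart_mem_Q1 (T : Cell n) {g : Vec n → ℝ} (hg : g ∈ Q1 n) :
    (fun x => g (T.chart x)) ∈ Q1 n :=
  comp_affine_mem_Q1 hg T.lo fun i => T.hi i - T.lo i

theorem pd_comp_chart (T : Cell n) {g : Vec n → ℝ} (hg : Differentiable ℝ g) (i : Fin n) :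
    pd i (fun x => g (T.chart x)) = fun x => (T.hi i - T.lo i) * pd i g (T.chart x) := by
  funext x
  have h := (hg (T.chart x)).hasFDerivAt.comp x (T.hasFDerivAt_chart x)
  have h1 : T.scaling (Pi.single i 1) = (T.hi i - T.lo i) • Pi.single i 1 := by
    funext l
    by_cases hl : l = i
    · subst hl; simp [Cell.scaling]
    · simp [Cell.scaling, Pi.single_eq_of_ne hl]
  change fderiv ℝ (g ∘ T.chart) x (Pi.single i 1) = _
  rw [h.fderiv, ContinuousLinearMap.comp_apply, h1, map_smul]
  rfl

theorem pull_mem_Qform (T : Cell n) {u : Form n k} (hu : u ∈ Qform n k) :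
    pull T u ∈ Qform n k := by
  intro a
  have : coef (pull T u) a =
      (∏ j, (T.hi (a j) - T.lo (a j))) • fun x => coef u a (T.chart x) :=
    funext fun x => coef_pull T u a x
  rw [this]
  exact Submodule.smul_mem _ _ (comp_chart_mem_Q1 T (hu a))

theorem pull_mem_Q1minus (T : Cell n) {u : Form n k} (hu : u ∈ Q1minus n k) :
    pull T u ∈ Q1minus n k := by
  rw [mem_Q1minus_iff] at hu ⊢
  refine ⟨pull_mem_Qform T hu.1, fun a l x t => ?_⟩
  rw [coef_pull, coef_pull]
  have : T.chart (update x (a l) t) =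
      update (T.chart x) (a l) (T.lo (a l) + (T.hi (a l) - T.lo (a l)) * t) := by
    funext i
    by_cases hi : i = a l
    · subst hi; simp [Cell.chart]
    · simp [Cell.chart, update_of_ne hi]
  rw [this, hu.2 a l]

theorem extDeriv_pull (T : Cell n) {u : Form n k} (hu : Differentiable ℝ u)
    (hu' : Differentiable ℝ (pull T u)) : extDeriv (pull T u) = pull T (extDeriv u) := by
  refine form_ext fun σ => ?_
  funext x
  rw [coef_pull, coef_extDeriv hu', coef_extDeriv hu]
  simp only [Finset.sum_apply, Pi.smul_apply, smul_eq_mul, Finset.mul_sum]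
  refine Finset.sum_congr rfl fun l _ => ?_
  have h1 : coef (pull T u) (l.removeNth σ) =
      (∏ j, (T.hi (l.removeNth σ j) - T.lo (l.removeNth σ j))) •
        fun x => coef u (l.removeNth σ) (T.chart x) := funext fun x => coef_pull T u _ x
  have hd := differentiable_coef hu (l.removeNth σ)
  have hd' : Differentiable ℝ fun x => coef u (l.removeNth σ) (T.chart x) := fun x =>
    ((hd _).hasFDerivAt.comp x (T.hasFDerivAt_chart x)).differentiableAt
  rw [h1, pd_smul _ _ hd', pd_comp_chart T hd, Fin.prod_univ_succAbove _ l]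
  simp only [Pi.smul_apply, smul_eq_mul, Fin.removeNth]
  ring

theorem pull_mem_Kform (T : Cell n) {u : Form n k} (hu : u ∈ Kform n k) :
    pull T u ∈ Kform n k := by
  have hmem : ∃ w ∈ Qform n k, ∃ c ∈ Qform n (k + 1), pull T u = w - koszul c := by
    obtain ⟨⟨w, hw, c, hc, rfl⟩, -⟩ := hu
    -- The translation part of the chart adds a contraction with a constant vector.
    refine ⟨pull T w - (pull T (koszul c) - koszul (pull T c)), Submodule.sub_mem _
      (pull_mem_Qform T hw) fun a => ?_, pull T c, pull_mem_Qform T hc, ?_⟩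
    · have : coef (pull T (koszul c) - koszul (pull T c)) a =
          ∑ j, ((∏ l, (T.hi (a l) - T.lo (a l))) * T.lo j) •
            fun x => coef c (Fin.cons j a) (T.chart x) := by
        funext x
        rw [coef_sub, Pi.sub_apply, coef_pull, coef_koszul, coef_koszul, Finset.mul_sum,
          ← Finset.sum_sub_distrib, Finset.sum_apply]
        refine Finset.sum_congr rfl fun j _ => ?_
        rw [coef_pull, Fin.prod_univ_succ]
        simp only [Fin.cons_zero, Fin.cons_succ, Pi.smul_apply, smul_eq_mul, Cell.chart]
        ring
      rw [this]
      exact Submodule.sum_mem _ fun j _ => Submodule.smul_mem _ _ (comp_chart_mem_Q1 T (hc _))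
    · rw [map_sub]; abel
  refine ⟨hmem, ?_⟩
  have hd : Differentiable ℝ (pull T u) := by
    obtain ⟨w, hw, c, hc, h⟩ := hmem
    rw [h]
    exact (contDiff_sub_koszul hw hc).differentiable (by simp)
  rw [extDeriv_pull T (differentiable_of_mem_Kform hu) hd]
  exact pull_mem_Q1minus T hu.2

instance : FiniteDimensional ℝ (Kform n k) := by
  let L : Kform n k →ₗ[ℝ] Qform n k :=
    ((interpForm (Cell.unit n)).comp (Kform n k).subtype).codRestrict _ fun u =>
      interpForm_mem_Qform _ _
  have hQ : IsNoetherian ℝ (Qform n k) := isNoetherian_of_isNoetherianRing_of_finite ℝ (Qform n k)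
  refine Module.Finite.of_injective L fun u v huv => ?_
  have h : interpForm (Cell.unit n) u.1 = interpForm (Cell.unit n) v.1 := congrArg Subtype.val huv
  refine Subtype.ext (sub_eq_zero.1 (eq_zero_of_vertices (Submodule.sub_mem _ u.2 v.2)
    Cell.unit_lt fun y hy => ?_))
  rw [Pi.sub_apply, ← interpForm_vertex Cell.unit_lt u.1 hy, h,
    interpForm_vertex Cell.unit_lt v.1 hy, sub_self]

end NormEquivalence

/-! ### Equivalence of the norms -/

section NormEquivalence
variable {n k : ℕ}

theorem l2Inner_comm (Ω : Set (Vec n)) (u v : Form n k) : l2Inner Ω u v = l2Inner Ω v u := by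
  simp only [l2Inner, altInner_comm]

theorem l2Inner_smul_left (Ω : Set (Vec n)) (c : ℝ) (u v : Form n k) :
    l2Inner Ω (c • u) v = c * l2Inner Ω u v := by
  simp only [l2Inner, Pi.smul_apply, altInner_smul_left, integral_const_mul]

theorem l2Inner_self_nonneg (Ω : Set (Vec n)) (u : Form n k) : 0 ≤ l2Inner Ω u u :=
  integral_nonneg fun _ => altInner_self_nonneg _

theorem integrableOn_altInner (T : Cell n) {u v : Form n k} (hu : Continuous u)
    (hv : Continuous v) : IntegrableOn (fun x => altInner (u x) (v x)) T.toSet :=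
  (continuous_altInner hu hv).continuousOn.integrableOn_compact T.isCompact_toSet

theorem l2Inner_add_left (T : Cell n) {u v w : Form n k} (hu : Continuous u) (hv : Continuous v)
    (hw : Continuous w) :
    l2Inner T.toSet (u + v) w = l2Inner T.toSet u w + l2Inner T.toSet v w := by
  unfold l2Inner
  rw [← integral_add (integrableOn_altInner T hu hw) (integrableOn_altInner T hv hw)]
  simp only [Pi.add_apply, altInner_add_left]

theorem l2Inner_eq_sum (T : Cell n) {u : Form n k} (hu : Continuous u) :
    l2Inner T.toSet u u = ∑ σ : Fin k ↪o Fin n, ∫ x in T.toSet, coef u σ x ^ 2 := by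
  simp only [l2Inner, altInner_eq, ← pow_two]
  exact integral_finsetSum _ fun σ _ =>
    ((continuous_coef hu σ).pow 2).continuousOn.integrableOn_compact T.isCompact_toSet

theorem quadLocal_self_eq_sum (T : Cell n) (u : Form n k) :
    quadLocal T u u = ((2 : ℝ) ^ n)⁻¹ * volume.real T.toSet *
      ∑ σ : Fin k ↪o Fin n, ∑ y ∈ T.vertices, coef u σ y ^ 2 := by
  simp only [quadLocal, altInner_eq, ← pow_two]
  rw [Finset.sum_comm]

theorem quadLocal_comm (T : Cell n) (u v : Form n k) : quadLocal T u v = quadLocal T v u := by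
  simp only [quadLocal, altInner_comm]

theorem quadLocal_add_left (T : Cell n) (u v w : Form n k) :
    quadLocal T (u + v) w = quadLocal T u w + quadLocal T v w := by
  simp only [quadLocal, Pi.add_apply, altInner_add_left, Finset.sum_add_distrib, mul_add]

theorem quadLocal_smul_left (T : Cell n) (c : ℝ) (u v : Form n k) :
    quadLocal T (c • u) v = c * quadLocal T u v := by
  simp only [quadLocal, Pi.smul_apply, altInner_smul_left, ← Finset.mul_sum]
  ring

theorem eq_zero_of_quadLocal_self {T : Cell n} (hT : ∀ i, T.lo i < T.hi i) {u : Form n k}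
    (h : quadLocal T u u = 0) {y : Vec n} (hy : y ∈ T.vertices) : u y = 0 := by
  have h1 := (mul_eq_zero.1 h).resolve_left (quadLocal_weight_pos hT).ne'
  exact altInner_self_eq_zero
    ((Finset.sum_eq_zero_iff_of_nonneg fun y _ => altInner_self_nonneg (u y)).1 h1 y hy)

theorem eq_zero_of_l2Inner_self {T : Cell n} (hT : ∀ i, T.lo i < T.hi i) {u : Form n k}
    (hu : Continuous u) (h : l2Inner T.toSet u u = 0) {y : Vec n} (hy : y ∈ T.toSet) :
    u y = 0 := by
  have hc := continuous_altInner hu hu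
  have h1 := (setIntegral_eq_zero_iff_of_nonneg_ae (Filter.Eventually.of_forall fun x =>
    altInner_self_nonneg (u x)) (integrableOn_altInner T hu hu)).1 h
  refine altInner_self_eq_zero (Measure.eqOn_of_ae_eq h1 hc.continuousOn continuousOn_const ?_ hy)
  rw [Cell.interior_toSet, closure_pi_set]
  intro x hx i _
  change x i ∈ closure (Ioo (T.lo i) (T.hi i))
  rw [closure_Ioo (hT i).ne]
  exact Cell.mem_toSet.1 hx i

/-- The mass form `⟨u, v⟩` of a box. -/
def massForm (T : Cell n) : LinearMap.BilinForm ℝ (Kform n k) :=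
  have hc := fun u : Kform n k => (contDiff_of_mem_Kform u.2).continuous
  LinearMap.mk₂ ℝ (fun u v => l2Inner T.toSet u.1 v.1)
    (fun u u' v => l2Inner_add_left T (hc u) (hc u') (hc v))
    (fun c u v => l2Inner_smul_left T.toSet c u.1 v.1)
    (fun u v v' => by
      simp only [l2Inner_comm T.toSet u.1]
      exact l2Inner_add_left T (hc v) (hc v') (hc u))
    (fun c u v => by
      simp only [l2Inner_comm T.toSet u.1]
      exact l2Inner_smul_left T.toSet c v.1 u.1)

/-- The lumped mass form `⟨u, v⟩_{h,T}` of a box. -/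
def lumpedForm (T : Cell n) : LinearMap.BilinForm ℝ (Kform n k) :=
  LinearMap.mk₂ ℝ (fun u v => quadLocal T u.1 v.1)
    (fun u u' v => quadLocal_add_left T u.1 u'.1 v.1)
    (fun c u v => quadLocal_smul_left T c u.1 v.1)
    (fun u v v' => by
      simp only [quadLocal_comm T u.1]
      exact quadLocal_add_left T v.1 v'.1 u.1)
    (fun c u v => by
      simp only [quadLocal_comm T u.1]
      exact quadLocal_smul_left T c v.1 u.1)

variable (n k) in
/-- Both forms are definite on the finite-dimensional space `Kform`, by unisolvence. -/
theorem exists_unit_norm_equivalence : ∃ C, 1 ≤ C ∧ ∀ u ∈ Kform n k,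
    l2Inner (Cell.unit n).toSet u u ≤ C * quadLocal (Cell.unit n) u u ∧
      quadLocal (Cell.unit n) u u ≤ C * l2Inner (Cell.unit n).toSet u u := by
  have hz : ∀ u : Kform n k, (∀ y ∈ (Cell.unit n).vertices, u.1 y = 0) → u = 0 := fun u h =>
    Subtype.ext (eq_zero_of_vertices u.2 Cell.unit_lt h)
  obtain ⟨C₁, h₁, H₁⟩ := exists_bilinForm_self_le (V := Kform n k) (massForm (Cell.unit n))
    (lumpedForm (Cell.unit n)) (fun u v => quadLocal_comm _ u.1 v.1)
    (fun u => quadLocal_self_nonneg _ u.1)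
    (fun u h => hz u fun y hy => eq_zero_of_quadLocal_self Cell.unit_lt h hy)
  obtain ⟨C₂, h₂, H₂⟩ := exists_bilinForm_self_le (V := Kform n k) (lumpedForm (Cell.unit n))
    (massForm (Cell.unit n)) (fun u v => l2Inner_comm _ u.1 v.1)
    (fun u => l2Inner_self_nonneg _ u.1)
    (fun u h => hz u fun y hy => eq_zero_of_l2Inner_self Cell.unit_lt
      (contDiff_of_mem_Kform u.2).continuous h (Cell.vertices_subset_toSet hy))
  refine ⟨max C₁ C₂, h₁.trans (le_max_left _ _), fun u hu => ⟨?_, ?_⟩⟩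
  · exact (H₁ ⟨u, hu⟩).trans
      (mul_le_mul_of_nonneg_right (le_max_left _ _) (quadLocal_self_nonneg _ u))
  · exact (H₂ ⟨u, hu⟩).trans
      (mul_le_mul_of_nonneg_right (le_max_right _ _) (l2Inner_self_nonneg _ u))

/-- The powers of the edge lengths produced by the pullback are comparable, by shape regularity. -/
theorem scaling_bounds {T : Cell n} (hT : ∀ i, T.lo i < T.hi i) {ρ : ℝ}
    (hρ : ∀ i j, T.hi i - T.lo i ≤ ρ * (T.hi j - T.lo j)) (i₀ : Fin n)
    {e : (Fin k ↪o Fin n) → ℝ} (he : ∀ σ, 0 ≤ e σ) :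
    ∑ σ : Fin k ↪o Fin n, (∏ j, (T.hi (σ j) - T.lo (σ j))) ^ 2 * e σ ≤
        (ρ ^ k) ^ 2 * ((T.hi i₀ - T.lo i₀) ^ k) ^ 2 * ∑ σ, e σ ∧
      ((T.hi i₀ - T.lo i₀) ^ k) ^ 2 * ∑ σ, e σ ≤
        (ρ ^ k) ^ 2 *
          ∑ σ : Fin k ↪o Fin n, (∏ j, (T.hi (σ j) - T.lo (σ j))) ^ 2 * e σ := by
  have hpos : ∀ i, 0 < T.hi i - T.lo i := fun i => sub_pos.2 (hT i)
  simp only [Finset.mul_sum]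
  constructor <;> refine Finset.sum_le_sum fun σ _ => ?_
  · refine mul_le_mul_of_nonneg_right ?_ (he σ)
    rw [← mul_pow, ← mul_pow]
    refine pow_le_pow_left₀ (Finset.prod_nonneg fun j _ => (hpos _).le) ?_ 2
    calc ∏ j, (T.hi (σ j) - T.lo (σ j)) ≤ ∏ _j : Fin k, ρ * (T.hi i₀ - T.lo i₀) :=
          Finset.prod_le_prod (fun j _ => (hpos _).le) fun j _ => hρ _ _
      _ = _ := by simp
  · rw [← mul_assoc]
    refine mul_le_mul_of_nonneg_right ?_ (he σ)
    rw [← mul_pow]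
    refine pow_le_pow_left₀ (pow_nonneg (hpos _).le _) ?_ 2
    calc (T.hi i₀ - T.lo i₀) ^ k = ∏ _j : Fin k, (T.hi i₀ - T.lo i₀) := by simp
      _ ≤ ∏ j, ρ * (T.hi (σ j) - T.lo (σ j)) :=
          Finset.prod_le_prod (fun j _ => (hpos _).le) fun j _ => hρ _ _
      _ = _ := by rw [Finset.prod_mul_distrib]; simp

theorem l2Inner_scaling {T : Cell n} (hT : ∀ i, T.lo i < T.hi i) {ρ : ℝ}
    (hρ : ∀ i j, T.hi i - T.lo i ≤ ρ * (T.hi j - T.lo j)) (i₀ : Fin n) {u : Form n k}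
    (hu : u ∈ Kform n k) :
    |T.scaling.det| * l2Inner (Cell.unit n).toSet (pull T u) (pull T u) ≤
        (ρ ^ k) ^ 2 * ((T.hi i₀ - T.lo i₀) ^ k) ^ 2 * l2Inner T.toSet u u ∧
      ((T.hi i₀ - T.lo i₀) ^ k) ^ 2 * l2Inner T.toSet u u ≤
        (ρ ^ k) ^ 2 * (|T.scaling.det| *
          l2Inner (Cell.unit n).toSet (pull T u) (pull T u)) := by
  have h := scaling_bounds hT hρ i₀ (k := k)
    (e := fun σ => |T.scaling.det| * ∫ x in (Cell.unit n).toSet, coef u σ (T.chart x) ^ 2)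
    fun σ => mul_nonneg (abs_nonneg _) (integral_nonneg fun x => sq_nonneg _)
  have h1 : l2Inner T.toSet u u = ∑ σ : Fin k ↪o Fin n, |T.scaling.det| *
      ∫ x in (Cell.unit n).toSet, coef u σ (T.chart x) ^ 2 := by
    rw [l2Inner_eq_sum T (contDiff_of_mem_Kform hu).continuous]
    exact Finset.sum_congr rfl fun σ _ => Cell.integral_chart hT _
  have h2 : |T.scaling.det| * l2Inner (Cell.unit n).toSet (pull T u) (pull T u) =
      ∑ σ : Fin k ↪o Fin n, (∏ j, (T.hi (σ j) - T.lo (σ j))) ^ 2 * (|T.scaling.det| *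
        ∫ x in (Cell.unit n).toSet, coef u σ (T.chart x) ^ 2) := by
    rw [l2Inner_eq_sum _ (contDiff_of_mem_Kform (pull_mem_Kform T hu)).continuous, Finset.mul_sum]
    refine Finset.sum_congr rfl fun σ _ => ?_
    simp only [coef_pull, mul_pow, integral_const_mul]
    ring
  rw [h1, h2]
  exact h

theorem quadLocal_scaling {T : Cell n} (hT : ∀ i, T.lo i < T.hi i) {ρ : ℝ}
    (hρ : ∀ i j, T.hi i - T.lo i ≤ ρ * (T.hi j - T.lo j)) (i₀ : Fin n) (u : Form n k) :
    |T.scaling.det| * quadLocal (Cell.unit n) (pull T u) (pull T u) ≤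
        (ρ ^ k) ^ 2 * ((T.hi i₀ - T.lo i₀) ^ k) ^ 2 * quadLocal T u u ∧
      ((T.hi i₀ - T.lo i₀) ^ k) ^ 2 * quadLocal T u u ≤
        (ρ ^ k) ^ 2 * (|T.scaling.det| *
          quadLocal (Cell.unit n) (pull T u) (pull T u)) := by
  set w : ℝ := |T.scaling.det| * (((2 : ℝ) ^ n)⁻¹ * volume.real (Cell.unit n).toSet) with hw
  have h := scaling_bounds hT hρ i₀ (k := k)
    (e := fun σ => w * ∑ x ∈ (Cell.unit n).vertices, coef u σ (T.chart x) ^ 2)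
    fun σ => mul_nonneg (by positivity) (Finset.sum_nonneg fun x _ => sq_nonneg _)
  have h1 : quadLocal T u u = ∑ σ : Fin k ↪o Fin n, w *
      ∑ x ∈ (Cell.unit n).vertices, coef u σ (T.chart x) ^ 2 := by
    rw [quadLocal_self_eq_sum, Cell.volume_chart hT, ← Finset.mul_sum, hw]
    simp only [Cell.sum_vertices_chart hT]
    ring
  have h2 : |T.scaling.det| * quadLocal (Cell.unit n) (pull T u) (pull T u) =
      ∑ σ : Fin k ↪o Fin n, (∏ j, (T.hi (σ j) - T.lo (σ j))) ^ 2 * (w *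
        ∑ x ∈ (Cell.unit n).vertices, coef u σ (T.chart x) ^ 2) := by
    rw [quadLocal_self_eq_sum, Finset.mul_sum, Finset.mul_sum]
    refine Finset.sum_congr rfl fun σ _ => ?_
    simp only [coef_pull, mul_pow, ← Finset.mul_sum]
    rw [hw]
    ring
  rw [h1, h2]
  exact h

theorem le_of_scaling {S R C d a a' b b' : ℝ} (hS : 0 < S) (hR : 0 ≤ R) (hC : 0 ≤ C) (hd : 0 ≤ d)
    (h1 : S * a ≤ R * (d * a')) (h2 : a' ≤ C * b') (h3 : d * b' ≤ R * S * b) :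
    a ≤ R ^ 2 * C * b := by
  refine le_of_mul_le_mul_left ?_ hS
  calc S * a ≤ R * (d * a') := h1
    _ ≤ R * (d * (C * b')) := by gcongr
    _ = R * C * (d * b') := by ring
    _ ≤ R * C * (R * S * b) := by gcongr
    _ = _ := by ring

/-- Equivalence of the norm and the lumped norm on a box, with constants depending only on the
shape regularity. -/
theorem exists_local_norm_equivalence (hn : 0 < n) (k : ℕ) (ρ : ℝ) :
    ∃ K, 1 ≤ K ∧ ∀ T : Cell n, (∀ i, T.lo i < T.hi i) →
      (∀ i j, T.hi i - T.lo i ≤ ρ * (T.hi j - T.lo j)) → ∀ u ∈ Kform n k,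
        l2Inner T.toSet u u ≤ K * quadLocal T u u ∧
          quadLocal T u u ≤ K * l2Inner T.toSet u u := by
  obtain ⟨C, hC, H⟩ := exists_unit_norm_equivalence n k
  set R := (ρ ^ k) ^ 2 with hR
  have hR0 : 0 ≤ R := sq_nonneg _
  have hC0 : 0 ≤ C := by linarith
  refine ⟨max 1 (R ^ 2 * C), le_max_left _ _, fun T hT hρ u hu => ?_⟩
  set i₀ : Fin n := ⟨0, hn⟩
  have hS : 0 < ((T.hi i₀ - T.lo i₀) ^ k) ^ 2 := by
    have := sub_pos.2 (hT i₀)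
    positivity
  have hd : 0 ≤ |T.scaling.det| := abs_nonneg _
  obtain ⟨l1, l2⟩ := l2Inner_scaling hT hρ i₀ hu
  obtain ⟨q1, q2⟩ := quadLocal_scaling hT hρ i₀ u
  obtain ⟨c1, c2⟩ := H _ (pull_mem_Kform T hu)
  constructor
  · exact (le_of_scaling hS hR0 hC0 hd l2 c1 q1).trans
      (mul_le_mul_of_nonneg_right (le_max_right _ _) (quadLocal_self_nonneg _ _))
  · exact (le_of_scaling hS hR0 hC0 hd q2 c2 l1).trans
      (mul_le_mul_of_nonneg_right (le_max_right _ _) (l2Inner_self_nonneg _ _))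

variable {Ω : Set (Vec n)} {𝒯 : Finset (Cell n)}

theorem norm_equivalence (hM : IsCubicalMesh Ω 𝒯) {ρ K : ℝ} (hρ : ShapeRegular ρ 𝒯)
    (hK : ∀ T : Cell n, (∀ i, T.lo i < T.hi i) →
      (∀ i j, T.hi i - T.lo i ≤ ρ * (T.hi j - T.lo j)) → ∀ u ∈ Kform n k,
        l2Inner T.toSet u u ≤ K * quadLocal T u u ∧
          quadLocal T u u ≤ K * l2Inner T.toSet u u)
    {u : Broken 𝒯 k} (hu : ∀ T, u T ∈ Kform n k) :
    l2Inner Ω (glue u) (glue u) ≤ K * quadForm 𝒯 u u ∧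
      quadForm 𝒯 u u ≤ K * l2Inner Ω (glue u) (glue u) := by
  have hc := fun T => (contDiff_of_mem_Kform (hu T)).continuous
  rw [hM.l2Inner_eq hc hc, quadForm_apply, Finset.mul_sum, Finset.mul_sum]
  exact ⟨Finset.sum_le_sum fun T _ => (hK T.1 (hM.lt T.1 T.2) (hρ T.1 T.2) _ (hu T)).1,
    Finset.sum_le_sum fun T _ => (hK T.1 (hM.lt T.1 T.2) (hρ T.1 T.2) _ (hu T)).2⟩

end NormEquivalence

/-! ### The projection and the discrete coderivative -/

section Projection
variable {n k : ℕ} {Ω : Set (Vec n)} {𝒯 : Finset (Cell n)}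

/-- Unisolvence of the degrees of freedom of `𝒬₁⁻Λ^k`. -/
theorem eq_of_traceIntegral_eq {T : Cell n} (hT : ∀ i, T.lo i < T.hi i) {u v : Form n k}
    (hu : u ∈ Q1minus n k) (hv : v ∈ Q1minus n k)
    (h : ∀ (f : Cell n) (hf : f.dim = k), f.IsFace T →
      f.traceIntegral hf u 1 = f.traceIntegral hf v 1) : u = v := by
  refine sub_eq_zero.1 (eq_zero_of_vertices
    (Q1minus_le_Kform (Submodule.sub_mem _ hu hv)) hT fun y hy => alt_ext fun σ => ?_)
  obtain ⟨f, hf, hfT, rfl, hyf⟩ := T.exists_face σ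
    (fun j => Cell.mem_dirs_of_lt hT _) hy
  have h1 := h f hf hfT
  have hy' := Cell.vertices_subset_hull hyf
  rw [traceIntegral_one_of_mem_Q1minus hu hf hy', traceIntegral_one_of_mem_Q1minus hv hf hy'] at h1
  exact sub_eq_zero.2 (mul_left_cancel₀ f.size_pos.ne' h1)

/-- The local projection averages vertex values, which does not change the means. -/
theorem quadLocal_proj_const {T : Cell n} (hT : ∀ i, T.lo i < T.hi i) (u : Form n k)
    (a : Alt n k) : quadLocal T (proj T u) (fun _ => a) = quadLocal T u fun _ => a := by
  have h : ∀ v : Form n k, ∑ y ∈ T.vertices, altInner (v y) a =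
      ∑ σ : Fin k ↪o Fin n, ∑ y ∈ T.vertices, a (basisVec σ) * coef v σ y := fun v => by
    rw [Finset.sum_comm]
    exact Finset.sum_congr rfl fun y _ => Finset.sum_congr rfl fun σ _ => mul_comm _ _
  simp only [quadLocal, h]
  congr 1
  exact Finset.sum_congr rfl fun σ _ => sum_mul_proj hT u σ fun _ _ _ => rfl

/-- The local projection averages vertex values, so it is a contraction in the lumped norm. -/
theorem quadLocal_proj_le {T : Cell n} (hT : ∀ i, T.lo i < T.hi i) (u : Form n k) :
    quadLocal T (proj T u) (proj T u) ≤ quadLocal T u u := by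
  rw [quadLocal_self_eq_sum, quadLocal_self_eq_sum]
  refine mul_le_mul_of_nonneg_left (Finset.sum_le_sum fun σ _ => ?_) (quadLocal_weight_pos hT).le
  have h1 := sum_mul_proj hT u σ (w := coef (proj T u) σ) fun j y _ => by
    rw [coef_proj, coef_proj]
    refine congrArg (T.interp (coef u σ)) (funext fun i => ?_)
    by_cases hi : i ∈ Finset.univ.image σ
    · rw [Finset.piecewise_eq_of_mem _ _ _ hi, Finset.piecewise_eq_of_mem _ _ _ hi]
    · rw [Finset.piecewise_eq_of_notMem _ _ _ hi, Finset.piecewise_eq_of_notMem _ _ _ hi,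
        Cell.flip, update_of_ne]
      rintro rfl
      exact hi (Finset.mem_image_of_mem _ (Finset.mem_univ _))
  have h2 : 0 ≤ ∑ y ∈ T.vertices, (coef (proj T u) σ y - coef u σ y) ^ 2 :=
    Finset.sum_nonneg fun y _ => sq_nonneg _
  have h3 : ∑ y ∈ T.vertices, (coef (proj T u) σ y - coef u σ y) ^ 2 =
      ∑ y ∈ T.vertices, coef (proj T u) σ y * coef (proj T u) σ y -
        2 * ∑ y ∈ T.vertices, coef (proj T u) σ y * coef u σ y +
          ∑ y ∈ T.vertices, coef u σ y ^ 2 := by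
    rw [Finset.mul_sum, ← Finset.sum_sub_distrib, ← Finset.sum_add_distrib]
    exact Finset.sum_congr rfl fun y _ => by ring
  -- `∑ P² = ∑ P u` and `∑ (P - u)² ≥ 0` give `∑ P² ≤ ∑ u²`.
  simp only [pow_two (coef (proj T u) σ _)]
  linarith

/-- The projection `Π_h`, which acts element by element. -/
def meshProj (hM : IsCubicalMesh Ω 𝒯) : S1plusMesh 𝒯 k →ₗ[ℝ] Q1minusMesh 𝒯 k where
  toFun u := ⟨fun T => proj T.1 (u.1 T), fun T => proj_mem_Q1minus _ _, fun f hf T T' hT hT' => by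
    rw [traceIntegral_proj (hM.lt T.1 T.2) (mem_Kform_of_mem_S1plusMesh u.2 T) hf hT,
      traceIntegral_proj (hM.lt T'.1 T'.2) (mem_Kform_of_mem_S1plusMesh u.2 T') hf hT']
    exact u.2.2 f hf T T' hT hT' 1 (const_mem_Q1 1)⟩
  map_add' u v := Subtype.ext (funext fun T => map_add (proj T.1) (u.1 T) (v.1 T))
  map_smul' c u := Subtype.ext (funext fun T => map_smul (proj T.1) c (u.1 T))

theorem preservesDOF_meshProj (hM : IsCubicalMesh Ω 𝒯) :
    PreservesDOF (meshProj (k := k) hM) := fun u _ hf T hT =>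
  traceIntegral_proj (hM.lt T.1 T.2) (mem_Kform_of_mem_S1plusMesh u.2 T) hf hT

theorem PreservesDOF.eq_meshProj (hM : IsCubicalMesh Ω 𝒯)
    {P : S1plusMesh 𝒯 k →ₗ[ℝ] Q1minusMesh 𝒯 k} (hP : PreservesDOF P) : P = meshProj hM := by
  refine LinearMap.ext fun u => Subtype.ext (funext fun T => ?_)
  refine eq_of_traceIntegral_eq (hM.lt T.1 T.2) ((P u).2.1 T) ((meshProj hM u).2.1 T)
    fun f hf hT => ?_
  rw [hP u f hf T hT, preservesDOF_meshProj hM u f hf T hT]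

theorem existsUnique_preservesDOF (hM : IsCubicalMesh Ω 𝒯) :
    ∃! P : S1plusMesh 𝒯 k →ₗ[ℝ] Q1minusMesh 𝒯 k, PreservesDOF P :=
  ⟨meshProj hM, preservesDOF_meshProj hM, fun _ hP => hP.eq_meshProj hM⟩

theorem brokenD_meshProj (hM : IsCubicalMesh Ω 𝒯) (u : S1plusMesh 𝒯 k) :
    brokenD (meshProj hM u).1 = brokenD u.1 :=
  funext fun T => extDeriv_proj (hM.lt T.1 T.2) (mem_Kform_of_mem_S1plusMesh u.2 T)

theorem quadForm_meshProj_le (hM : IsCubicalMesh Ω 𝒯) (u : S1plusMesh 𝒯 k) :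
    quadForm 𝒯 (meshProj hM u).1 (meshProj hM u).1 ≤ quadForm 𝒯 u.1 u.1 :=
  Finset.sum_le_sum fun T _ => quadLocal_proj_le (hM.lt T.1 T.2) (u.1 T)

theorem quadForm_meshProj_const (hM : IsCubicalMesh Ω 𝒯) (u : S1plusMesh 𝒯 k) {w : Broken 𝒯 k}
    (hw : w ∈ piecewiseConst 𝒯 k) : quadForm 𝒯 (meshProj hM u).1 w = quadForm 𝒯 u.1 w :=
  Finset.sum_congr rfl fun T _ => by
    obtain ⟨a, ha⟩ := hw T
    rw [ha]
    exact quadLocal_proj_const (hM.lt T.1 T.2) (u.1 T) a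

theorem continuous_of_mem_piecewiseConst {w : Broken 𝒯 k} (hw : w ∈ piecewiseConst 𝒯 k) (T : 𝒯) :
    Continuous (w T) := by
  obtain ⟨a, ha⟩ := hw T
  rw [ha]
  exact continuous_const

/-- The quadrature rule is exact for `𝒬₁` functions. -/
theorem l2Inner_const_eq_quadLocal {T : Cell n} (hT : ∀ i, T.lo i < T.hi i) {u : Form n k}
    (hu : u ∈ Qform n k) (a : Alt n k) :
    l2Inner T.toSet u (fun _ => a) = quadLocal T u fun _ => a := by
  have hg : (fun x => altInner (u x) a) ∈ Q1 n := by
    have : (fun x => altInner (u x) a) =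
        ∑ σ : Fin k ↪o Fin n, a (basisVec σ) • coef u σ := by
      funext x
      simp [altInner, coef, mul_comm]
      rfl
    rw [this]
    exact Submodule.sum_mem _ fun σ _ => Submodule.smul_mem _ _ (hu σ)
  have h1 := T.setIntegral_of_mem_Q1 hg
  rw [Cell.planeMeasure_eq_volume hT] at h1
  simp only [l2Inner, quadLocal]
  rw [h1, T.sum_vertices hg, Cell.card_vertices hT, Cell.volume_toSet hT]
  push_cast
  field_simp

theorem l2Inner_eq_quadForm (hM : IsCubicalMesh Ω 𝒯) {u w : Broken 𝒯 k}
    (hu : u ∈ Q1minusMesh 𝒯 k) (hw : w ∈ piecewiseConst 𝒯 k) :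
    l2Inner Ω (glue u) (glue w) = quadForm 𝒯 u w := by
  rw [hM.l2Inner_eq (fun T => (contDiff_of_mem_Q1minus (hu.1 T)).continuous)
    (continuous_of_mem_piecewiseConst hw)]
  refine Finset.sum_congr rfl fun T _ => ?_
  obtain ⟨a, ha⟩ := hw T
  rw [ha]
  exact l2Inner_const_eq_quadLocal (hM.lt T.1 T.2) (Q1minus_le_Qform (hu.1 T)) a

end Projection

section Coderivative
variable {n k : ℕ} {Ω : Set (Vec n)} {𝒯 : Finset (Cell n)}

instance : FiniteDimensional ℝ (S1plusMesh 𝒯 k) := by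
  let L : S1plusMesh 𝒯 k →ₗ[ℝ] 𝒯 → Kform n k :=
    LinearMap.pi fun T => ((LinearMap.proj T).comp (S1plusMesh 𝒯 k).subtype).codRestrict _
      fun u => mem_Kform_of_mem_S1plusMesh u.2 T
  have hQ : IsNoetherian ℝ (Kform n k) := isNoetherian_of_isNoetherianRing_of_finite ℝ (Kform n k)
  have hQ' : IsNoetherian ℝ (𝒯 → Kform n k) := isNoetherian_pi (M := fun _ : 𝒯 => Kform n k)
  exact Module.Finite.of_injective L fun u v huv =>
    Subtype.ext (funext fun T => congrArg Subtype.val (congrFun huv T))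

/-- A definite bilinear form on a finite-dimensional space represents every linear family of
functionals. -/
theorem existsUnique_represent {V E : Type*} [AddCommGroup V] [Module ℝ V] [FiniteDimensional ℝ V]
    [AddCommGroup E] [Module ℝ E] (B : LinearMap.BilinForm ℝ V) (hB : ∀ u, B u u = 0 → u = 0)
    (L : E →ₗ[ℝ] V →ₗ[ℝ] ℝ) : ∃! D : E →ₗ[ℝ] V, ∀ u τ, B (D u) τ = L u τ := by
  have hinj : Injective B := (injective_iff_map_eq_zero B).2 fun u hu => hB u (by rw [hu]; rfl)
  have hsurj : Surjective B :=
    (LinearMap.injective_iff_surjective_of_finrank_eq_finrank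
      (Subspace.dual_finrank_eq (K := ℝ) (V := V)).symm).1 hinj
  set e := LinearEquiv.ofBijective B ⟨hinj, hsurj⟩ with he
  refine ⟨e.symm.toLinearMap ∘ₗ L, fun u τ => ?_, fun D hD => LinearMap.ext fun u => ?_⟩
  · exact LinearMap.congr_fun (e.apply_symm_apply (L u)) τ
  · refine hinj (LinearMap.ext fun τ => ?_)
    rw [hD u τ]
    exact (LinearMap.congr_fun (e.apply_symm_apply (L u)) τ).symm

theorem eq_zero_of_quadForm_self (hM : IsCubicalMesh Ω 𝒯) {u : Broken 𝒯 k}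
    (hu : u ∈ S1plusMesh 𝒯 k) (h : quadForm 𝒯 u u = 0) : u = 0 := by
  funext T
  have h1 := (Finset.sum_eq_zero_iff_of_nonneg fun T _ => quadLocal_self_nonneg T.1 (u T)).1 h T
    (Finset.mem_univ T)
  exact eq_zero_of_vertices (mem_Kform_of_mem_S1plusMesh hu T) (hM.lt T.1 T.2) fun y hy =>
    eq_zero_of_quadLocal_self (hM.lt T.1 T.2) h1 hy

theorem IsCubicalMesh.l2Inner_glue_add_left (hM : IsCubicalMesh Ω 𝒯) {u v w : Broken 𝒯 k}
    (hu : ∀ T, Continuous (u T)) (hv : ∀ T, Continuous (v T)) (hw : ∀ T, Continuous (w T)) :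
    l2Inner Ω (glue (u + v)) (glue w) =
      l2Inner Ω (glue u) (glue w) + l2Inner Ω (glue v) (glue w) := by
  rw [hM.l2Inner_eq (u := u + v) (fun T => (hu T).add (hv T)) hw, hM.l2Inner_eq hu hw, hM.l2Inner_eq hv hw,
    ← Finset.sum_add_distrib]
  exact Finset.sum_congr rfl fun T _ => l2Inner_add_left T.1 (hu T) (hv T) (hw T)

theorem IsCubicalMesh.l2Inner_glue_smul_left (hM : IsCubicalMesh Ω 𝒯) (c : ℝ) {u v : Broken 𝒯 k}
    (hu : ∀ T, Continuous (u T)) (hv : ∀ T, Continuous (v T)) :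
    l2Inner Ω (glue (c • u)) (glue v) = c * l2Inner Ω (glue u) (glue v) := by
  rw [hM.l2Inner_eq (u := c • u) (fun T => (hu T).const_smul c) hv, hM.l2Inner_eq hu hv, Finset.mul_sum]
  exact Finset.sum_congr rfl fun T _ => l2Inner_smul_left _ c _ _

theorem continuous_brokenD {u : Broken 𝒯 k} (hu : u ∈ S1plusMesh 𝒯 k) (T : 𝒯) :
    Continuous (brokenD u T) :=
  (contDiff_extDeriv (contDiff_of_mem_S1plus (hu.1 T))).continuous

theorem brokenD_add {u v : Broken 𝒯 k} (hu : u ∈ S1plusMesh 𝒯 k) (hv : v ∈ S1plusMesh 𝒯 k) :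
    brokenD (u + v) = brokenD u + brokenD v :=
  funext fun T => extDeriv_add_of_contDiff (contDiff_of_mem_S1plus (hu.1 T))
    (contDiff_of_mem_S1plus (hv.1 T))

theorem brokenD_smul (c : ℝ) (u : Broken 𝒯 k) : brokenD (c • u) = c • brokenD u :=
  funext fun T => extDeriv_smul' c (u T)

/-- The pairing `(u, τ) ↦ ⟨u, dτ⟩`. -/
def derivPairing (hM : IsCubicalMesh Ω 𝒯) :
    Q1minusMesh 𝒯 (k + 1) →ₗ[ℝ] S1plusMesh 𝒯 k →ₗ[ℝ] ℝ :=
  have hc := fun (u : Q1minusMesh 𝒯 (k + 1)) T =>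
    (contDiff_of_mem_Q1minus (u.2.1 T)).continuous
  have hd := fun (τ : S1plusMesh 𝒯 k) => continuous_brokenD τ.2
  LinearMap.mk₂ ℝ (fun u τ => l2Inner Ω (glue u.1) (glue (brokenD τ.1)))
    (fun u u' τ => hM.l2Inner_glue_add_left (hc u) (hc u') (hd τ))
    (fun c u τ => hM.l2Inner_glue_smul_left c (hc u) (hd τ))
    (fun u τ τ' => by
      simp only [l2Inner_comm Ω (glue u.1)]
      rw [← hM.l2Inner_glue_add_left (hd τ) (hd τ') (hc u), ← brokenD_add τ.2 τ'.2]
      rfl)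
    (fun c u τ => by
      simp only [l2Inner_comm Ω (glue u.1)]
      rw [smul_eq_mul, ← hM.l2Inner_glue_smul_left c (hd τ) (hc u), ← brokenD_smul]
      rfl)

theorem existsUnique_discreteCoderivative (hM : IsCubicalMesh Ω 𝒯) :
    ∃! D : Q1minusMesh 𝒯 (k + 1) →ₗ[ℝ] S1plusMesh 𝒯 k, IsDiscreteCoderivative Ω D := by
  let B : LinearMap.BilinForm ℝ (S1plusMesh 𝒯 k) :=
    (quadForm 𝒯).domRestrict₁₂ (S1plusMesh 𝒯 k) (S1plusMesh 𝒯 k)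
  have hB : ∀ u, B u u = 0 → u = 0 := fun u hu =>
    Subtype.ext (eq_zero_of_quadForm_self hM u.2 hu)
  exact existsUnique_represent (V := S1plusMesh 𝒯 k) (E := Q1minusMesh 𝒯 (k + 1)) B hB
    (derivPairing hM)

/-- Testing with the function of `𝒮₁⁺Λ^k(𝒯)` that has the values of `D u - D u'` at one vertex `x`
and vanishes at all other vertices isolates the values at `x`. -/
theorem IsDiscreteCoderivative.isLocalAtVertices (hM : IsCubicalMesh Ω 𝒯)
    {D : Q1minusMesh 𝒯 (k + 1) →ₗ[ℝ] S1plusMesh 𝒯 k} (hD : IsDiscreteCoderivative Ω D) :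
    IsLocalAtVertices D := by
  classical
  intro x u u' huu' T₀ hT₀
  set v : S1plusMesh 𝒯 k := D u - D u' with hv
  have hex : ∀ T : 𝒯, ∃ w ∈ S1plus n k, ∀ y ∈ T.1.vertices,
      w y = if y = x then v.1 T x else 0 := fun T =>
    exists_S1plus_vertex (hM.lt T.1 T.2) fun y => if y = x then v.1 T x else 0
  choose τ hτ hτv using hex
  have hτm : τ ∈ S1plusMesh 𝒯 k := by
    refine mem_S1plusMesh_iff.2 ⟨hτ, fun f hf T T' hT hT' y hy => ?_⟩
    have e1 := hτv T y (hT.vertices_subset hy)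
    have e2 := hτv T' y (hT'.vertices_subset hy)
    simp only [coef, e1, e2]
    split_ifs with hyx
    · exact (mem_S1plusMesh_iff.1 v.2).2 f hf T T' hT hT' x (hyx ▸ hy)
    · rfl
  have hτ0 : ∀ T : 𝒯, x ∉ T.1.vertices → τ T = 0 := fun T hx =>
    eq_zero_of_vertices (S1plus_le_Kform (hτ T)) (hM.lt T.1 T.2) fun y hy => by
      rw [hτv T y hy, if_neg]
      rintro rfl
      exact hx hy
  have hcu := fun (u : Q1minusMesh 𝒯 (k + 1)) T => (contDiff_of_mem_Q1minus (u.2.1 T)).continuous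
  have hrhs : l2Inner Ω (glue u.1) (glue (brokenD τ)) =
      l2Inner Ω (glue u'.1) (glue (brokenD τ)) := by
    rw [hM.l2Inner_eq (hcu u) (continuous_brokenD hτm),
      hM.l2Inner_eq (hcu u') (continuous_brokenD hτm)]
    refine Finset.sum_congr rfl fun T _ => ?_
    by_cases hx : x ∈ T.1.vertices
    · exact setIntegral_congr_fun T.1.isCompact_toSet.measurableSet fun y hy => by
        simp only [huu' T hx hy]
    · have h0 : brokenD τ T = 0 := by
        have := extDeriv_smul' 0 (τ T)
        rw [zero_smul, zero_smul] at this
        change extDeriv (τ T) = 0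
        rwa [hτ0 T hx]
      rw [h0]
      simp [l2Inner, altInner]
  have hlhs : quadForm 𝒯 v.1 τ = 0 := by
    have h1 := hD u ⟨τ, hτm⟩
    have h2 := hD u' ⟨τ, hτm⟩
    have h3 : quadForm 𝒯 v.1 τ = quadForm 𝒯 (D u).1 τ - quadForm 𝒯 (D u').1 τ :=
      LinearMap.BilinForm.sub_left _ _ _
    rw [h3]
    exact sub_eq_zero.2 (h1.trans (hrhs.trans h2.symm))
  have hloc : ∀ T : 𝒯, quadLocal T.1 (v.1 T) (τ T) =
      if x ∈ T.1.vertices then ((2 : ℝ) ^ n)⁻¹ * volume.real T.1.toSet *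
        altInner (v.1 T x) (v.1 T x) else 0 := by
    intro T
    split_ifs with hx
    · unfold quadLocal
      rw [Finset.sum_eq_single x]
      · rw [hτv T x hx, if_pos rfl]
      · intro y hy hyx
        rw [hτv T y hy, if_neg hyx]
        simp [altInner]
      · exact fun h => absurd hx h
    · rw [hτ0 T hx]
      simp [quadLocal, altInner]
  rw [quadForm_apply] at hlhs
  simp only [hloc] at hlhs
  have h1 := (Finset.sum_eq_zero_iff_of_nonneg fun T _ => by
    split_ifs
    · exact mul_nonneg (quadLocal_weight_pos (hM.lt T.1 T.2)).le (altInner_self_nonneg _)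
    · exact le_rfl).1 hlhs T₀ (Finset.mem_univ T₀)
  rw [if_pos hT₀] at h1
  have h2 := altInner_self_eq_zero
    ((mul_eq_zero.1 h1).resolve_left (quadLocal_weight_pos (hM.lt T₀.1 T₀.2)).ne')
  exact sub_eq_zero.1 h2

theorem quadForm_sq_le (u v : Broken 𝒯 k) :
    quadForm 𝒯 u v ^ 2 ≤ quadForm 𝒯 u u * quadForm 𝒯 v v :=
  LinearMap.BilinForm.apply_sq_le_of_symm _ quadForm_self_nonneg
    ⟨fun u v => quadForm_comm u v⟩ u v

theorem sqrt_le_mul_sqrt {K x y : ℝ} (hK : 1 ≤ K) (hy : 0 ≤ y) (h : x ≤ K * y) :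
    √x ≤ K * √y := by
  have hK0 : 0 ≤ K := by linarith
  calc √x ≤ √(K ^ 2 * y) := Real.sqrt_le_sqrt (h.trans (by nlinarith [mul_nonneg hK0 hy]))
    _ = K * √y := by rw [Real.sqrt_mul (sq_nonneg K), Real.sqrt_sq hK0]

end Coderivative

end CubicalFEEC

end

theorem mainTheorem10 (n k : ℕ) (hk : k + 1 ≤ n) (ρ : ℝ) :
    ∃ C : ℝ, 0 < C ∧ ∀ (Ω : Set (Vec n)) (𝒯 : Finset (Cell n)),
      IsCubicalMesh Ω 𝒯 → ShapeRegular ρ 𝒯 →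
      -- the discrete spaces are subspaces of `HΛ(Ω)`, and `d V_h^k ⊆ V_h^{k+1}`
      ((∀ τ ∈ S1plusMesh 𝒯 k,
          MemHLambda Ω (glue τ)
            (glue (brokenD τ)) ∧
          brokenD τ ∈ Q1minusMesh 𝒯 (k + 1)) ∧
        (∀ u ∈ Q1minusMesh 𝒯 (k + 1),
          MemHLambda Ω (glue u)
            (glue (brokenD u)))) ∧
      -- condition (A)
      ((∀ σ ∈ S1plusMesh 𝒯 k, ∀ τ ∈ S1plusMesh 𝒯 k,
          quadForm 𝒯 σ τ = quadForm 𝒯 τ σ ∧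
          |quadForm 𝒯 σ τ| ≤ C * l2Norm Ω (glue σ) *
            l2Norm Ω (glue τ)) ∧
        (∀ τ ∈ S1plusMesh 𝒯 k,
          l2Norm Ω (glue τ) ^ 2 ≤ C * quadForm 𝒯 τ τ ∧
          quadNorm τ ≤ C * l2Norm Ω (glue τ) ∧
          l2Norm Ω (glue τ) ≤ C * quadNorm τ)) ∧
      -- condition (B)
      (Q1minusMesh 𝒯 k ≤ S1plusMesh 𝒯 k ∧
        (∀ τ₀ ∈ piecewiseConst 𝒯 k,
          MemL2 Ω (glue τ₀)) ∧
        (∀ τ ∈ Q1minusMesh 𝒯 k, ∀ τ₀ ∈ piecewiseConst 𝒯 k,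
          l2Inner Ω (glue τ) (glue τ₀) =
            quadForm 𝒯 τ τ₀) ∧
        (∃! P : S1plusMesh 𝒯 k →ₗ[ℝ] Q1minusMesh 𝒯 k,
          PreservesDOF P) ∧
        (∀ P : S1plusMesh 𝒯 k →ₗ[ℝ] Q1minusMesh 𝒯 k,
          PreservesDOF P → ∀ τ : S1plusMesh 𝒯 k,
            brokenD (P τ).1 = brokenD τ.1 ∧
            l2Norm Ω (glue (P τ).1) ≤
              C * l2Norm Ω (glue τ.1) ∧
            (∀ τ₀ ∈ piecewiseConst 𝒯 k,
              quadForm 𝒯 (P τ).1 τ₀ = quadForm 𝒯 τ.1 τ₀))) ∧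
      -- the discrete coderivative is well defined and local
      ((∃! D : Q1minusMesh 𝒯 (k + 1) →ₗ[ℝ] S1plusMesh 𝒯 k,
          IsDiscreteCoderivative Ω D) ∧
        (∀ D : Q1minusMesh 𝒯 (k + 1) →ₗ[ℝ] S1plusMesh 𝒯 k,
          IsDiscreteCoderivative Ω D → IsLocalAtVertices D)) := by
  have hn : 0 < n := by omega
  obtain ⟨K, hK1, hK⟩ := exists_local_norm_equivalence hn k ρ
  have hK0 : 0 < K := by linarith
  refine ⟨K, hK0, fun Ω 𝒯 hM hρ => ?_⟩
  have hne : ∀ {u : Broken 𝒯 k}, u ∈ S1plusMesh 𝒯 k →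
      l2Inner Ω (glue u) (glue u) ≤ K * quadForm 𝒯 u u ∧
        quadForm 𝒯 u u ≤ K * l2Inner Ω (glue u) (glue u) := fun {u} hu =>
    norm_equivalence hM hρ hK (mem_Kform_of_mem_S1plusMesh hu)
  refine ⟨⟨fun τ hτ => ⟨hM.memHLambda hn hτ, brokenD_mem_Q1minusMesh hτ⟩,
    fun u hu => hM.memHLambda hn (Q1minusMesh_le_S1plusMesh hu)⟩, ⟨?_, ?_⟩,
    ⟨Q1minusMesh_le_S1plusMesh, fun τ₀ h => memL2_glue (continuous_of_mem_piecewiseConst h),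
      fun τ hτ τ₀ hτ₀ => l2Inner_eq_quadForm hM hτ hτ₀, existsUnique_preservesDOF hM, ?_⟩,
    existsUnique_discreteCoderivative hM, fun D hD => hD.isLocalAtVertices hM⟩
  · intro σ hσ τ hτ
    refine ⟨quadForm_comm σ τ, abs_le_of_sq_le_sq ?_ (by unfold l2Norm; positivity)⟩
    rw [l2Norm, l2Norm, mul_pow, mul_pow, Real.sq_sqrt (l2Inner_self_nonneg Ω _),
      Real.sq_sqrt (l2Inner_self_nonneg Ω _)]
    calc quadForm 𝒯 σ τ ^ 2 ≤ quadForm 𝒯 σ σ * quadForm 𝒯 τ τ := quadForm_sq_le σ τ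
      _ ≤ (K * l2Inner Ω (glue σ) (glue σ)) * (K * l2Inner Ω (glue τ) (glue τ)) :=
        mul_le_mul (hne hσ).2 (hne hτ).2 (quadForm_self_nonneg τ)
          (mul_nonneg hK0.le (l2Inner_self_nonneg Ω _))
      _ = _ := by ring
  · intro τ hτ
    refine ⟨?_, sqrt_le_mul_sqrt hK1 (l2Inner_self_nonneg Ω _) (hne hτ).2,
      sqrt_le_mul_sqrt hK1 (quadForm_self_nonneg τ) (hne hτ).1⟩
    rw [l2Norm, Real.sq_sqrt (l2Inner_self_nonneg Ω _)]
    exact (hne hτ).1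
  · intro P hP τ
    rw [hP.eq_meshProj hM]
    refine ⟨brokenD_meshProj hM τ, ?_, fun τ₀ hτ₀ => quadForm_meshProj_const hM τ hτ₀⟩
    refine Real.sqrt_le_iff.2 ⟨by unfold l2Norm; positivity, ?_⟩
    rw [l2Norm, mul_pow, Real.sq_sqrt (l2Inner_self_nonneg Ω _)]
    calc l2Inner Ω (glue (meshProj hM τ).1) (glue (meshProj hM τ).1)
        ≤ K * quadForm 𝒯 (meshProj hM τ).1 (meshProj hM τ).1 :=
          (hne (Q1minusMesh_le_S1plusMesh (meshProj hM τ).2)).1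
      _ ≤ K * quadForm 𝒯 τ.1 τ.1 := by gcongr; exact quadForm_meshProj_le hM τ
      _ ≤ K * (K * l2Inner Ω (glue τ.1) (glue τ.1)) := by gcongr; exact (hne τ.2).2
      _ = K ^ 2 * l2Inner Ω (glue τ.1) (glue τ.1) := by ring
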